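/- Let $d\ge 3$ and $\alpha>2$, and write $\langle x\rangle=\sqrt{1+|x|^2}$ for $x\in\mathbb{R}^d$. There is a constant $\delta_0=\delta_0(d,\alpha)>0$ with the following property. Let $V:\mathbb{R}^d\to\mathbb{R}$ be a measurable function whose positive and negative parts $V_+=\max(V,0)$ and $V_-=\max(-V,0)$ satisfy, for some $C>0$ and some $0<\delta\le\delta_0$, $$V_+(x)\le C\langle x\rangle^{-\alpha},\qquad V_-(x)\le\delta\langle x\rangle^{-\alpha}\qquad\text{for almost every }x\in\mathbb{R}^d .$$ Then the operator $H=-\tfrac12\Delta+V$ on $L^2(\mathbb{R}^d;\mathbb{C})$ with domain $H^2(\mathbb{R}^d)$ has no eigenvalues (neither nonpositive nor positive), and $0$ is not a resonance of $H$. The latter means that the only distributional solution $u$ of $(-\tfrac12\Delta+V)u=0$ that belongs to $\langle x\rangle^{\nu}L^2(\mathbb{R}^d;\mathbb{C})=\{\langle\cdot\rangle^{\nu}g : g\in L^2(\mathbb{R}^d;\mathbb{C})\}$ for every $\nu>\tfrac12$ is $u=0$. -/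

import Mathlib

noncomputable section

namespace Schrodinger

open MeasureTheory TemperedDistribution
open scoped SchwartzMap Laplacian ENNReal ContDiff

/-- The Euclidean space `ℝ^d`. -/
abbrev Space (d : ℕ) : Type := EuclideanSpace ℝ (Fin d)

/-- The Hilbert space `L²(ℝ^d; ℂ)`. -/
abbrev L2 (d : ℕ) : Type := Lp ℂ 2 (volume : Measure (Space d))

/-- The Japanese bracket `⟨x⟩ = √(1 + |x|²)`. -/
def bracket {d : ℕ} (x : Space d) : ℝ := Real.sqrt (1 + ‖x‖ ^ 2)

/-- The tempered distribution defined by an element of `L²(ℝ^d; ℂ)`. -/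
abbrev toDistr {d : ℕ} (φ : L2 d) : 𝓢'(Space d, ℂ) := Lp.toTemperedDistribution φ

theorem toDistr_injective {d : ℕ} {φ ψ : L2 d} (h : toDistr φ = toDistr ψ) : φ = ψ := by
  have hk := Lp.ker_toTemperedDistributionCLM_eq_bot (E := Space d) (F := ℂ)
    (μ := (volume : Measure (Space d))) (p := 2)
  exact LinearMap.ker_eq_bot.mp hk h

theorem toDistr_add {d : ℕ} (φ ψ : L2 d) : toDistr (φ + ψ) = toDistr φ + toDistr ψ :=
  (Lp.toTemperedDistributionCLM ℂ (volume : Measure (Space d)) 2).map_add φ ψ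

theorem toDistr_smul {d : ℕ} (c : ℂ) (φ : L2 d) : toDistr (c • φ) = c • toDistr φ :=
  (Lp.toTemperedDistributionCLM ℂ (volume : Measure (Space d)) 2).map_smul c φ

theorem toDistr_zero {d : ℕ} : toDistr (0 : L2 d) = 0 :=
  (Lp.toTemperedDistributionCLM ℂ (volume : Measure (Space d)) 2).map_zero

/-- The Sobolev space `H²(ℝ^d)` as a subspace of `L²(ℝ^d; ℂ)`. -/
def sobolevTwo (d : ℕ) : Submodule ℂ (L2 d) where
  carrier := {φ | MemSobolev 2 2 (toDistr φ)}
  zero_mem' := by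
    simp only [Set.mem_ofPred_eq, toDistr_zero]
    exact memSobolev_fun_zero _ _ 2 2
  add_mem' := by
    intro φ ψ hφ hψ
    simp only [Set.mem_ofPred_eq, toDistr_add] at *
    exact hφ.add hψ
  smul_mem' := by
    intro c φ hφ
    simp only [Set.mem_ofPred_eq, toDistr_smul] at *
    exact hφ.smul c

theorem exists_laplacian {d : ℕ} (φ : sobolevTwo d) :
    ∃ ψ : L2 d, toDistr ψ = Δ (toDistr (φ : L2 d)) := by
  have h : MemSobolev 2 2 (toDistr (φ : L2 d)) := φ.2
  have h' := h.laplacian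
  rw [sub_self, memSobolev_zero_iff] at h'
  obtain ⟨ψ, hψ⟩ := h'
  exact ⟨ψ, hψ.symm⟩

/-- For `φ ∈ H²(ℝ^d)`, the element of `L²(ℝ^d; ℂ)` that represents the distribution `Δφ`. -/
def laplacianFun {d : ℕ} (φ : sobolevTwo d) : L2 d := (exists_laplacian φ).choose

theorem toDistr_laplacianFun {d : ℕ} (φ : sobolevTwo d) :
    toDistr (laplacianFun φ) = Δ (toDistr (φ : L2 d)) := (exists_laplacian φ).choose_spec

/-- The Laplacian as an unbounded operator on `L²(ℝ^d; ℂ)` with domain `H²(ℝ^d)`. -/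
def laplacianOp (d : ℕ) : L2 d →ₗ.[ℂ] L2 d where
  domain := sobolevTwo d
  toFun :=
    { toFun := laplacianFun
      map_add' := by
        intro φ ψ
        apply toDistr_injective
        rw [toDistr_add, toDistr_laplacianFun, toDistr_laplacianFun, toDistr_laplacianFun,
          Submodule.coe_add, toDistr_add, ← laplacianCLM_apply, map_add]
        simp only [laplacianCLM_apply]
      map_smul' := by
        intro c φ
        apply toDistr_injective
        rw [RingHom.id_apply, toDistr_smul, toDistr_laplacianFun, toDistr_laplacianFun,
          Submodule.coe_smul, toDistr_smul, ← laplacianCLM_apply, map_smul]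
        simp only [laplacianCLM_apply] }

/-- The maximal domain `{φ ∈ L² | V φ ∈ L²}` of the multiplication by the real function `V`. -/
def potentialDomain {d : ℕ} (V : Space d → ℝ) : Submodule ℂ (L2 d) where
  carrier := {φ | MemLp (fun x ↦ (V x : ℂ) * φ x) 2 volume}
  zero_mem' := by
    refine MemLp.ae_eq (f := 0) ?_ MemLp.zero
    filter_upwards [Lp.coeFn_zero ℂ 2 (volume : Measure (Space d))] with x hx
    rw [hx, Pi.zero_apply, mul_zero]
  add_mem' := by
    intro φ ψ hφ hψ
    refine MemLp.ae_eq ?_ (MemLp.add hφ hψ)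
    filter_upwards [Lp.coeFn_add φ ψ] with x hx
    rw [hx, Pi.add_apply, Pi.add_apply, mul_add]
  smul_mem' := by
    intro c φ hφ
    refine MemLp.ae_eq ?_ (MemLp.const_smul hφ c)
    filter_upwards [Lp.coeFn_smul c φ] with x hx
    rw [hx, Pi.smul_apply, Pi.smul_apply, smul_eq_mul, smul_eq_mul, mul_left_comm]

/-- For `φ` in the maximal domain, the element `V φ` of `L²(ℝ^d; ℂ)`. -/
def potentialFun {d : ℕ} (V : Space d → ℝ) (φ : potentialDomain V) : L2 d :=
  MemLp.toLp (fun x ↦ (V x : ℂ) * (φ : L2 d) x) φ.2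

theorem coeFn_potentialFun {d : ℕ} (V : Space d → ℝ) (φ : potentialDomain V) :
    potentialFun V φ =ᵐ[volume] fun x ↦ (V x : ℂ) * (φ : L2 d) x :=
  MemLp.coeFn_toLp φ.2

/-- Multiplication by the real function `V` as an unbounded operator on `L²(ℝ^d; ℂ)`, with its
maximal domain. -/
def potentialOp {d : ℕ} (V : Space d → ℝ) : L2 d →ₗ.[ℂ] L2 d where
  domain := potentialDomain V
  toFun :=
    { toFun := potentialFun V
      map_add' := by
        intro φ ψ
        apply Lp.ext
        filter_upwards [coeFn_potentialFun V (φ + ψ), coeFn_potentialFun V φ,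
          coeFn_potentialFun V ψ, Lp.coeFn_add (φ : L2 d) (ψ : L2 d),
          Lp.coeFn_add (potentialFun V φ) (potentialFun V ψ)] with x h1 h2 h3 h4 h5
        rw [h1, h5, Submodule.coe_add, h4, Pi.add_apply, Pi.add_apply, h2, h3, mul_add]
      map_smul' := by
        intro c φ
        apply Lp.ext
        filter_upwards [coeFn_potentialFun V (c • φ), coeFn_potentialFun V φ,
          Lp.coeFn_smul c (φ : L2 d), Lp.coeFn_smul c (potentialFun V φ)] with x h1 h2 h3 h4
        rw [RingHom.id_apply, h1, h4, Submodule.coe_smul, h3, Pi.smul_apply, Pi.smul_apply, h2,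
          smul_eq_mul, smul_eq_mul, mul_left_comm] }

/-- The Schrödinger operator `H = -½ Δ + V` on `L²(ℝ^d; ℂ)`, with domain
`{φ ∈ H²(ℝ^d) | V φ ∈ L²}` (which is `H²(ℝ^d)` when `V` is measurable and bounded). -/
def hamiltonian {d : ℕ} (V : Space d → ℝ) : L2 d →ₗ.[ℂ] L2 d :=
  (-(1 / 2 : ℂ)) • laplacianOp d + potentialOp V

theorem mem_hamiltonian_domain {d : ℕ} {V : Space d → ℝ} {φ : L2 d} :
    φ ∈ (hamiltonian V).domain ↔ φ ∈ sobolevTwo d ∧ φ ∈ potentialDomain V := Iff.rfl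

theorem hamiltonian_apply {d : ℕ} {V : Space d → ℝ} (φ : L2 d) (h : φ ∈ (hamiltonian V).domain)
    (h₁ : φ ∈ sobolevTwo d) (h₂ : φ ∈ potentialDomain V) :
    hamiltonian V ⟨φ, h⟩ = (-(1 / 2 : ℂ)) • laplacianFun ⟨φ, h₁⟩ + potentialFun V ⟨φ, h₂⟩ := by
  unfold hamiltonian
  rw [LinearPMap.add_apply, LinearPMap.smul_apply]
  rfl

/-- `z` is an eigenvalue of the unbounded operator `A`: there is a nonzero `φ` in the domain of `A`
with `A φ = z φ`. -/
def IsEigenvalue {X : Type*} [AddCommGroup X] [Module ℂ X] (A : X →ₗ.[ℂ] X) (z : ℂ) : Prop :=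
  ∃ φ : A.domain, (φ : X) ≠ 0 ∧ A φ = z • (φ : X)

/-- `u` lies in `⟨x⟩^ν L²(ℝ^d; ℂ)`. -/
def MemWeightedL2 {d : ℕ} (ν : ℝ) (u : Space d → ℂ) : Prop :=
  MemLp (fun x ↦ ((bracket x ^ (-ν) : ℝ) : ℂ) * u x) 2 volume

/-- `u` solves `(-½ Δ + V) u = 0` on `ℝ^d` in the sense of distributions; the distributions `u` and
`V u` are required to be given by locally integrable functions. -/
def IsZeroEnergySolution {d : ℕ} (V : Space d → ℝ) (u : Space d → ℂ) : Prop :=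
  LocallyIntegrable u volume ∧
  LocallyIntegrable (fun x ↦ (V x : ℂ) * u x) volume ∧
  ∀ η : Space d → ℂ, ContDiff ℝ ∞ η → HasCompactSupport η →
    ∫ x, (u x * (-(1 / 2 : ℂ) * (Δ η) x) + (V x : ℂ) * u x * η x) = 0

/-- `-½ Δ + V` has a resonance at `0`: the equation `(-½ Δ + V) u = 0` has a nonzero distributional
solution that lies in `⟨x⟩^ν L²` for every `ν > 1/2`. (Solutions in `L²` are not excluded.) -/
def HasZeroResonance {d : ℕ} (V : Space d → ℝ) : Prop :=
  ∃ u : Space d → ℂ, ¬ (u =ᵐ[volume] 0) ∧ (∀ ν : ℝ, 1 / 2 < ν → MemWeightedL2 ν u) ∧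
    IsZeroEnergySolution V u

end Schrodinger

end

/-! The real and imaginary parts of an eigenfunction or of a resonance solve `Δu = g` weakly, with
`u` and `g` locally square integrable. For real energy `E` the parts decouple and `g = 2(V - E)u`.
Each inequality below is proved for smooth functions in a form containing no derivative of `u`
except `Δu`, and then passes to the limit along mollifications. Throughout, `sig x = ⟨x⟩²`.

Energy `E ≤ 0`, and resonances at `0`: testing with `χ²u` for a cutoff `χ` at scale `R` and applying
Hardy's inequality, the negative part of `V` is absorbed once `δ ≤ 1/16`. What remains is bounded by
`R⁻² ∫ u²` over `|x| ≤ 2R`, which tends to zero when `u ∈ ⟨x⟩^ν L²` for some `ν < 1`; the choice `ν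
= 3/4` covers eigenfunctions and resonances alike (`eq_zero_of_form_nonneg`).

Nonreal energy: this is the symmetry of `H`, in the form of a Wronskian identity for the real and
imaginary parts (`eq_zero_of_wronskian`).

Energy `E > 0`: here `|Δu + k²u| ≤ M⟨x⟩⁻²|u|` with `k² = 2E`, and a Carleman estimate is used
(`carleman_identity`, `carleman_inequality`). The weight is `e^ρ` with `ρ = τ(σ/(1+εσ))^(1/3)`, `σ =
⟨x⟩²`. It behaves like `τ|x|^(2/3)` until `εσ` is of order one and then saturates. Being bounded, it
lets the outer cutoff be removed for a function that is merely in `L²`. Letting `τ → ∞` makes `u`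
vanish outside a ball of arbitrarily small radius, so growth at infinity and unique continuation are
handled by one estimate (`helmholtz_annulus_eq_zero`). -/

noncomputable section

namespace Schrodinger

open MeasureTheory Filter Topology
open scoped ContDiff Laplacian Convolution

variable {d : ℕ}

/-! ### Calculus of smooth functions: Green's identity, the Euler field, the Pohozaev identity -/

/-- The partial derivative `∂ᵢ f`. -/
def pd (i : Fin d) (f : Space d → ℝ) : Space d → ℝ :=
  fun x ↦ fderiv ℝ f x (EuclideanSpace.single i 1)

/-- The Laplacian, as the sum of the second partial derivatives. -/
def lap (f : Space d → ℝ) : Space d → ℝ := fun x ↦ ∑ i, pd i (pd i f) x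

/-- The scalar product `∇f · ∇g`. -/
def gradDot (f g : Space d → ℝ) : Space d → ℝ := fun x ↦ ∑ i, pd i f x * pd i g x

/-- The Euler field `x · ∇f`. -/
def euler (f : Space d → ℝ) : Space d → ℝ := fun x ↦ ∑ i, x i * pd i f x

theorem contDiff_pd {f : Space d → ℝ} (hf : ContDiff ℝ ∞ f) (i : Fin d) :
    ContDiff ℝ ∞ (pd i f) := by
  have h : ContDiff ℝ ∞ (fderiv ℝ f) := hf.fderiv_right (by simp)
  exact h.clm_apply contDiff_const

theorem contDiff_lap {f : Space d → ℝ} (hf : ContDiff ℝ ∞ f) : ContDiff ℝ ∞ (lap f) :=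
  ContDiff.sum fun i _ ↦ contDiff_pd (contDiff_pd hf i) i

theorem contDiff_gradDot {f g : Space d → ℝ} (hf : ContDiff ℝ ∞ f) (hg : ContDiff ℝ ∞ g) :
    ContDiff ℝ ∞ (gradDot f g) :=
  ContDiff.sum fun i _ ↦ (contDiff_pd hf i).mul (contDiff_pd hg i)

theorem contDiff_coord (i : Fin d) : ContDiff ℝ ∞ (fun x : Space d ↦ x i) :=
  contDiff_piLp_apply 2

theorem contDiff_euler {f : Space d → ℝ} (hf : ContDiff ℝ ∞ f) : ContDiff ℝ ∞ (euler f) :=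
  ContDiff.sum fun i _ ↦ (contDiff_coord i).mul (contDiff_pd hf i)

theorem two_le_smooth : (2 : WithTop ℕ∞) ≤ ∞ := WithTop.coe_le_coe.2 le_top

theorem differentiableAt_of_smooth {f : Space d → ℝ} (hf : ContDiff ℝ ∞ f) (x : Space d) :
    DifferentiableAt ℝ f x :=
  (hf.differentiable (by simp)) x

theorem pd_mul {f g : Space d → ℝ} (hf : ContDiff ℝ ∞ f) (hg : ContDiff ℝ ∞ g) (i : Fin d) :
    pd i (fun x ↦ f x * g x) = fun x ↦ pd i f x * g x + f x * pd i g x := by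
  ext x
  unfold pd
  rw [fderiv_fun_mul (differentiableAt_of_smooth hf x) (differentiableAt_of_smooth hg x)]
  simp only [add_apply, smul_apply, smul_eq_mul]
  ring

theorem pd_add {f g : Space d → ℝ} (hf : ContDiff ℝ ∞ f) (hg : ContDiff ℝ ∞ g) (i : Fin d) :
    pd i (fun x ↦ f x + g x) = fun x ↦ pd i f x + pd i g x := by
  ext x
  unfold pd
  rw [fderiv_fun_add (differentiableAt_of_smooth hf x) (differentiableAt_of_smooth hg x)]
  rfl

theorem pd_sum {ι : Type*} (s : Finset ι) {f : ι → Space d → ℝ}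
    (hf : ∀ j, ContDiff ℝ ∞ (f j)) (i : Fin d) :
    pd i (fun x ↦ ∑ j ∈ s, f j x) = fun x ↦ ∑ j ∈ s, pd i (f j) x := by
  ext x
  unfold pd
  rw [fderiv_fun_sum fun j _ ↦ differentiableAt_of_smooth (hf j) x]
  simp

theorem pd_comp {f : Space d → ℝ} (hf : ContDiff ℝ ∞ f) {h : ℝ → ℝ} {h' : ℝ} {x : Space d}
    (hh : HasDerivAt h h' (f x)) (i : Fin d) :
    pd i (fun y ↦ h (f y)) x = h' * pd i f x := by
  have := hh.comp_hasFDerivAt x (differentiableAt_of_smooth hf x).hasFDerivAt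
  unfold pd
  rw [show (fun y ↦ h (f y)) = h ∘ f from rfl, this.fderiv]
  simp

theorem pd_const (c : ℝ) (i : Fin d) : pd i (fun _ : Space d ↦ c) = fun _ ↦ 0 := by
  ext x
  simp [pd]

theorem pd_const_mul (c : ℝ) {f : Space d → ℝ} (hf : ContDiff ℝ ∞ f) (i : Fin d) :
    pd i (fun x ↦ c * f x) = fun x ↦ c * pd i f x := by
  rw [pd_mul contDiff_const hf, pd_const]
  simp

theorem pd_coord (i j : Fin d) :
    pd i (fun x : Space d ↦ x j) = fun _ ↦ if i = j then 1 else 0 := by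
  ext x
  have : HasFDerivAt (fun x : Space d ↦ x j) (EuclideanSpace.proj j : Space d →L[ℝ] ℝ) x :=
    (EuclideanSpace.proj j : Space d →L[ℝ] ℝ).hasFDerivAt
  unfold pd
  rw [this.fderiv]
  simp [eq_comm]

theorem pd_comm {f : Space d → ℝ} (hf : ContDiff ℝ ∞ f) (i j : Fin d) :
    pd i (pd j f) = pd j (pd i f) := by
  ext x
  have hd : DifferentiableAt ℝ (fderiv ℝ f) x :=
    ((hf.fderiv_right (m := ∞) (by simp)).differentiable (by simp)) x
  have h : ∀ v w : Space d, fderiv ℝ (fun y ↦ fderiv ℝ f y v) x w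
      = fderiv ℝ (fderiv ℝ f) x w v := by
    intro v w
    rw [fderiv_clm_apply hd (differentiableAt_const v)]
    simp
  unfold pd
  rw [h, h]
  exact (hf.contDiffAt.isSymmSndFDerivAt (by simpa using two_le_smooth)).eq _ _

theorem hasCompactSupport_pd {f : Space d → ℝ} (hf : HasCompactSupport f) (i : Fin d) :
    HasCompactSupport (pd i f) :=
  hf.fderiv_apply (𝕜 := ℝ) _

theorem integrable_of_smooth {f : Space d → ℝ} (hf : ContDiff ℝ ∞ f) (hc : HasCompactSupport f) :
    Integrable f :=
  hf.continuous.integrable_of_hasCompactSupport hc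

theorem integral_pd_eq_zero {f : Space d → ℝ} (hf : ContDiff ℝ ∞ f) (hc : HasCompactSupport f)
    (i : Fin d) : ∫ x, pd i f x = 0 := by
  have h := integral_mul_fderiv_eq_neg_fderiv_mul_of_integrable (μ := (volume : Measure (Space d)))
    (f := fun _ ↦ (1 : ℝ)) (g := f) (v := EuclideanSpace.single i 1) (by simp)
    (by simpa only [one_mul] using!
      integrable_of_smooth (contDiff_pd hf i) (hasCompactSupport_pd hc i))
    (by simpa using integrable_of_smooth hf hc) (fun x _ ↦ differentiableAt_const _)
    (fun x _ ↦ differentiableAt_of_smooth hf x)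
  simpa [pd] using h

theorem gradDot_comm (f g : Space d → ℝ) (x : Space d) : gradDot f g x = gradDot g f x := by
  simp only [gradDot, mul_comm]

theorem gradDot_self_nonneg (f : Space d → ℝ) (x : Space d) : 0 ≤ gradDot f f x :=
  Finset.sum_nonneg fun _ _ ↦ mul_self_nonneg _

/-- Green's identity. -/
theorem integral_mul_lap {f g : Space d → ℝ} (hf : ContDiff ℝ ∞ f) (hg : ContDiff ℝ ∞ g)
    (hc : HasCompactSupport f) : ∫ x, f x * lap g x = -∫ x, gradDot f g x := by
  have h : ∀ i, ∫ x, (pd i f x * pd i g x + f x * pd i (pd i g) x) = 0 := by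
    intro i
    have := integral_pd_eq_zero (hf.mul (contDiff_pd hg i)) hc.mul_right i
    rwa [pd_mul hf (contDiff_pd hg i)] at this
  have i1 : ∀ i, Integrable fun x ↦ pd i f x * pd i g x := fun i ↦
    integrable_of_smooth ((contDiff_pd hf i).mul (contDiff_pd hg i))
      (hasCompactSupport_pd hc i).mul_right
  have i2 : ∀ i, Integrable fun x ↦ f x * pd i (pd i g) x := fun i ↦
    integrable_of_smooth (hf.mul (contDiff_pd (contDiff_pd hg i) i)) hc.mul_right
  simp only [lap, gradDot, Finset.mul_sum]
  rw [integral_finsetSum _ fun i _ ↦ i1 i, integral_finsetSum _ fun i _ ↦ i2 i,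
    ← Finset.sum_neg_distrib]
  refine Finset.sum_congr rfl fun i _ ↦ ?_
  have := h i
  rw [integral_add (i1 i) (i2 i)] at this
  linarith

theorem hasCompactSupport_sum {f : Fin d → Space d → ℝ} (hf : ∀ i, HasCompactSupport (f i)) :
    HasCompactSupport (fun x ↦ ∑ i, f i x) := by
  have : ∀ s : Finset (Fin d), HasCompactSupport (fun x ↦ ∑ i ∈ s, f i x) := by
    intro s
    induction s using Finset.cons_induction with
    | empty => exact HasCompactSupport.zero
    | cons a s ha ih =>
      simp only [Finset.sum_cons]
      exact (hf a).add ih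
  exact this _

theorem hasCompactSupport_euler {f : Space d → ℝ} (hf : HasCompactSupport f) :
    HasCompactSupport (euler f) :=
  hasCompactSupport_sum fun i ↦ (hasCompactSupport_pd hf i).mul_left

theorem hasCompactSupport_lap {f : Space d → ℝ} (hf : HasCompactSupport f) :
    HasCompactSupport (lap f) :=
  hasCompactSupport_sum fun i ↦ hasCompactSupport_pd (hasCompactSupport_pd hf i) i

theorem hasCompactSupport_gradDot {f g : Space d → ℝ} (hf : HasCompactSupport f) :
    HasCompactSupport (gradDot f g) :=
  hasCompactSupport_sum fun i ↦ (hasCompactSupport_pd hf i).mul_right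

/-- The divergence of the field `x` is `d`. -/
theorem integral_euler {f : Space d → ℝ} (hf : ContDiff ℝ ∞ f) (hc : HasCompactSupport f) :
    ∫ x, euler f x = -(d * ∫ x, f x) := by
  have h : ∀ i : Fin d, ∫ x, x i * pd i f x = -∫ x, f x := by
    intro i
    have := integral_pd_eq_zero ((contDiff_coord i).mul hf) hc.mul_left i
    rw [pd_mul (contDiff_coord i) hf, pd_coord] at this
    simp only [if_true, one_mul] at this
    rw [integral_add (integrable_of_smooth hf hc)] at this
    · linarith
    · exact integrable_of_smooth ((contDiff_coord i).mul (contDiff_pd hf i))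
        (hasCompactSupport_pd hc i).mul_left
  simp only [euler]
  rw [integral_finsetSum]
  · simp [h]
  · exact fun i _ ↦ integrable_of_smooth ((contDiff_coord i).mul (contDiff_pd hf i))
        (hasCompactSupport_pd hc i).mul_left

theorem euler_mul {f g : Space d → ℝ} (hf : ContDiff ℝ ∞ f) (hg : ContDiff ℝ ∞ g) :
    euler (fun x ↦ f x * g x) = fun x ↦ euler f x * g x + f x * euler g x := by
  ext x
  simp only [euler, pd_mul hf hg, Finset.sum_mul, Finset.mul_sum, ← Finset.sum_add_distrib]
  exact Finset.sum_congr rfl fun i _ ↦ by ring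

theorem euler_add {f g : Space d → ℝ} (hf : ContDiff ℝ ∞ f) (hg : ContDiff ℝ ∞ g) :
    euler (fun x ↦ f x + g x) = fun x ↦ euler f x + euler g x := by
  ext x
  simp only [euler, pd_add hf hg, ← Finset.sum_add_distrib]
  exact Finset.sum_congr rfl fun i _ ↦ by ring

theorem euler_const_mul (c : ℝ) {f : Space d → ℝ} (hf : ContDiff ℝ ∞ f) :
    euler (fun x ↦ c * f x) = fun x ↦ c * euler f x := by
  ext x
  simp only [euler, pd_const_mul c hf, Finset.mul_sum]
  exact Finset.sum_congr rfl fun i _ ↦ by ring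

theorem euler_const (c : ℝ) : euler (fun _ : Space d ↦ c) = fun _ ↦ 0 := by
  ext x
  simp [euler, pd_const]

theorem euler_comp {f : Space d → ℝ} (hf : ContDiff ℝ ∞ f) {h : ℝ → ℝ} {h' : ℝ} {x : Space d}
    (hh : HasDerivAt h h' (f x)) : euler (fun y ↦ h (f y)) x = h' * euler f x := by
  simp only [euler, pd_comp hf hh, Finset.mul_sum]
  exact Finset.sum_congr rfl fun i _ ↦ by ring

/-- The commutator of `∂ᵢ` with `x · ∇` is `∂ᵢ`, which produces the first term; the rest is `∇w · (x
· ∇)∇w`, half the Euler derivative of `|∇w|²`. -/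
theorem gradDot_euler_self {w : Space d → ℝ} (hw : ContDiff ℝ ∞ w) (x : Space d) :
    gradDot (euler w) w x = gradDot w w x + euler (gradDot w w) x / 2 := by
  have h1 : ∀ i, pd i (euler w) x = pd i w x + ∑ j, x j * pd j (pd i w) x := by
    intro i
    unfold euler
    rw [pd_sum _ fun j ↦ (contDiff_coord j).mul (contDiff_pd hw j)]
    simp only [pd_mul (contDiff_coord _) (contDiff_pd hw _), pd_coord, Finset.sum_add_distrib,
      pd_comm hw i]
    simp
  have h2 : ∀ j, pd j (gradDot w w) x = ∑ i, 2 * (pd j (pd i w) x * pd i w x) := by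
    intro j
    unfold gradDot
    rw [pd_sum _ fun i ↦ (contDiff_pd hw i).mul (contDiff_pd hw i)]
    simp only [pd_mul (contDiff_pd hw _) (contDiff_pd hw _)]
    exact Finset.sum_congr rfl fun i _ ↦ by ring
  have h3 : euler (gradDot w w) x / 2 = ∑ i, (∑ j, x j * pd j (pd i w) x) * pd i w x := by
    simp only [euler, h2, Finset.mul_sum, Finset.sum_mul, Finset.sum_div]
    rw [Finset.sum_comm]
    exact Finset.sum_congr rfl fun i _ ↦ Finset.sum_congr rfl fun j _ ↦ by ring
  rw [h3]
  simp only [gradDot, h1, ← Finset.sum_add_distrib]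
  exact Finset.sum_congr rfl fun i _ ↦ by ring

/-- The Pohozaev identity. -/
theorem integral_euler_mul_lap {w : Space d → ℝ} (hw : ContDiff ℝ ∞ w)
    (hc : HasCompactSupport w) :
    ∫ x, euler w x * lap w x = (d / 2 - 1) * ∫ x, gradDot w w x := by
  have hG := contDiff_gradDot hw hw
  have hGc : HasCompactSupport (gradDot w w) := hasCompactSupport_gradDot hc
  rw [integral_mul_lap (contDiff_euler hw) hw (hasCompactSupport_euler hc)]
  simp only [gradDot_euler_self hw]
  rw [integral_add (integrable_of_smooth hG hGc), integral_div, integral_euler hG hGc]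
  · ring
  · exact (integrable_of_smooth (contDiff_euler hG) (hasCompactSupport_euler hGc)).div_const 2

/-- Since `2w (x · ∇w) = x · ∇(w²)`, the field `b x` is integrated by parts, and its divergence is
`d b + x · ∇b`. -/
theorem integral_mul_euler_mul {b w : Space d → ℝ} (hb : ContDiff ℝ ∞ b) (hw : ContDiff ℝ ∞ w)
    (hc : HasCompactSupport w) :
    ∫ x, 2 * (b x * (w x * euler w x)) = -∫ x, (d * b x + euler b x) * w x ^ 2 := by
  have hw2 := hw.mul hw
  have h := integral_euler (hb.mul hw2) (hc.mul_right (f' := w)).mul_left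
  rw [euler_mul hb hw2, euler_mul hw hw, ← integral_const_mul, ← integral_neg] at h
  have i1 : Integrable fun x ↦ 2 * (b x * (w x * euler w x)) :=
    (integrable_of_smooth (hb.mul (hw.mul (contDiff_euler hw)))
      (hc.mul_right (f' := euler w)).mul_left).const_mul 2
  have i2 : Integrable fun x ↦ (d * b x + euler b x) * w x ^ 2 :=
    integrable_of_smooth (((contDiff_const.mul hb).add (contDiff_euler hb)).mul (hw.pow 2))
      (by simp only [pow_two]; exact (hc.mul_right (f' := w)).mul_left)
  have i3 : Integrable fun x ↦ -(d * (b x * (w x * w x))) :=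
    ((integrable_of_smooth (hb.mul hw2) (hc.mul_right (f' := w)).mul_left).const_mul _).neg
  have e : (fun x ↦ euler b x * (w x * w x) + b x * (euler w x * w x + w x * euler w x))
    = fun x ↦ (2 * (b x * (w x * euler w x)) + (d * b x + euler b x) * w x ^ 2)
      + -(d * (b x * (w x * w x))) := by
    ext x; ring
  rw [e, integral_add (by exact i1.add i2) i3, integral_add i1 i2] at h
  linarith

theorem lap_mul {f g : Space d → ℝ} (hf : ContDiff ℝ ∞ f) (hg : ContDiff ℝ ∞ g) (x : Space d) :
    lap (fun x ↦ f x * g x) x = f x * lap g x + 2 * gradDot f g x + lap f x * g x := by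
  simp only [lap, gradDot, pd_mul hf hg, Finset.mul_sum, Finset.sum_mul,
    ← Finset.sum_add_distrib]
  refine Finset.sum_congr rfl fun i _ ↦ ?_
  rw [pd_add ((contDiff_pd hf i).mul hg) (hf.mul (contDiff_pd hg i)),
    pd_mul (contDiff_pd hf i) hg, pd_mul hf (contDiff_pd hg i)]
  ring

theorem laplacian_eq_lap {f : Space d → ℝ} (hf : ContDiff ℝ ∞ f) : Δ f = lap f := by
  ext x
  rw [InnerProductSpace.laplacian_eq_iteratedFDeriv_orthonormalBasis f
    (EuclideanSpace.basisFun (Fin d) ℝ)]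
  simp only [lap]
  refine Finset.sum_congr rfl fun i _ ↦ ?_
  have hd : DifferentiableAt ℝ (fderiv ℝ f) x :=
    ((hf.fderiv_right (m := ∞) (by simp)).differentiable (by simp)) x
  rw [iteratedFDeriv_two_apply]
  unfold pd
  rw [fderiv_clm_apply hd (differentiableAt_const _)]
  simp

theorem laplacian_ofReal {f : Space d → ℝ} (hf : ContDiff ℝ ∞ f) (x : Space d) :
    Δ (fun x ↦ (f x : ℂ)) x = (lap f x : ℂ) := by
  have h := (hf.contDiffAt (x := x)).of_le (m := 2) two_le_smooth
  have := h.laplacian_CLM_comp_left (l := Complex.ofRealCLM)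
  rw [show (fun x ↦ (f x : ℂ)) = Complex.ofRealCLM ∘ f from rfl, this, laplacian_eq_lap hf]
  rfl

/-! ### Weak Laplacian, mollification and local `L²` convergence -/

/-- `g = Δu` in the sense of distributions. -/
structure IsWeakLap (u g : Space d → ℝ) : Prop where
  left : LocallyIntegrable u
  right : LocallyIntegrable g
  eq : ∀ η : Space d → ℝ, ContDiff ℝ ∞ η → HasCompactSupport η →
    ∫ x, u x * lap η x = ∫ x, g x * η x

/-- Square integrability on every ball centred at the origin. -/
def LocL2 (f : Space d → ℝ) : Prop :=
  ∀ R : ℝ, MemLp f 2 (volume.restrict (Metric.ball 0 R))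

theorem pd_comp_const_sub {f : Space d → ℝ} (hf : ContDiff ℝ ∞ f) (x : Space d) (i : Fin d) :
    pd i (fun y ↦ f (x - y)) = fun y ↦ -pd i f (x - y) := by
  ext y
  have h1 : HasFDerivAt (fun y : Space d ↦ x - y) (-ContinuousLinearMap.id ℝ (Space d)) y :=
    (hasFDerivAt_id y).const_sub x
  have := (differentiableAt_of_smooth hf (x - y)).hasFDerivAt.comp y h1
  unfold pd
  rw [show (fun y ↦ f (x - y)) = f ∘ (fun y ↦ x - y) from rfl, this.fderiv]
  simp

theorem contDiff_comp_const_sub {f : Space d → ℝ} (hf : ContDiff ℝ ∞ f) (x : Space d) :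
    ContDiff ℝ ∞ fun y ↦ f (x - y) :=
  hf.comp (contDiff_const.sub contDiff_id)

theorem lap_comp_const_sub {f : Space d → ℝ} (hf : ContDiff ℝ ∞ f) (x y : Space d) :
    lap (fun y ↦ f (x - y)) y = lap f (x - y) := by
  simp only [lap]
  refine Finset.sum_congr rfl fun i _ ↦ ?_
  have h : (fun y ↦ -pd i f (x - y)) = fun y ↦ (-1) * pd i f (x - y) := by ext; ring
  rw [pd_comp_const_sub hf, h, pd_const_mul _ (contDiff_comp_const_sub (contDiff_pd hf i) x),
    pd_comp_const_sub (contDiff_pd hf i)]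
  ring

theorem hasCompactSupport_comp_const_sub {f : Space d → ℝ} (hf : HasCompactSupport f)
    (x : Space d) : HasCompactSupport fun y ↦ f (x - y) :=
  hf.comp_homeomorph (Homeomorph.subLeft x)

/-- The convolution `φ ⋆ u` with respect to Lebesgue measure. -/
def conv (φ u : Space d → ℝ) : Space d → ℝ := φ ⋆[ContinuousLinearMap.lsmul ℝ ℝ, volume] u

theorem conv_apply (φ u : Space d → ℝ) (x : Space d) :
    conv φ u x = ∫ y, φ y * u (x - y) := rfl

theorem conv_apply_swap (φ u : Space d → ℝ) (x : Space d) :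
    conv φ u x = ∫ y, φ (x - y) * u y := by
  unfold conv
  rw [convolution_lsmul_swap]
  rfl

theorem contDiff_conv {φ u : Space d → ℝ} (hφ : ContDiff ℝ ∞ φ) (hc : HasCompactSupport φ)
    (hu : LocallyIntegrable u) : ContDiff ℝ ∞ (conv φ u) :=
  hc.contDiff_convolution_left _ hφ hu

theorem pd_conv {φ u : Space d → ℝ} (hφ : ContDiff ℝ ∞ φ) (hc : HasCompactSupport φ)
    (hu : LocallyIntegrable u) (i : Fin d) : pd i (conv φ u) = conv (pd i φ) u := by
  ext x
  have h := hc.hasFDerivAt_convolution_left (ContinuousLinearMap.lsmul ℝ ℝ : ℝ →L[ℝ] ℝ →L[ℝ] ℝ)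
    (hφ.of_le (by simp)) hu x
  have hex := ((hc.fderiv ℝ).convolutionExists_left
    ((ContinuousLinearMap.lsmul ℝ ℝ : ℝ →L[ℝ] ℝ →L[ℝ] ℝ).precompL (Space d))
    (hφ.continuous_fderiv (by simp)) hu) x
  unfold pd
  rw [show conv φ u = φ ⋆[ContinuousLinearMap.lsmul ℝ ℝ, volume] u from rfl, h.fderiv,
    convolution_def, ContinuousLinearMap.integral_apply hex, conv_apply]
  rfl

theorem conv_sum {ι : Type*} (s : Finset ι) {φ : ι → Space d → ℝ} {u : Space d → ℝ}
    (hφ : ∀ i, ContDiff ℝ ∞ (φ i)) (hc : ∀ i, HasCompactSupport (φ i))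
    (hu : LocallyIntegrable u) (x : Space d) :
    conv (fun y ↦ ∑ i ∈ s, φ i y) u x = ∑ i ∈ s, conv (φ i) u x := by
  simp only [conv_apply, Finset.sum_mul]
  exact integral_finsetSum _ fun i _ ↦ (hc i).convolutionExists_left
    (ContinuousLinearMap.lsmul ℝ ℝ : ℝ →L[ℝ] ℝ →L[ℝ] ℝ) (hφ i).continuous hu x

theorem IsWeakLap.lap_conv {u g φ : Space d → ℝ} (h : IsWeakLap u g) (hφ : ContDiff ℝ ∞ φ)
    (hc : HasCompactSupport φ) : lap (conv φ u) = conv φ g := by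
  ext x
  have h1 : lap (conv φ u) x = conv (lap φ) u x := by
    unfold lap
    rw [conv_sum _ (fun i ↦ contDiff_pd (contDiff_pd hφ i) i)
      (fun i ↦ hasCompactSupport_pd (hasCompactSupport_pd hc i) i) h.left]
    refine Finset.sum_congr rfl fun i _ ↦ ?_
    rw [pd_conv hφ hc h.left, pd_conv (contDiff_pd hφ i) (hasCompactSupport_pd hc i) h.left]
  have h2 := h.eq _ (contDiff_comp_const_sub hφ x) (hasCompactSupport_comp_const_sub hc x)
  simp only [lap_comp_const_sub hφ] at h2
  rw [h1, conv_apply_swap, conv_apply_swap]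
  simpa only [mul_comm] using h2

/-- Jensen's inequality for the convolution with a probability density. -/
theorem sq_conv_le {φ f : Space d → ℝ} (hφ : Continuous φ) (hc : HasCompactSupport φ)
    (h0 : ∀ x, 0 ≤ φ x) (h1 : ∫ x, φ x = 1) (hf : LocallyIntegrable f)
    (hf2 : LocallyIntegrable fun x ↦ f x ^ 2) (x : Space d) :
    conv φ f x ^ 2 ≤ conv φ (fun x ↦ f x ^ 2) x := by
  have e1 : Integrable fun y ↦ φ y * f (x - y) := hc.convolutionExists_left
    (ContinuousLinearMap.lsmul ℝ ℝ : ℝ →L[ℝ] ℝ →L[ℝ] ℝ) hφ hf x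
  have e2 : Integrable fun y ↦ φ y * f (x - y) ^ 2 := hc.convolutionExists_left
    (ContinuousLinearMap.lsmul ℝ ℝ : ℝ →L[ℝ] ℝ →L[ℝ] ℝ) hφ hf2 x
  have e3 : Integrable φ := hφ.integrable_of_hasCompactSupport hc
  set c := conv φ f x with hcdef
  -- The variance about the mean `c` is nonnegative.
  have h : 0 ≤ ∫ y, φ y * (f (x - y) - c) ^ 2 :=
    integral_nonneg fun y ↦ mul_nonneg (h0 y) (sq_nonneg _)
  have e : (fun y ↦ φ y * (f (x - y) - c) ^ 2)
      = fun y ↦ φ y * f (x - y) ^ 2 - 2 * c * (φ y * f (x - y)) + c ^ 2 * φ y := by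
    ext y; ring
  rw [e, integral_add (by exact e2.sub (e1.const_mul _)) (e3.const_mul _),
    integral_sub e2 (e1.const_mul _), integral_const_mul, integral_const_mul, h1,
    ← conv_apply φ f, ← conv_apply φ fun x ↦ f x ^ 2, ← hcdef] at h
  linarith

/-- A sequence of bump functions with shrinking supports. -/
def bump (d : ℕ) (n : ℕ) : ContDiffBump (0 : Space d) where
  rIn := 1 / (2 * (n + 1))
  rOut := 1 / (n + 1)
  rIn_pos := by positivity
  rIn_lt_rOut := by
    apply one_div_lt_one_div_of_lt <;> linarith [n.cast_nonneg (α := ℝ)]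

/-- The `n`-th mollification of `u`. -/
def mollify (n : ℕ) (u : Space d → ℝ) : Space d → ℝ := conv ((bump d n).normed volume) u

theorem contDiff_mollify {u : Space d → ℝ} (hu : LocallyIntegrable u) (n : ℕ) :
    ContDiff ℝ ∞ (mollify n u) :=
  contDiff_conv (bump d n).contDiff_normed (bump d n).hasCompactSupport_normed hu

theorem IsWeakLap.lap_mollify {u g : Space d → ℝ} (h : IsWeakLap u g) (n : ℕ) :
    lap (mollify n u) = mollify n g :=
  h.lap_conv (bump d n).contDiff_normed (bump d n).hasCompactSupport_normed

theorem tendsto_mollify_ae {f : Space d → ℝ} (hf : LocallyIntegrable f) :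
    ∀ᵐ x, Tendsto (fun n ↦ mollify n f x) atTop (𝓝 (f x)) := by
  refine ContDiffBump.ae_convolution_tendsto_right_of_locallyIntegrable (K := 2) ?_ ?_ hf
  · exact tendsto_one_div_add_atTop_nhds_zero_nat
  · refine Eventually.of_forall fun n ↦ le_of_eq ?_
    simp only [bump]
    field_simp

theorem sq_mollify_le {f : Space d → ℝ} (hf : MemLp f 2) (n : ℕ) (x : Space d) :
    mollify n f x ^ 2 ≤ mollify n (fun x ↦ f x ^ 2) x :=
  sq_conv_le (bump d n).continuous_normed (bump d n).hasCompactSupport_normed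
    (bump d n).nonneg_normed (bump d n).integral_normed (hf.locallyIntegrable (by norm_num))
    hf.integrable_sq.locallyIntegrable x

theorem integrable_mollify {f : Space d → ℝ} (hf : Integrable f) (n : ℕ) :
    Integrable (mollify n f) :=
  (ContDiffBump.integrable_normed (bump d n)).integrable_convolution _ hf

theorem integrable_sq_mollify_sub {f : Space d → ℝ} (hf : MemLp f 2) (n : ℕ) :
    Integrable fun x ↦ (mollify n f x - f x) ^ 2 := by
  have hc := (contDiff_mollify (hf.locallyIntegrable (by norm_num)) n).continuous
  refine Integrable.mono' (((integrable_mollify hf.integrable_sq n).add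
    hf.integrable_sq).const_mul 2) ((hc.aestronglyMeasurable.sub hf.1).pow 2)
    (Eventually.of_forall fun x ↦ ?_)
  rw [Real.norm_of_nonneg (sq_nonneg _)]
  simp only [Pi.add_apply]
  nlinarith [sq_mollify_le hf n x, sq_nonneg (mollify n f x + f x)]

/-- Fatou's lemma is applied to the functions `2(f²)ₙ + 2f² - (fₙ - f)²`, nonnegative by Jensen's
inequality. They converge almost everywhere to `4f²`, and mollification preserves `∫ f²`, so `∫ (fₙ
- f)²` is forced to tend to zero. -/
theorem tendsto_integral_sq_mollify_sub {f : Space d → ℝ} (hf : MemLp f 2) :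
    Tendsto (fun n ↦ ∫ x, (mollify n f x - f x) ^ 2) atTop (𝓝 0) := by
  have hf1 : LocallyIntegrable f := hf.locallyIntegrable (by norm_num)
  have hf2 : Integrable fun x ↦ f x ^ 2 := hf.integrable_sq
  have hm2 : ∀ n, Integrable (mollify n fun x ↦ f x ^ 2) := integrable_mollify hf2
  have hi2 : ∀ n, ∫ x, mollify n (fun x ↦ f x ^ 2) x = ∫ x, f x ^ 2 := by
    intro n
    have := integral_convolution (ContinuousLinearMap.lsmul ℝ ℝ : ℝ →L[ℝ] ℝ →L[ℝ] ℝ)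
      (ContDiffBump.integrable_normed (bump d n) (μ := volume)) hf2
    rw [ContDiffBump.integral_normed] at this
    simpa [mollify, conv] using this
  have hj := sq_mollify_le hf
  have hint := integrable_sq_mollify_sub hf
  set A := ∫ x, f x ^ 2 with hA
  set F : ℕ → Space d → ℝ := fun n x ↦
    2 * mollify n (fun x ↦ f x ^ 2) x + 2 * f x ^ 2 - (mollify n f x - f x) ^ 2 with hF
  have hF0 : ∀ n x, 0 ≤ F n x := fun n x ↦ by
    simp only [hF]
    nlinarith [hj n x, sq_nonneg (mollify n f x + f x)]
  have hFi : ∀ n, Integrable (F n) := fun n ↦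
    (((hm2 n).const_mul 2).add (hf2.const_mul 2)).sub (hint n)
  have hFI : ∀ n, ∫ x, F n x = 4 * A - ∫ x, (mollify n f x - f x) ^ 2 := by
    intro n
    simp only [hF]
    rw [integral_sub (by exact ((hm2 n).const_mul 2).add (hf2.const_mul 2)) (hint n),
      integral_add ((hm2 n).const_mul 2) (hf2.const_mul 2), integral_const_mul,
      integral_const_mul, hi2]
    ring
  have hle : ∀ n, ∫ x, (mollify n f x - f x) ^ 2 ≤ 4 * A := fun n ↦ by
    have := integral_nonneg (μ := (volume : Measure (Space d))) (f := F n) fun x ↦ hF0 n x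
    rw [hFI] at this
    linarith
  have hfatou : ENNReal.ofReal (4 * A) ≤
      liminf (fun n ↦ ENNReal.ofReal (4 * A - ∫ x, (mollify n f x - f x) ^ 2)) atTop := by
    calc ENNReal.ofReal (4 * A) = ∫⁻ x, ENNReal.ofReal (4 * f x ^ 2) := by
          rw [← ofReal_integral_eq_lintegral_ofReal (hf2.const_mul 4)
            (Eventually.of_forall fun x ↦ by positivity), integral_const_mul]
      _ = ∫⁻ x, liminf (fun n ↦ ENNReal.ofReal (F n x)) atTop := by
          refine lintegral_congr_ae ?_
          filter_upwards [tendsto_mollify_ae hf1, tendsto_mollify_ae hf2.locallyIntegrable]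
            with x h1 h2
          refine (Tendsto.liminf_eq ?_).symm
          refine ENNReal.tendsto_ofReal ?_
          have := ((h2.const_mul 2).add_const (2 * f x ^ 2)).sub ((h1.sub_const (f x)).pow 2)
          convert this using 2
          ring
      _ ≤ liminf (fun n ↦ ∫⁻ x, ENNReal.ofReal (F n x)) atTop :=
          lintegral_liminf_le' fun n ↦ (hFi n).aestronglyMeasurable.aemeasurable.ennreal_ofReal
      _ = _ := by
          congr 1
          ext n
          rw [← ofReal_integral_eq_lintegral_ofReal (hFi n) (Eventually.of_forall (hF0 n)), hFI]
  have hI0 : ∀ n, 0 ≤ ∫ x, (mollify n f x - f x) ^ 2 := fun n ↦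
    integral_nonneg fun x ↦ sq_nonneg _
  rw [Metric.tendsto_atTop']
  intro ε hε
  have hd : ∀ n, dist (∫ x, (mollify n f x - f x) ^ 2) 0 = ∫ x, (mollify n f x - f x) ^ 2 := by
    intro n
    rw [Real.dist_eq, sub_zero, abs_of_nonneg (hI0 n)]
  simp only [hd]
  rcases lt_or_ge (4 * A) ε with h | h
  · exact ⟨0, fun n _ ↦ (hle n).trans_lt h⟩
  · have hlt : ENNReal.ofReal (4 * A - ε) < ENNReal.ofReal (4 * A) :=
      (ENNReal.ofReal_lt_ofReal_iff (by linarith)).2 (by linarith)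
    obtain ⟨N, hN⟩ := eventually_atTop.1 (eventually_lt_of_lt_liminf (hlt.trans_le hfatou))
    refine ⟨N, fun n hn ↦ ?_⟩
    by_contra hcon
    have := hN n hn.le
    rw [lt_iff_not_ge] at this
    exact this (ENNReal.ofReal_le_ofReal (by linarith))

theorem LocL2.locallyIntegrable {f : Space d → ℝ} (hf : LocL2 f) : LocallyIntegrable f := by
  intro x
  refine ⟨Metric.ball 0 (‖x‖ + 1), Metric.isOpen_ball.mem_nhds (by simp), ?_⟩
  have : IsFiniteMeasure (volume.restrict (Metric.ball (0 : Space d) (‖x‖ + 1))) :=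
    isFiniteMeasure_restrict.2 measure_ball_lt_top.ne
  exact (hf (‖x‖ + 1)).integrable (by norm_num)

theorem LocL2.integrableOn_sq {f : Space d → ℝ} (hf : LocL2 f) (R : ℝ) :
    IntegrableOn (fun x ↦ f x ^ 2) (Metric.ball 0 R) :=
  (hf R).integrable_sq

theorem locL2_of_continuous {f : Space d → ℝ} (hf : Continuous f) : LocL2 f := by
  intro R
  have : IsFiniteMeasure (volume.restrict (Metric.ball (0 : Space d) R)) :=
    isFiniteMeasure_restrict.2 measure_ball_lt_top.ne
  obtain ⟨C, hC⟩ := (isCompact_closedBall (0 : Space d) R).exists_bound_of_continuousOn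
    hf.continuousOn
  refine MemLp.of_bound hf.aestronglyMeasurable C ?_
  filter_upwards [ae_restrict_mem measurableSet_ball] with x hx
  exact hC x (Metric.ball_subset_closedBall hx)

theorem LocL2.add {f g : Space d → ℝ} (hf : LocL2 f) (hg : LocL2 g) :
    LocL2 fun x ↦ f x + g x := fun R ↦ (hf R).add (hg R)

theorem LocL2.sub {f g : Space d → ℝ} (hf : LocL2 f) (hg : LocL2 g) :
    LocL2 fun x ↦ f x - g x := fun R ↦ (hf R).sub (hg R)

theorem LocL2.const_mul {f : Space d → ℝ} (hf : LocL2 f) (c : ℝ) :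
    LocL2 fun x ↦ c * f x := fun R ↦ (hf R).const_mul c

theorem LocL2.of_le {f g : Space d → ℝ} (hf : LocL2 f) (hg : AEStronglyMeasurable g volume)
    {M : ℝ} (h : ∀ᵐ x, |g x| ≤ M * |f x|) : LocL2 g := fun R ↦
  (hf R).of_le_mul hg.restrict (ae_restrict_of_ae h)

theorem LocL2.integrableOn_mul {f g : Space d → ℝ} (hf : LocL2 f) (hg : LocL2 g) (R : ℝ) :
    IntegrableOn (fun x ↦ f x * g x) (Metric.ball 0 R) :=
  (hf R).integrable_mul (hg R)

theorem integrable_mul_of_locL2 {b f g : Space d → ℝ} (hb : Continuous b)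
    (hc : HasCompactSupport b) (hf : LocL2 f) (hg : LocL2 g) :
    Integrable fun x ↦ b x * (f x * g x) := by
  obtain ⟨R, hR⟩ := hc.isBounded.subset_ball (0 : Space d)
  obtain ⟨K, hK⟩ := hc.exists_bound_of_continuous hb
  have h : IntegrableOn (fun x ↦ b x * (f x * g x)) (Metric.ball 0 R) :=
    (hf.integrableOn_mul hg R).bdd_mul hb.aestronglyMeasurable.restrict
      (Eventually.of_forall hK)
  rwa [integrableOn_iff_integrable_of_support_subset] at h
  intro x hx
  refine hR (subset_tsupport b ?_)
  intro h0
  simp [h0] at hx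

theorem integrable_mul_sq_of_locL2 {b f : Space d → ℝ} (hb : Continuous b)
    (hc : HasCompactSupport b) (hf : LocL2 f) : Integrable fun x ↦ b x * f x ^ 2 :=
  (integrable_mul_of_locL2 hb hc hf hf).congr (Eventually.of_forall fun x ↦ by
    simp only [pow_two])

/-- Convergence in `L²` on every ball of a sequence of continuous functions. -/
structure LocTendsto (u : ℕ → Space d → ℝ) (f : Space d → ℝ) : Prop where
  cont : ∀ n, Continuous (u n)
  lim : LocL2 f
  tendsto : ∀ R : ℝ, Tendsto (fun n ↦ ∫ x in Metric.ball 0 R, (u n x - f x) ^ 2) atTop (𝓝 0)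

theorem LocTendsto.add {u v : ℕ → Space d → ℝ} {f g : Space d → ℝ} (hu : LocTendsto u f)
    (hv : LocTendsto v g) : LocTendsto (fun n x ↦ u n x + v n x) fun x ↦ f x + g x where
  cont n := (hu.cont n).add (hv.cont n)
  lim := hu.lim.add hv.lim
  tendsto R := by
    have h := ((hu.tendsto R).const_mul 2).add ((hv.tendsto R).const_mul 2)
    simp only [mul_zero, add_zero] at h
    refine squeeze_zero (fun n ↦ integral_nonneg fun x ↦ sq_nonneg _) (fun n ↦ ?_) h
    have i1 := ((locL2_of_continuous (hu.cont n)).sub hu.lim).integrableOn_sq R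
    have i2 := ((locL2_of_continuous (hv.cont n)).sub hv.lim).integrableOn_sq R
    rw [← integral_const_mul, ← integral_const_mul, ← integral_add (i1.const_mul 2)
      (i2.const_mul 2)]
    refine integral_mono_of_nonneg (Eventually.of_forall fun x ↦ sq_nonneg _)
      ((i1.const_mul 2).add (i2.const_mul 2)) (Eventually.of_forall fun x ↦ ?_)
    simp only
    nlinarith [sq_nonneg ((u n x - f x) - (v n x - g x))]

theorem LocTendsto.const_mul {u : ℕ → Space d → ℝ} {f : Space d → ℝ} (hu : LocTendsto u f)
    (c : ℝ) : LocTendsto (fun n x ↦ c * u n x) fun x ↦ c * f x where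
  cont n := (hu.cont n).const_mul c
  lim := hu.lim.const_mul c
  tendsto R := by
    have h := (hu.tendsto R).const_mul (c ^ 2)
    rw [mul_zero] at h
    refine h.congr fun n ↦ ?_
    rw [← integral_const_mul]
    congr 1
    ext x
    ring

/-- Young's inequality with parameter `ε`: the first term vanishes in the limit for fixed `ε`, and
the second is small because `f` and `g` are square integrable on balls. -/
theorem abs_mul_sub_mul_le {ε : ℝ} (hε : 0 < ε) (u v f g : ℝ) :
    |u * v - f * g| ≤ (1 / 2 + 1 / (2 * ε)) * ((u - f) ^ 2 + (v - g) ^ 2)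
      + ε / 2 * (f ^ 2 + g ^ 2) := by
  have key : ∀ a b : ℝ, |a * b| ≤ ε / 2 * a ^ 2 + 1 / (2 * ε) * b ^ 2 := by
    intro a b
    rw [abs_mul, ← sq_abs a, ← sq_abs b]
    have h : ε / 2 * |a| ^ 2 + 1 / (2 * ε) * |b| ^ 2 - |a| * |b|
        = (ε * |a| - |b|) ^ 2 / (2 * ε) := by
      field_simp
      ring
    have : 0 ≤ (ε * |a| - |b|) ^ 2 / (2 * ε) := by positivity
    linarith
  have h1 := key f (v - g)
  have h2 := key g (u - f)
  have h3 : |(u - f) * (v - g)| ≤ 1 / 2 * ((u - f) ^ 2 + (v - g) ^ 2) := by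
    rw [abs_le]
    constructor <;> nlinarith [sq_nonneg (u - f + (v - g)), sq_nonneg (u - f - (v - g))]
  have e : u * v - f * g = (u - f) * (v - g) + f * (v - g) + g * (u - f) := by ring
  rw [e]
  refine (abs_add_three _ _ _).trans ?_
  linarith

theorem LocTendsto.integral_mul {u v : ℕ → Space d → ℝ} {f g b : Space d → ℝ}
    (hu : LocTendsto u f) (hv : LocTendsto v g) (hb : Continuous b) (hc : HasCompactSupport b) :
    Tendsto (fun n ↦ ∫ x, b x * (u n x * v n x)) atTop (𝓝 (∫ x, b x * (f x * g x))) := by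
  obtain ⟨R, hR⟩ := hc.isBounded.subset_ball (0 : Space d)
  obtain ⟨K, hK⟩ := hc.exists_bound_of_continuous hb
  have hK0 : 0 ≤ K := (norm_nonneg _).trans (hK 0)
  set B := Metric.ball (0 : Space d) R
  set S := ∫ x in B, (f x ^ 2 + g x ^ 2) with hS
  have hS0 : 0 ≤ S := integral_nonneg fun x ↦ by positivity
  have hsupp : ∀ x, x ∉ B → b x = 0 := fun x hx ↦ by
    by_contra h
    exact hx (hR (subset_tsupport b h))
  have hbound : ∀ ε : ℝ, 0 < ε → ∀ n,
      |(∫ x, b x * (u n x * v n x)) - ∫ x, b x * (f x * g x)| ≤ K * ((1 / 2 + 1 / (2 * ε)) *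
      ((∫ x in B, (u n x - f x) ^ 2) + ∫ x in B, (v n x - g x) ^ 2) + ε / 2 * S) := by
    intro ε hε n
    have j1 := ((locL2_of_continuous (hu.cont n)).sub hu.lim).integrableOn_sq R
    have j2 := ((locL2_of_continuous (hv.cont n)).sub hv.lim).integrableOn_sq R
    have j3 := (hu.lim.integrableOn_sq R).add (hv.lim.integrableOn_sq R)
    rw [← integral_sub (integrable_mul_of_locL2 hb hc (locL2_of_continuous (hu.cont n))
      (locL2_of_continuous (hv.cont n))) (integrable_mul_of_locL2 hb hc hu.lim hv.lim),
      ← setIntegral_eq_integral_of_forall_compl_eq_zero (s := B)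
        (fun x hx ↦ by simp [hsupp x hx]), ← integral_add j1 j2, hS, ← integral_const_mul,
      ← integral_const_mul, ← integral_add (by exact (j1.add j2).const_mul _)
        (by exact j3.const_mul _), ← integral_const_mul]
    rw [← Real.norm_eq_abs]
    refine norm_integral_le_of_norm_le ((((j1.add j2).const_mul (1 / 2 + 1 / (2 * ε))).add
      (j3.const_mul (ε / 2))).const_mul K) (Eventually.of_forall fun x ↦ ?_)
    rw [← mul_sub, norm_mul]
    exact mul_le_mul (hK x) (abs_mul_sub_mul_le hε _ _ _ _) (norm_nonneg _) hK0
  rw [Metric.tendsto_atTop']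
  intro e he
  -- With this `ε` the Young remainder `K (ε/2) S` is at most `e/2`.
  set ε := e / (K * S + 1) with hεdef
  have hKS : 0 ≤ K * S := mul_nonneg hK0 hS0
  have hε : 0 < ε := by positivity
  have hlim := (((hu.tendsto R).add (hv.tendsto R)).const_mul
    (K * (1 / 2 + 1 / (2 * ε))))
  simp only [add_zero, mul_zero] at hlim
  obtain ⟨N, hN⟩ := eventually_atTop.1 (hlim.eventually_lt_const (half_pos he))
  refine ⟨N, fun n hn ↦ ?_⟩
  have h1 := hN n hn.le
  have h2 : K * S * ε ≤ e := by
    rw [hεdef, mul_div_assoc', div_le_iff₀ (by positivity)]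
    nlinarith
  rw [Real.dist_eq]
  refine (hbound ε hε n).trans_lt ?_
  linarith

theorem LocTendsto.integral_mul_sq {u : ℕ → Space d → ℝ} {f b : Space d → ℝ}
    (hu : LocTendsto u f) (hb : Continuous b) (hc : HasCompactSupport b) :
    Tendsto (fun n ↦ ∫ x, b x * u n x ^ 2) atTop (𝓝 (∫ x, b x * f x ^ 2)) := by
  simpa only [pow_two] using hu.integral_mul hu hb hc

theorem locTendsto_mollify {f : Space d → ℝ} (hf : LocL2 f) :
    LocTendsto (fun n ↦ mollify n f) f where
  cont n := (contDiff_mollify hf.locallyIntegrable n).continuous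
  lim := hf
  tendsto R := by
    -- The bumps have radius at most `1`, so on the ball of radius `R` the mollification sees only
    -- the values of `f` on the ball of radius `R + 1`. Truncation reduces the claim to a global
    -- `L²` function.
    set F := (Metric.ball (0 : Space d) (R + 1)).indicator f with hF
    have hFm : MemLp F 2 := (memLp_indicator_iff_restrict measurableSet_ball).2 (hf _)
    have hF1 : LocallyIntegrable F := hFm.locallyIntegrable (by norm_num)
    have hsub : LocL2 fun x ↦ F x := fun R ↦ hFm.restrict _
    have heq : ∀ n, ∀ x ∈ Metric.ball (0 : Space d) R, mollify n f x - f x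
        = mollify n F x - F x := by
      intro n x hx
      rw [mem_ball_zero_iff] at hx
      have h1 : F x = f x := Set.indicator_of_mem (by rw [mem_ball_zero_iff]; linarith) f
      rw [h1]
      congr 1
      simp only [mollify, conv_apply]
      congr 1
      ext y
      by_cases hy : y ∈ Metric.ball (0 : Space d) 1
      · rw [mem_ball_zero_iff] at hy
        rw [hF, Set.indicator_of_mem]
        rw [mem_ball_zero_iff]
        linarith [norm_sub_le x y]
      · have : (bump d n).normed volume y = 0 := by
          by_contra hne
          have hmem : y ∈ Function.support ((bump d n).normed volume) := hne
          rw [ContDiffBump.support_normed_eq] at hmem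
          refine hy (Metric.ball_subset_ball ?_ hmem)
          simp only [bump]
          rw [div_le_one (by positivity)]
          linarith [n.cast_nonneg (α := ℝ)]
        simp [this]
    refine squeeze_zero (fun n ↦ integral_nonneg fun x ↦ sq_nonneg _) (fun n ↦ ?_)
      (tendsto_integral_sq_mollify_sub hFm)
    have hint : ∫ x in Metric.ball 0 R, (mollify n f x - f x) ^ 2
        = ∫ x in Metric.ball 0 R, (mollify n F x - F x) ^ 2 :=
      setIntegral_congr_fun measurableSet_ball fun x hx ↦ by simp only [heq n x hx]
    rw [hint]
    refine setIntegral_le_integral ?_ (Eventually.of_forall fun x ↦ sq_nonneg _)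
    exact integrable_sq_mollify_sub hFm n

/-- The weak equation `Δu = g` between locally square integrable functions is approximated by
smooth functions. -/
theorem IsWeakLap.exists_approx {u g : Space d → ℝ} (h : IsWeakLap u g) (hu : LocL2 u)
    (hg : LocL2 g) : ∃ v : ℕ → Space d → ℝ, (∀ n, ContDiff ℝ ∞ (v n)) ∧ LocTendsto v u ∧
      LocTendsto (fun n ↦ lap (v n)) g := by
  refine ⟨fun n ↦ mollify n u, fun n ↦ contDiff_mollify h.left n, locTendsto_mollify hu, ?_⟩
  simp only [h.lap_mollify]
  exact locTendsto_mollify hg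

-- Cutoff identities and the Caccioppoli inequality

attribute [fun_prop] contDiff_pd contDiff_lap contDiff_gradDot contDiff_euler contDiff_coord

theorem gradDot_eq_zero_of_notMem {f : Space d → ℝ} {x : Space d} (hx : x ∉ tsupport f)
    (g : Space d → ℝ) : gradDot f g x = 0 := by
  have h : ∀ i, pd i f x = 0 := fun i ↦ by
    have h0 : fderiv ℝ f x = 0 := by
      by_contra hne
      exact hx (support_fderiv_subset ℝ hne)
    simp [pd, h0]
  simp [gradDot, h]

theorem integrable_of_eq_zero_of_notMem {χ f : Space d → ℝ} (hc : HasCompactSupport χ)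
    (hf : Continuous f) (h : ∀ x ∉ tsupport χ, f x = 0) : Integrable f :=
  hf.integrable_of_hasCompactSupport (HasCompactSupport.intro hc h)

theorem gradDot_mul_left {f g : Space d → ℝ} (hf : ContDiff ℝ ∞ f) (hg : ContDiff ℝ ∞ g)
    (h : Space d → ℝ) (x : Space d) :
    gradDot (fun x ↦ f x * g x) h x = f x * gradDot g h x + g x * gradDot f h x := by
  simp only [gradDot, pd_mul hf hg, Finset.mul_sum, ← Finset.sum_add_distrib]
  exact Finset.sum_congr rfl fun i _ ↦ by ring

theorem gradDot_mul_right {f g : Space d → ℝ} (hf : ContDiff ℝ ∞ f) (hg : ContDiff ℝ ∞ g)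
    (h : Space d → ℝ) (x : Space d) :
    gradDot h (fun x ↦ f x * g x) x = f x * gradDot h g x + g x * gradDot h f x := by
  rw [gradDot_comm, gradDot_mul_left hf hg, gradDot_comm g, gradDot_comm f]

theorem two_mul_gradDot_le (p q : ℝ) (f g : Space d → ℝ) (x : Space d) :
    2 * (p * q * gradDot f g x) ≤ p ^ 2 * gradDot f f x + q ^ 2 * gradDot g g x := by
  simp only [gradDot, Finset.mul_sum, ← Finset.sum_add_distrib]
  refine Finset.sum_le_sum fun i _ ↦ ?_
  nlinarith [sq_nonneg (p * pd i f x - q * pd i g x)]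

theorem gradDot_sq_le (f g : Space d → ℝ) (x : Space d) :
    gradDot f g x ^ 2 ≤ gradDot f f x * gradDot g g x := by
  simp only [gradDot, ← pow_two]
  exact Finset.sum_mul_sq_le_sq_mul_sq _ _ _

theorem norm_sq_eq_sum (x : Space d) : ‖x‖ ^ 2 = ∑ i, x i ^ 2 := by
  rw [EuclideanSpace.norm_sq_eq]
  simp

theorem euler_sq_le (f : Space d → ℝ) (x : Space d) :
    euler f x ^ 2 ≤ ‖x‖ ^ 2 * gradDot f f x := by
  simp only [gradDot, ← pow_two, euler, norm_sq_eq_sum]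
  exact Finset.sum_mul_sq_le_sq_mul_sq _ _ _

theorem integral_sq_mul_mul_lap {χ v : Space d → ℝ} (hχ : ContDiff ℝ ∞ χ)
    (hc : HasCompactSupport χ) (hv : ContDiff ℝ ∞ v) :
    ∫ x, χ x ^ 2 * (v x * lap v x)
      = -∫ x, (χ x ^ 2 * gradDot v v x + 2 * (χ x * v x * gradDot χ v x)) := by
  have h := integral_mul_lap ((hχ.mul (hχ.mul hv))) hv (hc.mul_right (f' := fun x ↦ χ x * v x))
  have e : ∀ x, gradDot (fun x ↦ χ x * (χ x * v x)) v x
      = χ x ^ 2 * gradDot v v x + 2 * (χ x * v x * gradDot χ v x) := fun x ↦ by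
    rw [gradDot_mul_left hχ (hχ.mul hv), gradDot_mul_left hχ hv]
    ring
  simp only [e] at h
  rw [← h]
  congr 1
  ext x
  ring

/-- The localized energy identity. -/
theorem integral_gradDot_cutoff {χ v : Space d → ℝ} (hχ : ContDiff ℝ ∞ χ)
    (hc : HasCompactSupport χ) (hv : ContDiff ℝ ∞ v) :
    ∫ x, gradDot (fun x ↦ χ x * v x) (fun x ↦ χ x * v x) x
      = (∫ x, gradDot χ χ x * v x ^ 2) - ∫ x, χ x ^ 2 * (v x * lap v x) := by
  rw [integral_sq_mul_mul_lap hχ hc hv, sub_neg_eq_add, ← integral_add]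
  · congr 1
    ext x
    rw [gradDot_mul_left hχ hv, gradDot_mul_right hχ hv, gradDot_mul_right hχ hv,
      gradDot_comm v χ]
    ring
  · refine integrable_of_eq_zero_of_notMem hc (ContDiff.continuous (𝕜 := ℝ) (n := ∞)
      (by fun_prop)) fun x hx ↦ ?_
    simp [gradDot_eq_zero_of_notMem hx]
  · refine integrable_of_eq_zero_of_notMem hc (ContDiff.continuous (𝕜 := ℝ) (n := ∞)
      (by fun_prop)) fun x hx ↦ ?_
    simp [gradDot_eq_zero_of_notMem hx, image_eq_zero_of_notMem_tsupport hx]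

/-- The Caccioppoli inequality. -/
theorem integral_sq_mul_gradDot_le {χ v : Space d → ℝ} (hχ : ContDiff ℝ ∞ χ)
    (hc : HasCompactSupport χ) (hv : ContDiff ℝ ∞ v) :
    ∫ x, χ x ^ 2 * gradDot v v x ≤ (∫ x, χ x ^ 2 * v x ^ 2) + (∫ x, χ x ^ 2 * lap v x ^ 2)
      + 4 * ∫ x, gradDot χ χ x * v x ^ 2 := by
  have h := integral_sq_mul_mul_lap hχ hc hv
  have i0 : ∀ w : Space d → ℝ, ContDiff ℝ ∞ w → Integrable fun x ↦ χ x ^ 2 * w x := by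
    intro w hw
    refine integrable_of_eq_zero_of_notMem hc (ContDiff.continuous (𝕜 := ℝ) (n := ∞)
      (by fun_prop)) fun x hx ↦ ?_
    simp [image_eq_zero_of_notMem_tsupport hx]
  have i1 := i0 _ (contDiff_gradDot hv hv)
  have i2 := i0 _ (hv.mul (contDiff_lap hv))
  have i3 := i0 _ (hv.pow 2)
  have i4 := i0 _ ((contDiff_lap hv).pow 2)
  have i5 : Integrable fun x ↦ 2 * (χ x * v x * gradDot χ v x) := by
    refine integrable_of_eq_zero_of_notMem hc (ContDiff.continuous (𝕜 := ℝ) (n := ∞)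
      (by fun_prop)) fun x hx ↦ ?_
    simp [image_eq_zero_of_notMem_tsupport hx]
  have i6 : Integrable fun x ↦ gradDot χ χ x * v x ^ 2 := by
    refine integrable_of_eq_zero_of_notMem hc (ContDiff.continuous (𝕜 := ℝ) (n := ∞)
      (by fun_prop)) fun x hx ↦ ?_
    simp [gradDot_eq_zero_of_notMem hx]
  rw [integral_add i1 i5] at h
  have h1 : -(∫ x, χ x ^ 2 * (v x * lap v x))
      ≤ ((∫ x, χ x ^ 2 * v x ^ 2) + ∫ x, χ x ^ 2 * lap v x ^ 2) / 2 := by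
    rw [← integral_add i3 i4, ← integral_div, ← integral_neg]
    refine integral_mono i2.neg ((i3.add i4).div_const 2) fun x ↦ ?_
    simp only
    nlinarith [mul_nonneg (sq_nonneg (χ x)) (sq_nonneg (v x + lap v x))]
  -- Half of the gradient integral is spent here and absorbed on the left at the end; this doubles
  -- the other constants.
  have h2 : -(∫ x, 2 * (χ x * v x * gradDot χ v x))
      ≤ (∫ x, χ x ^ 2 * gradDot v v x) / 2 + 2 * ∫ x, gradDot χ χ x * v x ^ 2 := by
    rw [← integral_div, ← integral_const_mul, ← integral_add (i1.div_const 2) (i6.const_mul 2),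
      ← integral_neg]
    refine integral_mono i5.neg ((i1.div_const 2).add (i6.const_mul 2)) fun x ↦ ?_
    have := two_mul_gradDot_le (-(2 * v x)) (χ x) χ v x
    simp only
    linarith
  linarith

/-! ### The Japanese bracket and Hardy's inequality -/

/-- The square of the Japanese bracket. -/
def sig (x : Space d) : ℝ := 1 + ‖x‖ ^ 2

theorem one_le_sig (x : Space d) : 1 ≤ sig x := by
  have := sq_nonneg ‖x‖
  unfold sig
  linarith

theorem sig_pos (x : Space d) : 0 < sig x := zero_lt_one.trans_le (one_le_sig x)

@[fun_prop]
theorem contDiff_sig : ContDiff ℝ ∞ (sig : Space d → ℝ) :=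
  contDiff_const.add (contDiff_norm_sq ℝ)

theorem sig_eq_sum (x : Space d) : sig x = 1 + ∑ i, x i * x i := by
  simp only [sig, norm_sq_eq_sum, ← pow_two]

theorem pd_sig (i : Fin d) (x : Space d) : pd i sig x = 2 * x i := by
  rw [show (sig : Space d → ℝ) = fun x ↦ 1 + ∑ j, x j * x j from funext sig_eq_sum,
    pd_add contDiff_const (ContDiff.sum fun j _ ↦ (contDiff_coord j).mul (contDiff_coord j)),
    pd_const, pd_sum _ fun j ↦ (contDiff_coord j).mul (contDiff_coord j)]
  simp only [pd_mul (contDiff_coord _) (contDiff_coord _), pd_coord, Finset.sum_add_distrib]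
  simp
  ring

theorem euler_sig (x : Space d) : euler sig x = 2 * ‖x‖ ^ 2 := by
  simp only [euler, pd_sig, norm_sq_eq_sum, Finset.mul_sum]
  exact Finset.sum_congr rfl fun i _ ↦ by ring

theorem contDiff_inv_sig : ContDiff ℝ ∞ (fun x : Space d ↦ (sig x)⁻¹) :=
  contDiff_sig.inv fun x ↦ (sig_pos x).ne'

/-- The field `x/σ` has divergence `d/σ - 2|x|²/σ² ≥ (d-2)/σ ≥ 1/σ`, which is where `d ≥ 3` enters.
Integrating by parts against `v²`, using Young's inequality and `(x · ∇v)² ≤ σ|∇v|²`, half of the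
left side is absorbed. -/
theorem hardy {v : Space d → ℝ} (hd : 3 ≤ d) (hv : ContDiff ℝ ∞ v) (hc : HasCompactSupport v) :
    ∫ x, (sig x)⁻¹ * v x ^ 2 ≤ 4 * ∫ x, gradDot v v x := by
  have h := integral_mul_euler_mul contDiff_inv_sig hv hc
  have he : ∀ x : Space d, euler (fun x ↦ (sig x)⁻¹) x = -(sig x ^ 2)⁻¹ * (2 * ‖x‖ ^ 2) := by
    intro x
    rw [euler_comp contDiff_sig (hasDerivAt_inv (sig_pos x).ne'), euler_sig]
  have hi := contDiff_inv_sig (d := d)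
  have i1 : Integrable fun x ↦ (sig x)⁻¹ * v x ^ 2 :=
    integrable_of_eq_zero_of_notMem hc (ContDiff.continuous (𝕜 := ℝ) (n := ∞) (by fun_prop))
      fun x hx ↦ by simp [image_eq_zero_of_notMem_tsupport hx]
  have i2 : Integrable fun x ↦ (d * (sig x)⁻¹ + euler (fun x ↦ (sig x)⁻¹) x) * v x ^ 2 :=
    integrable_of_eq_zero_of_notMem hc (ContDiff.continuous (𝕜 := ℝ) (n := ∞) (by fun_prop))
      fun x hx ↦ by simp [image_eq_zero_of_notMem_tsupport hx]
  have i3 : Integrable fun x ↦ 2 * ((sig x)⁻¹ * (v x * euler v x)) :=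
    integrable_of_eq_zero_of_notMem hc (ContDiff.continuous (𝕜 := ℝ) (n := ∞) (by fun_prop))
      fun x hx ↦ by simp [image_eq_zero_of_notMem_tsupport hx]
  have i4 : Integrable (gradDot v v) :=
    integrable_of_smooth (contDiff_gradDot hv hv) (hasCompactSupport_gradDot hc)
  have h1 : ∫ x, (sig x)⁻¹ * v x ^ 2
      ≤ ∫ x, (d * (sig x)⁻¹ + euler (fun x ↦ (sig x)⁻¹) x) * v x ^ 2 := by
    refine integral_mono i1 i2 fun x ↦ ?_
    refine mul_le_mul_of_nonneg_right ?_ (sq_nonneg _)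
    rw [he]
    have hσ := sig_pos x
    have h3 : (3 : ℝ) ≤ d := by exact_mod_cast hd
    have : (sig x ^ 2)⁻¹ * (2 * ‖x‖ ^ 2) ≤ 2 * (sig x)⁻¹ := by
      rw [inv_mul_eq_div, div_le_iff₀ (by positivity), pow_two (sig x)]
      field_simp
      unfold sig
      linarith
    nlinarith [inv_pos.2 hσ]
  have h2 : -(∫ x, 2 * ((sig x)⁻¹ * (v x * euler v x)))
      ≤ (∫ x, (sig x)⁻¹ * v x ^ 2) / 2 + 2 * ∫ x, gradDot v v x := by
    rw [← integral_div, ← integral_const_mul, ← integral_add (i1.div_const 2) (i4.const_mul 2),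
      ← integral_neg]
    refine integral_mono i3.neg ((i1.div_const 2).add (i4.const_mul 2)) fun x ↦ ?_
    simp only
    have hσ := inv_pos.2 (sig_pos x)
    have h4 : (sig x)⁻¹ * euler v x ^ 2 ≤ gradDot v v x := by
      rw [inv_mul_le_iff₀ (sig_pos x)]
      refine (euler_sq_le v x).trans (mul_le_mul_of_nonneg_right ?_ (gradDot_self_nonneg v x))
      unfold sig
      linarith
    nlinarith [mul_nonneg hσ.le (sq_nonneg (v x + 2 * euler v x))]
  linarith

/-! ### Radial cutoffs at scale `R` -/

/-- A smooth bump function that is `1` on the unit ball and vanishes off the ball of radius `2`. -/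
def unitBump (d : ℕ) : ContDiffBump (0 : Space d) := ⟨1, 2, one_pos, one_lt_two⟩

/-- The cutoff at scale `R`. -/
def cut (R : ℝ) (x : Space d) : ℝ := unitBump d (R⁻¹ • x)

@[fun_prop]
theorem contDiff_cut (R : ℝ) : ContDiff ℝ ∞ (cut R : Space d → ℝ) :=
  (unitBump d).contDiff.comp (contDiff_const_smul _)

theorem cut_nonneg (R : ℝ) (x : Space d) : 0 ≤ cut R x := (unitBump d).nonneg

theorem cut_le_one (R : ℝ) (x : Space d) : cut R x ≤ 1 := (unitBump d).le_one

theorem norm_inv_smul {R : ℝ} (hR : 0 < R) (x : Space d) : ‖R⁻¹ • x‖ = ‖x‖ / R := by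
  rw [norm_smul, Real.norm_of_nonneg (inv_nonneg.2 hR.le), inv_mul_eq_div]

theorem cut_eq_one {R : ℝ} (hR : 0 < R) {x : Space d} (hx : ‖x‖ ≤ R) : cut R x = 1 := by
  refine (unitBump d).one_of_mem_closedBall ?_
  rw [mem_closedBall_zero_iff, norm_inv_smul hR]
  exact (div_le_one hR).2 hx

theorem cut_eq_zero {R : ℝ} (hR : 0 < R) {x : Space d} (hx : 2 * R ≤ ‖x‖) : cut R x = 0 := by
  refine (unitBump d).zero_of_le_dist ?_
  rw [dist_zero_right, norm_inv_smul hR]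
  exact (le_div_iff₀ hR).2 hx

theorem hasCompactSupport_cut {R : ℝ} (hR : 0 < R) :
    HasCompactSupport (cut R : Space d → ℝ) := by
  refine HasCompactSupport.intro (isCompact_closedBall 0 (2 * R)) fun x hx ↦ cut_eq_zero hR ?_
  rw [mem_closedBall_zero_iff, not_le] at hx
  exact hx.le

theorem pd_comp_smul {f : Space d → ℝ} (hf : ContDiff ℝ ∞ f) (c : ℝ) (i : Fin d) :
    pd i (fun x ↦ f (c • x)) = fun x ↦ c * pd i f (c • x) := by
  ext x
  have h1 : HasFDerivAt (fun y : Space d ↦ c • y) (c • ContinuousLinearMap.id ℝ (Space d)) x :=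
    (hasFDerivAt_id x).const_smul c
  have := (differentiableAt_of_smooth hf (c • x)).hasFDerivAt.comp x h1
  unfold pd
  rw [show (fun y ↦ f (c • y)) = f ∘ (fun y ↦ c • y) from rfl, this.fderiv]
  simp

theorem lap_comp_smul {f : Space d → ℝ} (hf : ContDiff ℝ ∞ f) (c : ℝ) (x : Space d) :
    lap (fun x ↦ f (c • x)) x = c ^ 2 * lap f (c • x) := by
  simp only [lap, Finset.mul_sum]
  refine Finset.sum_congr rfl fun i _ ↦ ?_
  have h : ContDiff ℝ ∞ fun x ↦ pd i f (c • x) := (contDiff_pd hf i).comp (contDiff_const_smul c)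
  rw [pd_comp_smul hf, pd_const_mul c h,
    pd_comp_smul (contDiff_pd hf i)]
  ring

theorem gradDot_comp_smul {f : Space d → ℝ} (hf : ContDiff ℝ ∞ f) (c : ℝ) (x : Space d) :
    gradDot (fun x ↦ f (c • x)) (fun x ↦ f (c • x)) x = c ^ 2 * gradDot f f (c • x) := by
  simp only [gradDot, Finset.mul_sum, pd_comp_smul hf]
  exact Finset.sum_congr rfl fun i _ ↦ by ring

/-- Scaling: the cutoff at scale `R` is one fixed bump composed with `x ↦ x/R`, so one constant
serves all scales. -/
theorem exists_cut_bound (d : ℕ) : ∃ K : ℝ, 0 < K ∧ ∀ R : ℝ, 0 < R → ∀ x : Space d,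
    gradDot (cut R) (cut R) x ≤ K / R ^ 2 ∧ lap (cut R) x ^ 2 ≤ K / R ^ 4 := by
  have hs : ContDiff ℝ ∞ (unitBump d) := (unitBump d).contDiff
  have hc : HasCompactSupport (unitBump d) := (unitBump d).hasCompactSupport
  obtain ⟨A, hA⟩ := (hasCompactSupport_gradDot (g := unitBump d) hc).exists_bound_of_continuous
    (contDiff_gradDot hs hs).continuous
  obtain ⟨B, hB⟩ := (hasCompactSupport_lap hc).exists_bound_of_continuous
    (contDiff_lap hs).continuous
  refine ⟨max A (B ^ 2) + 1, ?_, fun R hR x ↦ ⟨?_, ?_⟩⟩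
  · linarith [le_max_right A (B ^ 2), sq_nonneg B]
  · rw [show (cut R : Space d → ℝ) = fun x ↦ unitBump d (R⁻¹ • x) from rfl,
      gradDot_comp_smul hs, inv_pow, inv_mul_eq_div]
    refine div_le_div_of_nonneg_right ?_ (by positivity)
    linarith [le_max_left A (B ^ 2), (le_abs_self _).trans (hA (R⁻¹ • x))]
  · rw [show (cut R : Space d → ℝ) = fun x ↦ unitBump d (R⁻¹ • x) from rfl,
      lap_comp_smul hs, mul_pow, inv_pow, inv_pow, ← pow_mul, inv_mul_eq_div]
    refine div_le_div_of_nonneg_right ?_ (by positivity)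
    have h := pow_le_pow_left₀ (norm_nonneg _) (hB (R⁻¹ • x)) 2
    rw [Real.norm_eq_abs, sq_abs] at h
    linarith [le_max_right A (B ^ 2)]

theorem pd_eq_of_eventuallyEq {f g : Space d → ℝ} {x : Space d} (h : f =ᶠ[𝓝 x] g) (i : Fin d) :
    pd i f =ᶠ[𝓝 x] pd i g := by
  filter_upwards [h.fderiv (𝕜 := ℝ)] with y hy
  simp only [pd, hy]

theorem gradDot_eq_zero_of_eventually_const {f : Space d → ℝ} {c : ℝ} {x : Space d}
    (h : f =ᶠ[𝓝 x] fun _ ↦ c) (g : Space d → ℝ) : gradDot f g x = 0 := by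
  refine Finset.sum_eq_zero fun i _ ↦ ?_
  rw [(pd_eq_of_eventuallyEq h i).eq_of_nhds, pd_const, zero_mul]

theorem lap_eq_zero_of_eventually_const {f : Space d → ℝ} {c : ℝ} {x : Space d}
    (h : f =ᶠ[𝓝 x] fun _ ↦ c) : lap f x = 0 := by
  refine Finset.sum_eq_zero fun i _ ↦ ?_
  have h1 := pd_eq_of_eventuallyEq h i
  rw [pd_const] at h1
  rw [(pd_eq_of_eventuallyEq h1 i).eq_of_nhds, pd_const]

theorem cut_eventuallyEq_one {R : ℝ} {x : Space d} (hx : ‖x‖ < R) :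
    (cut R : Space d → ℝ) =ᶠ[𝓝 x] fun _ ↦ 1 := by
  filter_upwards [continuous_norm.continuousAt.eventually_lt continuousAt_const hx] with y hy
  exact cut_eq_one ((norm_nonneg x).trans_lt hx) hy.le

theorem cut_eventuallyEq_zero {R : ℝ} (hR : 0 < R) {x : Space d} (hx : 2 * R < ‖x‖) :
    (cut R : Space d → ℝ) =ᶠ[𝓝 x] fun _ ↦ 0 := by
  filter_upwards [continuousAt_const.eventually_lt continuous_norm.continuousAt hx] with y hy
  exact cut_eq_zero hR hy.le

/-! ### Nonpositive energies and zero resonances -/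

theorem setIntegral_ball_le_of_cut {u : Space d → ℝ} (hu : LocL2 u) {T B : ℝ} (hT : 0 < T)
    {b : Space d → ℝ} (hb : Continuous b) (hb0 : ∀ x, 0 ≤ b x)
    (h : ∫ x, cut T x ^ 2 * b x * u x ^ 2 ≤ B) :
    ∫ x in Metric.ball 0 T, b x * u x ^ 2 ≤ B := by
  refine le_trans ?_ h
  have i1 : Integrable fun x ↦ cut T x ^ 2 * b x * u x ^ 2 := by
    have c1 : Continuous fun x : Space d ↦ cut T x ^ 2 := (contDiff_cut T).continuous.pow 2
    have c2 : HasCompactSupport fun x : Space d ↦ cut T x ^ 2 := by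
      simp only [pow_two]
      exact (hasCompactSupport_cut hT).mul_right
    exact integrable_mul_sq_of_locL2 (c1.mul hb) c2.mul_right hu
  refine le_trans (le_of_eq ?_) (setIntegral_le_integral (s := Metric.ball 0 T) i1
    (Eventually.of_forall fun x ↦ mul_nonneg (mul_nonneg (sq_nonneg _) (hb0 x)) (sq_nonneg _)))
  refine setIntegral_congr_fun measurableSet_ball fun x hx ↦ ?_
  rw [mem_ball_zero_iff] at hx
  simp only [cut_eq_one hT hx.le]
  ring

theorem ae_eq_zero_of_forall_ball {u : Space d → ℝ} (hu : LocL2 u) {b : Space d → ℝ}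
    (hb : Continuous b) (hb0 : ∀ x, 0 < b x)
    (h : ∀ T : ℝ, 0 < T → ∫ x in Metric.ball 0 T, b x * u x ^ 2 ≤ 0) : u =ᵐ[volume] 0 := by
  have h1 : ∀ n : ℕ, ∀ᵐ x ∂volume.restrict (Metric.ball (0 : Space d) (n + 1)), u x = 0 := by
    intro n
    have hT : (0 : ℝ) < n + 1 := by positivity
    have hi : IntegrableOn (fun x ↦ b x * u x ^ 2) (Metric.ball 0 (n + 1 : ℝ)) := by
      obtain ⟨C, hC⟩ := (isCompact_closedBall (0 : Space d) (n + 1)).exists_bound_of_continuousOn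
        hb.continuousOn
      refine Integrable.bdd_mul (c := C) (hu.integrableOn_sq _) hb.aestronglyMeasurable ?_
      filter_upwards [ae_restrict_mem measurableSet_ball] with x hx
      exact hC x (Metric.ball_subset_closedBall hx)
    have h0 : ∀ x, 0 ≤ b x * u x ^ 2 := fun x ↦ mul_nonneg (hb0 x).le (sq_nonneg _)
    have := (setIntegral_eq_zero_iff_of_nonneg_ae (Eventually.of_forall h0) hi).1
      (le_antisymm (h _ hT) (integral_nonneg h0))
    filter_upwards [this] with x hx
    simpa [(hb0 x).ne'] using hx
  have h2 := (ae_restrict_iUnion_iff (fun n : ℕ ↦ Metric.ball (0 : Space d) (n + 1))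
    (fun x ↦ u x = 0) (μ := volume)).2 h1
  rwa [Metric.iUnion_ball_nat_succ, Measure.restrict_univ] at h2

/-- Hardy's inequality for `χu`, with the gradient eliminated by `integral_gradDot_cutoff`, so that
only `u` and `Δu = g` appear and mollification gives the weak case. -/
theorem weak_energy_le {u g : Space d → ℝ} (hd : 3 ≤ d) (h : IsWeakLap u g) (hu : LocL2 u)
    (hg : LocL2 g) {χ : Space d → ℝ} (hχ : ContDiff ℝ ∞ χ) (hc : HasCompactSupport χ) :
    ∫ x, χ x ^ 2 * (sig x)⁻¹ * u x ^ 2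
      ≤ 4 * ((∫ x, gradDot χ χ x * u x ^ 2) - ∫ x, χ x ^ 2 * (u x * g x)) := by
  obtain ⟨v, hv, hvu, hvg⟩ := h.exists_approx hu hg
  have hσ := contDiff_inv_sig (d := d)
  have c1 : Continuous fun x ↦ χ x ^ 2 * (sig x)⁻¹ :=
    ContDiff.continuous (𝕜 := ℝ) (n := ∞) (by fun_prop)
  have c2 : HasCompactSupport fun x ↦ χ x ^ 2 := by
    simp only [pow_two]
    exact hc.mul_right
  have hG := contDiff_gradDot hχ hχ
  have c3 : Continuous fun x ↦ χ x ^ 2 := hχ.continuous.pow 2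
  refine le_of_tendsto_of_tendsto' (hvu.integral_mul_sq c1 c2.mul_right)
    (((hvu.integral_mul_sq hG.continuous (hasCompactSupport_gradDot hc)).sub
      (hvu.integral_mul hvg c3 c2)).const_mul 4) fun n ↦ ?_
  rw [← integral_gradDot_cutoff hχ hc (hv n)]
  refine le_trans (le_of_eq ?_) (hardy hd (hχ.mul (hv n)) hc.mul_right)
  congr 1
  ext x
  ring

/-- A weak solution of `Δu = g` of slow growth with `u g ≥ -u² / (8⟨x⟩²)` vanishes. -/
theorem eq_zero_of_form_nonneg {u g : Space d → ℝ} (hd : 3 ≤ d) (h : IsWeakLap u g)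
    (hu : LocL2 u) (hg : LocL2 g)
    (hsign : ∀ᵐ x, -(1 / 8 * ((sig x)⁻¹ * u x ^ 2)) ≤ u x * g x)
    (hw : Integrable fun x ↦ sig x ^ (-(3 / 4) : ℝ) * u x ^ 2) : u =ᵐ[volume] 0 := by
  obtain ⟨K, hK0, hK⟩ := exists_cut_bound d
  set I := ∫ x, sig x ^ (-(3 / 4) : ℝ) * u x ^ 2 with hI
  have hσ := contDiff_inv_sig (d := d)
  have key : ∀ R : ℝ, 1 ≤ R → ∫ x, cut R x ^ 2 * (sig x)⁻¹ * u x ^ 2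
      ≤ 40 * K * I * R ^ (-(1 / 2) : ℝ) := by
    intro R hR
    have hR0 : 0 < R := by linarith
    have hχ := contDiff_cut (d := d) R
    have hc := hasCompactSupport_cut (d := d) hR0
    have c2 : HasCompactSupport fun x : Space d ↦ cut R x ^ 2 := by
      simp only [pow_two]
      exact hc.mul_right
    have h1 := weak_energy_le hd h hu hg hχ hc
    have c3 : Continuous fun x : Space d ↦ cut R x ^ 2 := hχ.continuous.pow 2
    have i1 : Integrable fun x ↦ cut R x ^ 2 * (u x * g x) :=
      integrable_mul_of_locL2 c3 c2 hu hg
    have i2 : Integrable fun x ↦ cut R x ^ 2 * (sig x)⁻¹ * u x ^ 2 :=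
      integrable_mul_sq_of_locL2 (c3.mul hσ.continuous) c2.mul_right hu
    have i3 : Integrable fun x ↦ gradDot (cut R) (cut R) x * u x ^ 2 :=
      integrable_mul_sq_of_locL2 (contDiff_gradDot hχ hχ).continuous
        (hasCompactSupport_gradDot hc) hu
    -- Hardy's factor `4` times `1/8` is `1/2`, so half of the left side is absorbed. The surviving
    -- term is `8 ∫ |∇χ|² u²`, whence `40 = 8 · 5` in `key`.
    have h2 : -(∫ x, cut R x ^ 2 * (u x * g x))
        ≤ 1 / 8 * ∫ x, cut R x ^ 2 * (sig x)⁻¹ * u x ^ 2 := by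
      rw [← integral_neg, ← integral_const_mul]
      refine integral_mono_ae i1.neg (i2.const_mul _) ?_
      filter_upwards [hsign] with x hx
      nlinarith [mul_le_mul_of_nonneg_left hx (sq_nonneg (cut R x))]
    -- On the support of `∇χ` one has `σ ≤ 5R²`, so `R⁻² = R^(-1/2) R^(-3/2) ≤ 5 R^(-1/2) σ^(-3/4)`:
    -- the weighted norm of `u` leaves a spare decay `R^(-1/2)`.
    have h3 : ∫ x, gradDot (cut R) (cut R) x * u x ^ 2 ≤ 5 * K * R ^ (-(1 / 2) : ℝ) * I := by
      rw [hI, ← integral_const_mul]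
      refine integral_mono i3 (hw.const_mul _) fun x ↦ ?_
      simp only
      rw [← mul_assoc]
      refine mul_le_mul_of_nonneg_right ?_ (sq_nonneg _)
      have hs0 := sig_pos x
      rcases lt_or_ge (2 * R) ‖x‖ with hx | hx
      · rw [gradDot_eq_zero_of_eventually_const (cut_eventuallyEq_zero hR0 hx)]
        positivity
      · refine (hK R hR0 x).1.trans ?_
        have hsig : sig x ≤ 5 * R ^ 2 := by
          unfold sig
          nlinarith [norm_nonneg x]
        have h4 : (5 * R ^ 2) ^ (-(3 / 4) : ℝ) ≤ sig x ^ (-(3 / 4) : ℝ) :=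
          Real.rpow_le_rpow_of_nonpos hs0 hsig (by norm_num)
        have h5 : (5 * R ^ 2 : ℝ) ^ (-(3 / 4) : ℝ) = 5 ^ (-(3 / 4) : ℝ) * R ^ (-(3 / 2) : ℝ) := by
          rw [Real.mul_rpow (by norm_num) (by positivity), ← Real.rpow_natCast R 2,
            ← Real.rpow_mul hR0.le]
          norm_num
        have h6 : (5 : ℝ) ^ (-1 : ℝ) ≤ 5 ^ (-(3 / 4) : ℝ) :=
          Real.rpow_le_rpow_of_exponent_le (by norm_num) (by norm_num)
        rw [Real.rpow_neg_one] at h6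
        have h7 : R ^ (-(1 / 2) : ℝ) * R ^ (-(3 / 2) : ℝ) = (R ^ 2)⁻¹ := by
          rw [← Real.rpow_add hR0, ← Real.rpow_natCast R 2, ← Real.rpow_neg hR0.le]
          norm_num
        have hp : 0 < R ^ (-(3 / 2) : ℝ) := Real.rpow_pos_of_pos hR0 _
        have hq : 0 < R ^ (-(1 / 2) : ℝ) := Real.rpow_pos_of_pos hR0 _
        have h8 : R ^ (-(3 / 2) : ℝ) ≤ 5 * sig x ^ (-(3 / 4) : ℝ) := by
          rw [h5] at h4
          nlinarith
        calc K / R ^ 2 = K * R ^ (-(1 / 2) : ℝ) * R ^ (-(3 / 2) : ℝ) := by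
              rw [mul_assoc, h7, div_eq_mul_inv]
          _ ≤ K * R ^ (-(1 / 2) : ℝ) * (5 * sig x ^ (-(3 / 4) : ℝ)) :=
              mul_le_mul_of_nonneg_left h8 (by positivity)
          _ = _ := by ring
    linarith
  refine ae_eq_zero_of_forall_ball hu hσ.continuous (fun x ↦ inv_pos.2 (sig_pos x))
    fun T hT ↦ ?_
  have hlim : Tendsto (fun R : ℝ ↦ 40 * K * I * R ^ (-(1 / 2) : ℝ)) atTop (𝓝 0) := by
    simpa using (tendsto_rpow_neg_atTop (show (0 : ℝ) < 1 / 2 by norm_num)).const_mul (40 * K * I)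
  refine ge_of_tendsto hlim ?_
  filter_upwards [eventually_ge_atTop (max 1 T)] with R hR
  have hTR : T ≤ R := (le_max_right _ _).trans hR
  have h1R : 1 ≤ R := (le_max_left _ _).trans hR
  have := setIntegral_ball_le_of_cut hu (by linarith) hσ.continuous
    (fun x ↦ (inv_pos.2 (sig_pos x)).le) (key R h1R)
  refine le_trans (setIntegral_mono_set ?_ (Eventually.of_forall fun x ↦
    mul_nonneg (inv_pos.2 (sig_pos x)).le (sq_nonneg _))
    (Metric.ball_subset_ball hTR).eventuallyLE) this
  have hM : Integrable (fun x ↦ (sig x)⁻¹ * u x ^ 2) (volume.restrict (Metric.ball 0 R)) := by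
    refine Integrable.bdd_mul (c := 1) (hu.integrableOn_sq _) hσ.continuous.aestronglyMeasurable
      (Eventually.of_forall fun x ↦ ?_)
    rw [Real.norm_of_nonneg (inv_pos.2 (sig_pos x)).le]
    exact inv_le_one_of_one_le₀ (one_le_sig x)
  exact hM

/-! ### Nonreal eigenvalues -/

theorem tsupport_cut_subset {R : ℝ} (hR : 0 < R) :
    tsupport (cut R : Space d → ℝ) ⊆ Metric.closedBall 0 (2 * R) := by
  refine closure_minimal (fun x hx ↦ ?_) Metric.isClosed_closedBall
  rw [mem_closedBall_zero_iff]
  by_contra hcon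
  exact hx (cut_eq_zero hR (not_le.1 hcon).le)

theorem hasCompactSupport_sq {χ : Space d → ℝ} (hc : HasCompactSupport χ) :
    HasCompactSupport fun x ↦ χ x ^ 2 := by
  simp only [pow_two]
  exact hc.mul_right

/-- In `χ(aΔb - bΔa)` the terms `χ∇a · ∇b` cancel after integration by parts, and only products with
`∇χ` remain. Young's inequality with parameter `t` separates `∇χ` from the gradients of `a` and `b`,
which `η` localizes. -/
theorem wronskian_smooth_le {χ η a b : Space d → ℝ} (hχ : ContDiff ℝ ∞ χ)
    (hc : HasCompactSupport χ) (hη : ContDiff ℝ ∞ η) (hηc : HasCompactSupport η)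
    (h1 : ∀ x ∈ tsupport χ, η x = 1) (ha : ContDiff ℝ ∞ a) (hb : ContDiff ℝ ∞ b) {t : ℝ}
    (ht : 0 < t) :
    2 * ((∫ x, χ x * (a x * lap b x)) - ∫ x, χ x * (b x * lap a x))
      ≤ t * ((∫ x, gradDot χ χ x * a x ^ 2) + ∫ x, gradDot χ χ x * b x ^ 2)
        + t⁻¹ * ((∫ x, η x ^ 2 * gradDot a a x) + ∫ x, η x ^ 2 * gradDot b b x) := by
  have g1 := integral_mul_lap (hχ.mul ha) hb hc.mul_right
  have g2 := integral_mul_lap (hχ.mul hb) ha hc.mul_right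
  simp only [gradDot_mul_left hχ ha] at g1
  simp only [gradDot_mul_left hχ hb] at g2
  have i1 : ∀ v w : Space d → ℝ, ContDiff ℝ ∞ v → ContDiff ℝ ∞ w →
      Integrable fun x ↦ χ x * gradDot v w x := fun v w hv hw ↦
    integrable_of_eq_zero_of_notMem hc (ContDiff.continuous (𝕜 := ℝ) (n := ∞) (by fun_prop))
      fun x hx ↦ by simp [image_eq_zero_of_notMem_tsupport hx]
  have i2 : ∀ v w : Space d → ℝ, ContDiff ℝ ∞ v → ContDiff ℝ ∞ w →
      Integrable fun x ↦ v x * gradDot χ w x := fun v w hv hw ↦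
    integrable_of_eq_zero_of_notMem hc (ContDiff.continuous (𝕜 := ℝ) (n := ∞) (by fun_prop))
      fun x hx ↦ by simp [gradDot_eq_zero_of_notMem hx]
  have i3 : ∀ v : Space d → ℝ, ContDiff ℝ ∞ v →
      Integrable fun x ↦ gradDot χ χ x * v x ^ 2 := fun v hv ↦
    integrable_of_eq_zero_of_notMem hc (ContDiff.continuous (𝕜 := ℝ) (n := ∞) (by fun_prop))
      fun x hx ↦ by simp [gradDot_eq_zero_of_notMem hx]
  have i4 : ∀ v : Space d → ℝ, ContDiff ℝ ∞ v →
      Integrable fun x ↦ η x ^ 2 * gradDot v v x := fun v hv ↦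
    integrable_of_eq_zero_of_notMem hηc (ContDiff.continuous (𝕜 := ℝ) (n := ∞) (by fun_prop))
      fun x hx ↦ by simp [image_eq_zero_of_notMem_tsupport hx]
  rw [integral_add (i1 a b ha hb) (i2 a b ha hb)] at g1
  rw [integral_add (i1 b a hb ha) (i2 b a hb ha)] at g2
  simp only [gradDot_comm b a] at g2
  have key : ∀ (c : ℝ) (v w : Space d → ℝ), c ^ 2 = 1 → ContDiff ℝ ∞ v → ContDiff ℝ ∞ w →
      2 * (c * ∫ x, v x * gradDot χ w x) ≤ t * (∫ x, gradDot χ χ x * v x ^ 2)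
        + t⁻¹ * ∫ x, η x ^ 2 * gradDot w w x := by
    intro c v w hc2 hv hw
    rw [← integral_const_mul, ← integral_const_mul, ← integral_const_mul, ← integral_const_mul,
      ← integral_add ((i3 v hv).const_mul t) ((i4 w hw).const_mul t⁻¹)]
    refine integral_mono (((i2 v w hv hw).const_mul c).const_mul 2)
      (((i3 v hv).const_mul t).add ((i4 w hw).const_mul t⁻¹)) fun x ↦ ?_
    simp only
    by_cases hx : x ∈ tsupport χ
    · rw [h1 x hx]
      have := two_mul_gradDot_le (c * v x * t) 1 χ w x
      have e : (c * v x * t) ^ 2 = t * (t * v x ^ 2) := by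
        rw [mul_pow, mul_pow, hc2]; ring
      rw [e] at this
      have h2 : t * (2 * (c * (v x * gradDot χ w x)))
          ≤ t * (t * (gradDot χ χ x * v x ^ 2) + t⁻¹ * (1 ^ 2 * gradDot w w x)) := by
        rw [mul_add, ← mul_assoc t t⁻¹, mul_inv_cancel₀ ht.ne']
        linarith
      exact le_of_mul_le_mul_left h2 ht
    · simp only [gradDot_eq_zero_of_notMem hx, zero_mul, mul_zero, zero_add]
      exact mul_nonneg (inv_nonneg.2 ht.le) (mul_nonneg (sq_nonneg _) (gradDot_self_nonneg w x))
  have k1 := key (-1) a b (by norm_num) ha hb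
  have k2 := key 1 b a (by norm_num) hb ha
  have e1 : ∫ x, χ x * (a x * lap b x) = ∫ x, χ x * a x * lap b x := by simp only [mul_assoc]
  have e2 : ∫ x, χ x * (b x * lap a x) = ∫ x, χ x * b x * lap a x := by simp only [mul_assoc]
  rw [e1, e2, g1, g2]
  linarith

/-- The Caccioppoli inequality with cutoff `η` replaces the gradients by `a`, `b` and their
Laplacians, so the estimate is stable under local `L²` limits. -/
theorem wronskian_weak_le {χ η a b g h : Space d → ℝ} (hχ : ContDiff ℝ ∞ χ)
    (hc : HasCompactSupport χ) (hη : ContDiff ℝ ∞ η) (hηc : HasCompactSupport η)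
    (h1 : ∀ x ∈ tsupport χ, η x = 1) (hag : IsWeakLap a g) (hbh : IsWeakLap b h)
    (ha : LocL2 a) (hb : LocL2 b) (hg : LocL2 g) (hh : LocL2 h) {t : ℝ} (ht : 0 < t) :
    2 * ((∫ x, χ x * (a x * h x)) - ∫ x, χ x * (b x * g x))
      ≤ t * ((∫ x, gradDot χ χ x * a x ^ 2) + ∫ x, gradDot χ χ x * b x ^ 2)
        + t⁻¹ * (((∫ x, η x ^ 2 * a x ^ 2) + (∫ x, η x ^ 2 * g x ^ 2)
            + 4 * ∫ x, gradDot η η x * a x ^ 2)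
          + ((∫ x, η x ^ 2 * b x ^ 2) + (∫ x, η x ^ 2 * h x ^ 2)
            + 4 * ∫ x, gradDot η η x * b x ^ 2)) := by
  obtain ⟨p, hp, hpa, hpg⟩ := hag.exists_approx ha hg
  obtain ⟨q, hq, hqb, hqh⟩ := hbh.exists_approx hb hh
  have cχ := (contDiff_gradDot hχ hχ).continuous
  have cχ' : HasCompactSupport (gradDot χ χ) := hasCompactSupport_gradDot hc
  have cη := (contDiff_gradDot hη hη).continuous
  have cη' : HasCompactSupport (gradDot η η) := hasCompactSupport_gradDot hηc
  have c2 : Continuous fun x ↦ η x ^ 2 := hη.continuous.pow 2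
  have c2' := hasCompactSupport_sq hηc
  refine le_of_tendsto_of_tendsto'
    (((hpa.integral_mul hqh hχ.continuous hc).sub
      (hqb.integral_mul hpg hχ.continuous hc)).const_mul 2)
    ((((hpa.integral_mul_sq cχ cχ').add (hqb.integral_mul_sq cχ cχ')).const_mul t).add
      (((((hpa.integral_mul_sq c2 c2').add (hpg.integral_mul_sq c2 c2')).add
        ((hpa.integral_mul_sq cη cη').const_mul 4)).add
      (((hqb.integral_mul_sq c2 c2').add (hqh.integral_mul_sq c2 c2')).add
        ((hqb.integral_mul_sq cη cη').const_mul 4))).const_mul t⁻¹)) fun n ↦ ?_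
  refine (wronskian_smooth_le hχ hc hη hηc h1 (hp n) (hq n) ht).trans ?_
  have k1 := integral_sq_mul_gradDot_le hη hηc (hp n)
  have k2 := integral_sq_mul_gradDot_le hη hηc (hq n)
  have := mul_le_mul_of_nonneg_left (add_le_add k1 k2) (inv_nonneg.2 ht.le)
  linarith

theorem integral_mul_sq_le {b f : Space d → ℝ} {C : ℝ} (hf : Integrable fun x ↦ f x ^ 2)
    (hC : ∀ x, b x ≤ C) (hb : Integrable fun x ↦ b x * f x ^ 2) :
    ∫ x, b x * f x ^ 2 ≤ C * ∫ x, f x ^ 2 := by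
  rw [← integral_const_mul]
  exact integral_mono hb (hf.const_mul C) fun x ↦
    mul_le_mul_of_nonneg_right (hC x) (sq_nonneg _)

theorem exists_wronskian_bound {a b g h : Space d → ℝ} (hag : IsWeakLap a g)
    (hbh : IsWeakLap b h) (ha : LocL2 a) (hb : LocL2 b) (hg : LocL2 g) (hh : LocL2 h)
    (ia : Integrable fun x ↦ a x ^ 2) (ib : Integrable fun x ↦ b x ^ 2)
    (ig : Integrable fun x ↦ g x ^ 2) (ih : Integrable fun x ↦ h x ^ 2) :
    ∃ M : ℝ, ∀ R : ℝ, 1 ≤ R →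
      (∫ x, cut R x * (a x * h x)) - ∫ x, cut R x * (b x * g x) ≤ M / R := by
  obtain ⟨K, hK0, hK⟩ := exists_cut_bound d
  set S := (∫ x, a x ^ 2) + ∫ x, b x ^ 2 with hS
  set T := (∫ x, g x ^ 2) + ∫ x, h x ^ 2 with hT
  refine ⟨(K * S + S + T + 4 * K * S) / 2, fun R hR ↦ ?_⟩
  have hR0 : 0 < R := by linarith
  have hχ := contDiff_cut (d := d) R
  have hc := hasCompactSupport_cut (d := d) hR0
  have hη := contDiff_cut (d := d) (2 * R)
  have hηc := hasCompactSupport_cut (d := d) (show 0 < 2 * R by linarith)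
  have h1 : ∀ x ∈ tsupport (cut R : Space d → ℝ), cut (2 * R) x = 1 := fun x hx ↦
    cut_eq_one (by linarith) (mem_closedBall_zero_iff.1 (tsupport_cut_subset hR0 hx))
  -- The choice `t = R` balances `t · K/R²` against `t⁻¹`, so both contributions are of order `1/R`.
  have main := wronskian_weak_le hχ hc hη hηc h1 hag hbh ha hb hg hh hR0
  have bχ : ∀ x : Space d, gradDot (cut R) (cut R) x ≤ K / R ^ 2 := fun x ↦ (hK R hR0 x).1
  have bη : ∀ x : Space d, gradDot (cut (2 * R)) (cut (2 * R)) x ≤ K := fun x ↦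
    (hK (2 * R) (by linarith) x).1.trans (div_le_self hK0.le (by nlinarith))
  have b2 : ∀ x : Space d, cut (2 * R) x ^ 2 ≤ 1 := fun x ↦
    pow_le_one₀ (cut_nonneg _ _) (cut_le_one _ _)
  have Iχ : ∀ f : Space d → ℝ, LocL2 f → Integrable fun x ↦ gradDot (cut R) (cut R) x * f x ^ 2 :=
    fun f hf ↦ integrable_mul_sq_of_locL2 (contDiff_gradDot hχ hχ).continuous
      (hasCompactSupport_gradDot hc) hf
  have Iη : ∀ f : Space d → ℝ, LocL2 f →
      Integrable fun x ↦ gradDot (cut (2 * R)) (cut (2 * R)) x * f x ^ 2 :=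
    fun f hf ↦ integrable_mul_sq_of_locL2 (contDiff_gradDot hη hη).continuous
      (hasCompactSupport_gradDot hηc) hf
  have I2 : ∀ f : Space d → ℝ, LocL2 f → Integrable fun x ↦ cut (2 * R) x ^ 2 * f x ^ 2 :=
    fun f hf ↦ integrable_mul_sq_of_locL2 (hη.continuous.pow 2) (hasCompactSupport_sq hηc) hf
  have e1 := integral_mul_sq_le ia bχ (Iχ a ha)
  have e2 := integral_mul_sq_le ib bχ (Iχ b hb)
  have e3 := integral_mul_sq_le ia bη (Iη a ha)
  have e4 := integral_mul_sq_le ib bη (Iη b hb)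
  have e5 := integral_mul_sq_le ia b2 (I2 a ha)
  have e6 := integral_mul_sq_le ib b2 (I2 b hb)
  have e7 := integral_mul_sq_le ig b2 (I2 g hg)
  have e8 := integral_mul_sq_le ih b2 (I2 h hh)
  have f1 := mul_le_mul_of_nonneg_left (add_le_add e1 e2) hR0.le
  have f2 := mul_le_mul_of_nonneg_left (add_le_add (add_le_add (add_le_add e5 e7)
    (mul_le_mul_of_nonneg_left e3 (show (0 : ℝ) ≤ 4 by norm_num))) (add_le_add
    (add_le_add e6 e8) (mul_le_mul_of_nonneg_left e4 (show (0 : ℝ) ≤ 4 by norm_num))))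
    (inv_nonneg.2 hR0.le)
  have f3 := main.trans (add_le_add f1 f2)
  have e : R * (K / R ^ 2 * (∫ x, a x ^ 2) + K / R ^ 2 * ∫ x, b x ^ 2)
      + R⁻¹ * (1 * (∫ x, a x ^ 2) + 1 * (∫ x, g x ^ 2) + 4 * (K * ∫ x, a x ^ 2)
        + (1 * (∫ x, b x ^ 2) + 1 * (∫ x, h x ^ 2) + 4 * (K * ∫ x, b x ^ 2)))
      = 2 * ((K * S + S + T + 4 * K * S) / 2 / R) := by
    rw [hS, hT]
    field_simp
    ring
  rw [e] at f3
  linarith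

/-- A symmetric operator has no nonreal eigenvalue: real form of the statement. -/
theorem eq_zero_of_wronskian {a b g h : Space d → ℝ} (hag : IsWeakLap a g)
    (hbh : IsWeakLap b h) (ha : LocL2 a) (hb : LocL2 b) (hg : LocL2 g) (hh : LocL2 h)
    (ia : Integrable fun x ↦ a x ^ 2) (ib : Integrable fun x ↦ b x ^ 2)
    (ig : Integrable fun x ↦ g x ^ 2) (ih : Integrable fun x ↦ h x ^ 2) {c : ℝ} (hc0 : 0 < c)
    (hc : ∀ᵐ x, a x * h x - b x * g x = c * (a x ^ 2 + b x ^ 2)) :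
    a =ᵐ[volume] 0 ∧ b =ᵐ[volume] 0 := by
  obtain ⟨M, hM⟩ := exists_wronskian_bound hag hbh ha hb hg hh ia ib ig ih
  have key : ∀ f : Space d → ℝ, LocL2 f → (∀ x, f x ^ 2 ≤ a x ^ 2 + b x ^ 2) →
      f =ᵐ[volume] 0 := by
    intro f hf hfab
    refine ae_eq_zero_of_forall_ball hf continuous_one (fun _ ↦ one_pos) fun T hT ↦ ?_
    have hlim : Tendsto (fun R : ℝ ↦ M / c / R) atTop (𝓝 0) :=
      tendsto_const_nhds.div_atTop tendsto_id
    refine ge_of_tendsto hlim ?_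
    filter_upwards [eventually_ge_atTop (max 1 T)] with R hR
    have hTR : T ≤ R := (le_max_right _ _).trans hR
    have h1R : 1 ≤ R := (le_max_left _ _).trans hR
    have hR0 : 0 < R := by linarith
    have hχ := (contDiff_cut (d := d) R).continuous
    have hχc := hasCompactSupport_cut (d := d) hR0
    have i1 := integrable_mul_of_locL2 hχ hχc ha hh
    have i2 := integrable_mul_of_locL2 hχ hχc hb hg
    have i3 : Integrable fun x ↦ cut R x ^ 2 * 1 * f x ^ 2 := by
      simp only [mul_one]
      exact integrable_mul_sq_of_locL2 (hχ.pow 2) (hasCompactSupport_sq hχc) hf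
    have h2 : ∫ x, cut R x ^ 2 * 1 * f x ^ 2 ≤ M / c / R := by
      rw [div_right_comm, le_div_iff₀ hc0, mul_comm]
      refine le_trans ?_ (hM R h1R)
      rw [← integral_const_mul, ← integral_sub i1 i2]
      refine integral_mono_ae (i3.const_mul c) (i1.sub i2) ?_
      filter_upwards [hc] with x hx
      simp only [mul_one]
      rw [← mul_sub, hx]
      -- The Wronskian bound carries the cutoff to the first power, the localization to balls
      -- carries its square.
      have h3 : cut R x ^ 2 ≤ cut R x := by
        rw [pow_two]
        exact mul_le_of_le_one_left (cut_nonneg R x) (cut_le_one R x)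
      have h4 := mul_le_mul h3 (hfab x) (sq_nonneg _) (cut_nonneg R x)
      nlinarith
    have h3 := setIntegral_ball_le_of_cut hf hR0 continuous_const (fun _ ↦ zero_le_one) h2
    refine le_trans (setIntegral_mono_set ?_ (Eventually.of_forall fun x ↦ ?_)
      (Metric.ball_subset_ball hTR).eventuallyLE) h3
    · simpa only [Pi.one_apply, one_mul] using! hf.integrableOn_sq R
    · simp only [Pi.one_apply, one_mul]
      exact sq_nonneg _
  exact ⟨key a ha fun x ↦ by linarith [sq_nonneg (b x)],
    key b hb fun x ↦ by linarith [sq_nonneg (a x)]⟩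

/-! ### The Carleman identity and inequality -/

/-- The zeroth order coefficient of `e^ρ (Δ + k²) e^{-ρ}` when `∇ρ = a x`. -/
def conjPot (a : Space d → ℝ) (k : ℝ) (x : Space d) : ℝ :=
  a x ^ 2 * (sig x - 1) - d * a x - euler a x + k ^ 2

/-- The zeroth order coefficient in the Carleman identity. -/
def carlemanPot (a : Space d → ℝ) (k : ℝ) (x : Space d) : ℝ :=
  conjPot a k x + euler (conjPot a k) x - (d - 1) * (d * a x + euler a x)

theorem contDiff_conjPot {a : Space d → ℝ} (ha : ContDiff ℝ ∞ a) (k : ℝ) :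
    ContDiff ℝ ∞ (conjPot a k) := by
  unfold conjPot
  fun_prop

theorem contDiff_carlemanPot {a : Space d → ℝ} (ha : ContDiff ℝ ∞ a) (k : ℝ) :
    ContDiff ℝ ∞ (carlemanPot a k) := by
  have := contDiff_conjPot ha k
  unfold carlemanPot
  fun_prop

/-- The multiplier is `2 x · ∇w + (d-1)w`. Its first part contributes `-(d-2)∫|∇w|²` by Pohozaev and
its second part `(d-1)∫|∇w|²` by Green, so exactly one positive copy of the gradient integral is
left. The remaining products `w (x · ∇w)` are integrated by parts into the coefficient of `w²`. -/
theorem carleman_identity {a w : Space d → ℝ} (ha : ContDiff ℝ ∞ a) (hw : ContDiff ℝ ∞ w)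
    (hc : HasCompactSupport w) (k : ℝ) :
    -(∫ x, (2 * euler w x + (d - 1) * w x)
        * (lap w x - 2 * a x * euler w x + conjPot a k x * w x))
      = (∫ x, gradDot w w x) + 4 * (∫ x, a x * euler w x ^ 2)
        + ∫ x, carlemanPot a k x * w x ^ 2 := by
  have hQ := contDiff_conjPot ha k
  have hB := contDiff_carlemanPot ha k
  have hz : ∀ x ∉ tsupport w, w x = 0 ∧ euler w x = 0 := fun x hx ↦
    ⟨image_eq_zero_of_notMem_tsupport hx, by
      have h : ∀ i, pd i w x = 0 := fun i ↦ by
        have h0 : fderiv ℝ w x = 0 := by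
          by_contra hne
          exact hx (support_fderiv_subset ℝ hne)
        simp [pd, h0]
      simp [euler, h]⟩
  have I : ∀ f : Space d → ℝ, ContDiff ℝ ∞ f → (∀ x ∉ tsupport w, f x = 0) → Integrable f :=
    fun f hf h ↦ integrable_of_eq_zero_of_notMem hc hf.continuous h
  have i1 : Integrable fun x ↦ euler w x * lap w x :=
    I _ (by fun_prop) fun x hx ↦ by simp [hz x hx]
  have i2 : Integrable fun x ↦ w x * lap w x :=
    I _ (by fun_prop) fun x hx ↦ by simp [hz x hx]
  have i3 : Integrable fun x ↦ a x * euler w x ^ 2 :=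
    I _ (by fun_prop) fun x hx ↦ by simp [hz x hx]
  have i4 : Integrable fun x ↦ 2 * (a x * (w x * euler w x)) :=
    I _ (by fun_prop) fun x hx ↦ by simp [hz x hx]
  have i5 : Integrable fun x ↦ 2 * (conjPot a k x * (w x * euler w x)) :=
    I _ (by fun_prop) fun x hx ↦ by simp [hz x hx]
  have i6 : Integrable fun x ↦ conjPot a k x * w x ^ 2 :=
    I _ (by fun_prop) fun x hx ↦ by simp [hz x hx]
  have i7 : Integrable fun x ↦ (d * a x + euler a x) * w x ^ 2 :=
    I _ (by fun_prop) fun x hx ↦ by simp [hz x hx]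
  have i8 : Integrable fun x ↦ (d * conjPot a k x + euler (conjPot a k) x) * w x ^ 2 :=
    I _ (by fun_prop) fun x hx ↦ by simp [hz x hx]
  have h1 := integral_euler_mul_lap hw hc
  have h2 := integral_mul_lap hw hw hc
  have h4 := integral_mul_euler_mul ha hw hc
  have h5 := integral_mul_euler_mul hQ hw hc
  have e1 : ∫ x, (2 * euler w x + (d - 1) * w x)
        * (lap w x - 2 * a x * euler w x + conjPot a k x * w x)
      = 2 * (∫ x, euler w x * lap w x) + (d - 1) * (∫ x, w x * lap w x)
        + (-4) * (∫ x, a x * euler w x ^ 2) + (-(d - 1)) * (∫ x, 2 * (a x * (w x * euler w x)))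
        + 1 * (∫ x, 2 * (conjPot a k x * (w x * euler w x)))
        + (d - 1) * ∫ x, conjPot a k x * w x ^ 2 := by
    have j1 := i1.const_mul 2
    have j2 := j1.fun_add (i2.const_mul (d - 1))
    have j3 := j2.fun_add (i3.const_mul (-4))
    have j4 := j3.fun_add (i4.const_mul (-(d - 1)))
    have j5 := j4.fun_add (i5.const_mul 1)
    simp only [← integral_const_mul]
    rw [← integral_add j1 (i2.const_mul _), ← integral_add j2 (i3.const_mul _),
      ← integral_add j3 (i4.const_mul _), ← integral_add j4 (i5.const_mul _),
      ← integral_add j5 (i6.const_mul _)]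
    congr 1
    ext x
    ring
  have e2 : ∫ x, carlemanPot a k x * w x ^ 2
      = (∫ x, (d * conjPot a k x + euler (conjPot a k) x) * w x ^ 2)
        + (-(d - 1)) * (∫ x, conjPot a k x * w x ^ 2)
        + (-(d - 1)) * ∫ x, (d * a x + euler a x) * w x ^ 2 := by
    simp only [← integral_const_mul]
    rw [← integral_add i8 (i6.const_mul _), ← integral_add (i8.fun_add (i6.const_mul _))
      (i7.const_mul _)]
    congr 1
    ext x
    simp only [carlemanPot]
    ring
  rw [e1, e2, h1, h2, h4, h5]
  ring

/-- Conjugation by `e^ρ` with `∇ρ = a x`: the zeroth order coefficient is `|∇ρ|² - Δρ + k²`, where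
`|∇ρ|² = a²(σ - 1)` and `Δρ = d a + x · ∇a`. -/
theorem lap_exp_mul {ρ a v : Space d → ℝ} (hρ : ContDiff ℝ ∞ ρ) (ha : ContDiff ℝ ∞ a)
    (hv : ContDiff ℝ ∞ v) (hρa : ∀ i, pd i ρ = fun x ↦ a x * x i) (k : ℝ) (x : Space d) :
    lap (fun x ↦ Real.exp (ρ x) * v x) x
        - 2 * a x * euler (fun x ↦ Real.exp (ρ x) * v x) x
        + conjPot a k x * (Real.exp (ρ x) * v x)
      = Real.exp (ρ x) * (lap v x + k ^ 2 * v x) := by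
  have he : ContDiff ℝ ∞ fun x ↦ Real.exp (ρ x) := hρ.exp
  have hpe : ∀ i, pd i (fun x ↦ Real.exp (ρ x)) = fun x ↦ Real.exp (ρ x) * (a x * x i) := by
    intro i
    ext y
    rw [pd_comp hρ (Real.hasDerivAt_exp (ρ y)), hρa]
  have hs : sig x - 1 = ∑ i, x i ^ 2 := by
    rw [← norm_sq_eq_sum, sig]
    ring
  have h1 : euler (fun x ↦ Real.exp (ρ x)) x = Real.exp (ρ x) * (a x * (sig x - 1)) := by
    simp only [euler, hpe, hs, Finset.mul_sum]
    exact Finset.sum_congr rfl fun i _ ↦ by ring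
  have h2 : gradDot (fun x ↦ Real.exp (ρ x)) v x = Real.exp (ρ x) * (a x * euler v x) := by
    simp only [euler, gradDot, hpe, Finset.mul_sum]
    exact Finset.sum_congr rfl fun i _ ↦ by ring
  have h3 : lap (fun x ↦ Real.exp (ρ x)) x
      = Real.exp (ρ x) * (a x ^ 2 * (sig x - 1) + d * a x + euler a x) := by
    have h4 : ∀ i, pd i (fun x ↦ Real.exp (ρ x) * (a x * x i)) x
        = Real.exp (ρ x) * (a x ^ 2 * x i ^ 2 + a x + x i * pd i a x) := by
      intro i
      rw [pd_mul he (ha.mul (contDiff_coord i)), hpe, pd_mul ha (contDiff_coord i), pd_coord]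
      simp only [if_true]
      ring
    simp only [lap, hpe, h4, ← Finset.mul_sum, Finset.sum_add_distrib, euler, hs]
    simp
  rw [lap_mul he hv, euler_mul he hv, conjPot]
  simp only [h1, h2, h3]
  ring

/-- The Carleman inequality with weight `e^ρ`, `∇ρ = a x`. -/
theorem carleman_inequality {ρ a v : Space d → ℝ} (hρ : ContDiff ℝ ∞ ρ) (ha : ContDiff ℝ ∞ a)
    (hv : ContDiff ℝ ∞ v) (hc : HasCompactSupport v) (hρa : ∀ i, pd i ρ = fun x ↦ a x * x i)
    (ha0 : ∀ x, 0 ≤ a x) (k : ℝ) {κ : ℝ} (hκ : 0 < κ) :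
    ∫ x, (carlemanPot a k x - κ) * Real.exp (2 * ρ x) * v x ^ 2
      ≤ ∫ x, (2 * sig x + (d - 1) ^ 2 / (4 * κ)) * Real.exp (2 * ρ x)
        * (lap v x + k ^ 2 * v x) ^ 2 := by
  have hw : ContDiff ℝ ∞ fun x ↦ Real.exp (ρ x) * v x := hρ.exp.mul hv
  have hwc : HasCompactSupport fun x ↦ Real.exp (ρ x) * v x := hc.mul_left
  have h := carleman_identity ha hw hwc k
  simp only [lap_exp_mul hρ ha hv hρa k] at h
  set w := fun x ↦ Real.exp (ρ x) * v x with hwdef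
  set F := fun x ↦ Real.exp (ρ x) * (lap v x + k ^ 2 * v x) with hF
  have hFs : ContDiff ℝ ∞ F := by
    have := hρ.exp
    fun_prop
  have hB := contDiff_carlemanPot ha k
  have hG := contDiff_gradDot hw hw
  have hE := contDiff_euler hw
  have hF0 : HasCompactSupport F := by
    refine HasCompactSupport.mul_left ?_
    exact (hasCompactSupport_lap hc).add hc.mul_left
  have i1 : Integrable fun x ↦ carlemanPot a k x * w x ^ 2 :=
    integrable_of_smooth (hB.mul (hw.pow 2)) (hasCompactSupport_sq hwc).mul_left
  have i2 : Integrable fun x ↦ κ * w x ^ 2 :=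
    integrable_of_smooth (contDiff_const.mul (hw.pow 2)) (hasCompactSupport_sq hwc).mul_left
  have i3 : Integrable fun x ↦ (2 * sig x + (d - 1) ^ 2 / (4 * κ)) * F x ^ 2 :=
    integrable_of_smooth (by fun_prop) (hasCompactSupport_sq hF0).mul_left
  have i4 : Integrable fun x ↦ (2 * euler w x + (d - 1) * w x) * F x :=
    integrable_of_smooth (by fun_prop) hF0.mul_left
  have i5 : Integrable (gradDot w w) :=
    integrable_of_smooth hG (hasCompactSupport_gradDot hwc)
  -- This term has the good sign and is discarded.
  have h0 : 0 ≤ ∫ x, a x * euler w x ^ 2 :=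
    integral_nonneg fun x ↦ mul_nonneg (ha0 x) (sq_nonneg _)
  -- The part with `x · ∇w` uses up the gradient integral of the identity, at the price of the
  -- weight `σ` on `F²`; the part with `w` costs `κ∫w²`.
  have h1 : -(∫ x, (2 * euler w x + (d - 1) * w x) * F x)
      ≤ (∫ x, gradDot w w x) + (∫ x, κ * w x ^ 2)
        + ∫ x, (2 * sig x + (d - 1) ^ 2 / (4 * κ)) * F x ^ 2 := by
    rw [← integral_add i5 i2, ← integral_add (i5.fun_add i2) i3, ← integral_neg]
    refine integral_mono i4.neg ((i5.fun_add i2).fun_add i3) fun x ↦ ?_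
    simp only
    have hσ := sig_pos x
    have g1 : -(2 * euler w x * F x) ≤ gradDot w w x + 2 * sig x * F x ^ 2 := by
      have e1 : (sig x)⁻¹ * euler w x ^ 2 ≤ gradDot w w x := by
        rw [inv_mul_le_iff₀ hσ]
        refine (euler_sq_le w x).trans (mul_le_mul_of_nonneg_right ?_ (gradDot_self_nonneg w x))
        unfold sig
        linarith
      have e2 : 0 ≤ (sig x)⁻¹ * (euler w x + sig x * F x) ^ 2 := by positivity
      have e3 : (sig x)⁻¹ * (euler w x + sig x * F x) ^ 2
          = (sig x)⁻¹ * euler w x ^ 2 + 2 * euler w x * F x + sig x * F x ^ 2 := by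
        field_simp
        ring
      nlinarith [mul_nonneg hσ.le (sq_nonneg (F x))]
    have g2 : -((d - 1) * w x * F x) ≤ κ * w x ^ 2 + (d - 1) ^ 2 / (4 * κ) * F x ^ 2 := by
      have e2 : 0 ≤ κ * (w x + (d - 1) / (2 * κ) * F x) ^ 2 := by positivity
      have e3 : κ * (w x + (d - 1) / (2 * κ) * F x) ^ 2
          = κ * w x ^ 2 + (d - 1) * w x * F x + (d - 1) ^ 2 / (4 * κ) * F x ^ 2 := by
        field_simp
        ring
      linarith
    linarith
  have hexp : ∀ x, Real.exp (2 * ρ x) = Real.exp (ρ x) ^ 2 := fun x ↦ by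
    rw [← Real.exp_nat_mul]
    norm_num
  have e1 : ∫ x, (carlemanPot a k x - κ) * Real.exp (2 * ρ x) * v x ^ 2
      = (∫ x, carlemanPot a k x * w x ^ 2) - ∫ x, κ * w x ^ 2 := by
    rw [← integral_sub i1 i2]
    congr 1
    ext x
    rw [hexp, hwdef]
    ring
  have e2 : ∫ x, (2 * sig x + (d - 1) ^ 2 / (4 * κ)) * Real.exp (2 * ρ x)
        * (lap v x + k ^ 2 * v x) ^ 2
      = ∫ x, (2 * sig x + (d - 1) ^ 2 / (4 * κ)) * F x ^ 2 := by
    congr 1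
    ext x
    rw [hexp, hF]
    ring
  rw [e1, e2]
  linarith

/-! ### The Carleman weight -/

/-- The radial profile of the Carleman weight, as a function of `⟨x⟩²`. -/
def wtProfile (τ ε s : ℝ) : ℝ := τ * (s / (1 + ε * s)) ^ (1 / 3 : ℝ)

/-- The Carleman weight. -/
def wt (τ ε : ℝ) (x : Space d) : ℝ := wtProfile τ ε (sig x)

/-- The coefficient `a` with `∇(wt) = a x`. -/
def wtGrad (τ ε : ℝ) (x : Space d) : ℝ := 2 / 3 * wt τ ε x / (sig x * (1 + ε * sig x))

/-- The logarithmic derivative of `wtGrad` along `-x`. -/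
def wtRate (ε : ℝ) (x : Space d) : ℝ := (1 - (sig x)⁻¹) * (4 - 8 / 3 * (1 + ε * sig x)⁻¹)

theorem one_add_mul_sig_pos {ε : ℝ} (hε : 0 ≤ ε) (x : Space d) : 0 < 1 + ε * sig x := by
  have := mul_nonneg hε (sig_pos x).le
  linarith

theorem contDiff_wt (τ : ℝ) {ε : ℝ} (hε : 0 ≤ ε) : ContDiff ℝ ∞ (wt τ ε : Space d → ℝ) := by
  unfold wt wtProfile
  refine contDiff_const.mul (ContDiff.rpow_const_of_ne ?_ fun x ↦ ?_)
  · exact contDiff_sig.div (by fun_prop) fun x ↦ (one_add_mul_sig_pos hε x).ne'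
  · exact (div_pos (sig_pos x) (one_add_mul_sig_pos hε x)).ne'

theorem contDiff_wtGrad (τ : ℝ) {ε : ℝ} (hε : 0 ≤ ε) :
    ContDiff ℝ ∞ (wtGrad τ ε : Space d → ℝ) := by
  have h := contDiff_wt (d := d) τ hε
  unfold wtGrad
  exact ContDiff.div (by fun_prop) (by fun_prop) fun x ↦
    (mul_pos (sig_pos x) (one_add_mul_sig_pos hε x)).ne'

theorem contDiff_wtRate {ε : ℝ} (hε : 0 ≤ ε) : ContDiff ℝ ∞ (wtRate ε : Space d → ℝ) := by
  have h1 := contDiff_inv_sig (d := d)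
  have h2 : ContDiff ℝ ∞ fun x : Space d ↦ (1 + ε * sig x)⁻¹ :=
    ContDiff.inv (by fun_prop) fun x ↦ (one_add_mul_sig_pos hε x).ne'
  unfold wtRate
  fun_prop

theorem hasDerivAt_wtProfile (τ : ℝ) {ε s : ℝ} (hε : 0 ≤ ε) (hs : 0 < s) :
    HasDerivAt (wtProfile τ ε) (wtProfile τ ε s / (3 * (s * (1 + ε * s)))) s := by
  have h1 : 0 < 1 + ε * s := by positivity
  have ht : 0 < s / (1 + ε * s) := div_pos hs h1
  have e1 : HasDerivAt (fun s ↦ 1 + ε * s) ε s := by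
    simpa using ((hasDerivAt_id s).const_mul ε).const_add 1
  have e2 := (hasDerivAt_id s).div e1 h1.ne'
  have e3 := (e2.rpow_const (p := 1 / 3) (Or.inl ht.ne')).const_mul τ
  refine e3.congr_deriv ?_
  simp only [Pi.div_apply, id, wtProfile]
  rw [Real.rpow_sub_one ht.ne']
  field_simp
  ring

theorem pd_wt (τ : ℝ) {ε : ℝ} (hε : 0 ≤ ε) (i : Fin d) :
    pd i (wt τ ε) = fun x ↦ wtGrad τ ε x * x i := by
  ext x
  have h1 := one_add_mul_sig_pos hε x
  have h2 := sig_pos x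
  rw [show (wt τ ε : Space d → ℝ) = fun x ↦ wtProfile τ ε (sig x) from rfl,
    pd_comp contDiff_sig (hasDerivAt_wtProfile τ hε h2), pd_sig, wtGrad, wt]
  field_simp

theorem euler_wtGrad (τ : ℝ) {ε : ℝ} (hε : 0 ≤ ε) :
    euler (wtGrad τ ε : Space d → ℝ) = fun x ↦ -(wtGrad τ ε x * wtRate ε x) := by
  ext x
  have h1 := one_add_mul_sig_pos hε x
  have h2 := sig_pos x
  have e1 : HasDerivAt (fun s ↦ 1 + ε * s) ε (sig x) := by
    simpa using ((hasDerivAt_id (sig x)).const_mul ε).const_add 1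
  have e2 := (((hasDerivAt_wtProfile τ hε h2).const_mul (2 / 3)).div
    ((hasDerivAt_id (sig x)).mul e1) (mul_pos h2 h1).ne')
  rw [show (wtGrad τ ε : Space d → ℝ)
    = fun x ↦ ((fun s : ℝ ↦ 2 / 3 * wtProfile τ ε s) / ((id : ℝ → ℝ) * fun s : ℝ ↦ 1 + ε * s))
      (sig x) from rfl,
    euler_comp contDiff_sig e2, euler_sig]
  have h3 : ‖x‖ ^ 2 = sig x - 1 := by
    unfold sig
    ring
  simp only [Pi.div_apply, Pi.mul_apply, id, wtRate, h3]
  field_simp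
  ring

theorem wtRate_nonneg {ε : ℝ} (hε : 0 ≤ ε) (x : Space d) : 0 ≤ wtRate ε x := by
  have h1 : (sig x)⁻¹ ≤ 1 := inv_le_one_of_one_le₀ (one_le_sig x)
  have h2 : (1 + ε * sig x)⁻¹ ≤ 1 := inv_le_one_of_one_le₀ (by
    linarith [mul_nonneg hε (sig_pos x).le])
  exact mul_nonneg (by linarith) (by linarith)

theorem wtRate_le_four {ε : ℝ} (hε : 0 ≤ ε) (x : Space d) : wtRate ε x ≤ 4 := by
  have h1 : (sig x)⁻¹ ≤ 1 := inv_le_one_of_one_le₀ (one_le_sig x)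
  have h1' : 0 < (sig x)⁻¹ := inv_pos.2 (sig_pos x)
  have h2 : (1 + ε * sig x)⁻¹ ≤ 1 := inv_le_one_of_one_le₀ (by
    linarith [mul_nonneg hε (sig_pos x).le])
  have h2' : 0 < (1 + ε * sig x)⁻¹ := inv_pos.2 (one_add_mul_sig_pos hε x)
  unfold wtRate
  nlinarith

theorem euler_wtRate_nonneg {ε : ℝ} (hε : 0 ≤ ε) (x : Space d) : 0 ≤ euler (wtRate ε) x := by
  have h1 := one_add_mul_sig_pos hε x
  have h2 := sig_pos x
  have e1 : HasDerivAt (fun s ↦ 1 + ε * s) ε (sig x) := by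
    simpa using ((hasDerivAt_id (sig x)).const_mul ε).const_add 1
  have e2 := ((hasDerivAt_inv h2.ne').const_sub 1).mul
    (((e1.inv h1.ne').const_mul (8 / 3)).const_sub 4)
  rw [show (wtRate ε : Space d → ℝ) = fun x ↦ ((fun s : ℝ ↦ 1 - s⁻¹)
    * fun s ↦ 4 - 8 / 3 * (fun s ↦ 1 + ε * s)⁻¹ s) (sig x) from rfl,
    euler_comp contDiff_sig e2, euler_sig]
  have h3 : (sig x)⁻¹ ≤ 1 := inv_le_one_of_one_le₀ (one_le_sig x)
  have h4 : (1 + ε * sig x)⁻¹ ≤ 1 := inv_le_one_of_one_le₀ (by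
    linarith [mul_nonneg hε (sig_pos x).le])
  refine mul_nonneg (add_nonneg ?_ ?_) (by positivity)
  · simp only [neg_neg, Pi.inv_apply]
    exact mul_nonneg (by positivity) (by linarith)
  · refine mul_nonneg (by linarith) ?_
    rw [neg_div, mul_neg, neg_neg]
    positivity

theorem wt_nonneg {τ ε : ℝ} (hτ : 0 ≤ τ) (hε : 0 ≤ ε) (x : Space d) : 0 ≤ wt τ ε x :=
  mul_nonneg hτ (Real.rpow_nonneg
    (div_pos (sig_pos x) (one_add_mul_sig_pos hε x)).le _)

theorem wtGrad_nonneg {τ ε : ℝ} (hτ : 0 ≤ τ) (hε : 0 ≤ ε) (x : Space d) : 0 ≤ wtGrad τ ε x :=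
  div_nonneg (mul_nonneg (by norm_num) (wt_nonneg hτ hε x))
    (mul_pos (sig_pos x) (one_add_mul_sig_pos hε x)).le

/-- Here `p` is the rate at which `a` decays along `x · ∇`, and the leading term has the sign of `3
- 2p`. For `ρ = σ^s` one has `p → 2(1-s)` at infinity, so asymptotic positivity requires `s > 1/4`,
whereas `a²σ → 0` requires `s < 1/2`. The exponent `1/3` satisfies both. -/
theorem carlemanPot_eq {a p : Space d → ℝ} (ha : ContDiff ℝ ∞ a) (hp : ContDiff ℝ ∞ p)
    (hap : euler a = fun x ↦ -(a x * p x)) (k : ℝ) (x : Space d) :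
    carlemanPot a k x = a x ^ 2 * (sig x - 1) * (3 - 2 * p x) + k ^ 2 - d ^ 2 * a x
      + 2 * d * a x * p x - a x * p x ^ 2 + a x * euler p x := by
  have e1 : conjPot a k = fun x ↦ (a x * a x) * (sig x + (-1)) + ((-d) * a x + a x * p x)
      + k ^ 2 := by
    ext y
    rw [conjPot, hap]
    ring
  have h1 : ContDiff ℝ ∞ fun x : Space d ↦ sig x + (-1) := by fun_prop
  have h2 : euler (fun x : Space d ↦ sig x + (-1)) = fun x ↦ 2 * (sig x - 1) := by
    ext y
    rw [euler_add contDiff_sig contDiff_const, euler_const]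
    simp only [euler_sig, sig]
    ring
  have e2 : euler (conjPot a k) x = (2 * (a x * euler a x)) * (sig x - 1)
      + a x ^ 2 * (2 * (sig x - 1)) - d * euler a x + (euler a x * p x + a x * euler p x) := by
    rw [e1, euler_add (by fun_prop) contDiff_const, euler_const,
      euler_add (by fun_prop) (by fun_prop), euler_mul (by fun_prop) h1, h2, euler_mul ha ha,
      euler_add (by fun_prop) (by fun_prop), euler_mul ha hp, euler_const_mul _ ha]
    ring
  rw [carlemanPot, e2, conjPot, hap]
  ring

/-- The terms with `2d a p` and `a (x · ∇p)` are nonnegative and dropped, and `p ≤ 4` gives the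
`16`. The bracket is positive before saturation, where `(1+εσ)⁻¹` is near `1`, but may drop towards
`-5` beyond it. -/
theorem le_carlemanPot {τ ε : ℝ} (hτ : 0 ≤ τ) (hε : 0 ≤ ε) (k : ℝ) (x : Space d) :
    wtGrad τ ε x ^ 2 * (sig x - 1) * (16 / 3 * (1 + ε * sig x)⁻¹ - 5) + k ^ 2
      - (d ^ 2 + 16) * wtGrad τ ε x ≤ carlemanPot (wtGrad τ ε) k x := by
  rw [carlemanPot_eq (contDiff_wtGrad τ hε) (contDiff_wtRate hε) (euler_wtGrad τ hε)]
  have h1 := wtGrad_nonneg hτ hε x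
  have h2 := wtRate_nonneg hε x
  have h3 := wtRate_le_four hε x
  have h4 := mul_nonneg h1 (euler_wtRate_nonneg hε x)
  have h5 : wtGrad τ ε x * wtRate ε x ^ 2 ≤ wtGrad τ ε x * 16 :=
    mul_le_mul_of_nonneg_left (by nlinarith) h1
  have h6 : 0 ≤ 2 * d * wtGrad τ ε x * wtRate ε x := by positivity
  have h7 : 16 / 3 * (1 + ε * sig x)⁻¹ - 5 ≤ 3 - 2 * wtRate ε x := by
    have g1 : 0 < (sig x)⁻¹ := inv_pos.2 (sig_pos x)
    have g2 : (1 + ε * sig x)⁻¹ ≤ 1 := inv_le_one_of_one_le₀ (by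
      linarith [mul_nonneg hε (sig_pos x).le])
    unfold wtRate
    nlinarith
  have h8 : 0 ≤ wtGrad τ ε x ^ 2 * (sig x - 1) :=
    mul_nonneg (sq_nonneg _) (by linarith [one_le_sig x])
  have h9 := mul_le_mul_of_nonneg_left h7 h8
  linarith

theorem wtGrad_mul_sig {τ ε : ℝ} (hε : 0 ≤ ε) (x : Space d) :
    wtGrad τ ε x * sig x = 2 / 3 * (wt τ ε x * (1 + ε * sig x)⁻¹) := by
  have h1 := one_add_mul_sig_pos hε x
  have hσ := sig_pos x
  rw [wtGrad]
  field_simp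

theorem half_le_wt {τ ε : ℝ} (hτ : 0 ≤ τ) (hε : 0 ≤ ε) {x : Space d}
    (hx : ε * sig x ≤ 1 / 31) : τ / 2 ≤ wt τ ε x := by
  have ht : (1 / 8 : ℝ) ≤ sig x / (1 + ε * sig x) := by
    rw [le_div_iff₀ (one_add_mul_sig_pos hε x)]
    linarith [one_le_sig x]
  have h8 : (1 / 8 : ℝ) ^ (1 / 3 : ℝ) = 1 / 2 := by
    rw [show (1 / 8 : ℝ) = (1 / 2) ^ (3 : ℝ) by norm_num, ← Real.rpow_mul (by norm_num)]
    norm_num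
  have := Real.rpow_le_rpow (by norm_num) ht (show (0 : ℝ) ≤ 1 / 3 by norm_num)
  rw [h8] at this
  rw [wt, wtProfile, div_eq_mul_one_div]
  exact mul_le_mul_of_nonneg_left this hτ

/-- Before saturation, `aσ` is at least a fixed multiple of `τ`, and `|x| ≥ r` gives `σ - 1 ≥ κσ`.
Hence `a²(σ-1) ≥ κ(aσ)²/σ`, which for large `τ` exceeds both `K/σ` and `N a`. The factor `σ - 1`
vanishes at the origin, so a ball has to be excluded. -/
theorem weight_near {τ ε r K N : ℝ} (hr : 0 < r) (hK : 0 ≤ K) (hN : 0 ≤ N) (hε : 0 ≤ ε)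
    (hτ : 4 * (6 * (N + K) / (r ^ 2 / (1 + r ^ 2)) + 1) ≤ τ) {x : Space d} (hx : r ≤ ‖x‖)
    (hcase : ε * sig x ≤ 1 / 31) :
    K / sig x + N * wtGrad τ ε x
      ≤ wtGrad τ ε x ^ 2 * (sig x - 1) * (16 / 3 * (1 + ε * sig x)⁻¹ - 5) := by
  set κ := r ^ 2 / (1 + r ^ 2) with hκ
  have hκ0 : 0 < κ := by positivity
  have hX : 0 ≤ 6 * (N + K) / κ := by positivity
  have hτ0 : 0 ≤ τ := by linarith
  have h1 := one_add_mul_sig_pos hε x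
  have hσ := sig_pos x
  have hσ1 := one_le_sig x
  -- The threshold `1/31` makes the bracket at least `(16/3)(31/32) - 5 = 1/6`.
  have hinv : 31 / 32 ≤ (1 + ε * sig x)⁻¹ := by
    rw [le_inv_comm₀ (by norm_num) h1]
    norm_num
    linarith
  have e1 := wtGrad_mul_sig (τ := τ) hε x
  have e2 := mul_le_mul (half_le_wt hτ0 hε hcase) hinv (by norm_num) (wt_nonneg hτ0 hε x)
  have hσκ : κ * sig x ≤ sig x - 1 := by
    rw [hκ, div_mul_eq_mul_div, div_le_iff₀ (by positivity), sig]
    nlinarith [mul_self_le_mul_self hr.le hx]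
  generalize wtGrad τ ε x = A at *
  generalize sig x = σ at *
  have hy : 6 * (N + K) / κ + 1 ≤ A * σ := by linarith
  have hyκ : 6 * (N + K) ≤ A * σ * κ := by
    rw [← div_le_iff₀ hκ0]
    linarith
  have hmain : K / σ + N * A ≤ A ^ 2 * (σ - 1) / 6 := by
    have e1 : K / σ + N * A = (K + N * (A * σ)) / σ := by
      field_simp
    rw [e1, div_le_iff₀ hσ]
    have e2 := mul_le_mul_of_nonneg_left hσκ (mul_nonneg (sq_nonneg A) hσ.le)
    have e3 : (A * σ) * (6 * (N + K)) ≤ (A * σ) * (A * σ * κ) :=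
      mul_le_mul_of_nonneg_left hyκ (by linarith)
    have e4 : K * 1 ≤ K * (A * σ) := mul_le_mul_of_nonneg_left (by linarith) hK
    linarith
  have hB : 0 ≤ A ^ 2 * (σ - 1) := mul_nonneg (sq_nonneg _) (by linarith)
  have e3 := mul_le_mul_of_nonneg_left hinv hB
  linarith

theorem wtGrad_mul_rpow_le {τ ε : ℝ} (hτ : 0 ≤ τ) (hε : 0 ≤ ε) (x : Space d) :
    wtGrad τ ε x * (sig x ^ (1 / 3 : ℝ)) ^ 2 ≤ τ := by
  have hσ := sig_pos x
  have h1 := one_add_mul_sig_pos hε x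
  have hw := wt_nonneg hτ hε x
  have hm3 : (sig x ^ (1 / 3 : ℝ)) ^ 3 = sig x := by
    rw [← Real.rpow_natCast, ← Real.rpow_mul hσ.le]
    norm_num
  have hm0 : 0 < sig x ^ (1 / 3 : ℝ) := Real.rpow_pos_of_pos hσ _
  have e1 : wt τ ε x ≤ τ * sig x ^ (1 / 3 : ℝ) := by
    rw [wt, wtProfile]
    refine mul_le_mul_of_nonneg_left (Real.rpow_le_rpow (div_pos hσ h1).le ?_ (by norm_num)) hτ
    exact div_le_self hσ.le (by linarith [mul_nonneg hε hσ.le])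
  have e2 : wtGrad τ ε x * sig x ≤ wt τ ε x := by
    rw [wtGrad_mul_sig hε]
    have := mul_le_mul_of_nonneg_left (inv_le_one_of_one_le₀ (show 1 ≤ 1 + ε * sig x by
      linarith [mul_nonneg hε hσ.le])) hw
    linarith
  refine le_of_mul_le_mul_right ?_ hm0
  rw [mul_assoc, ← pow_succ, hm3]
  exact e2.trans e1

/-- Beyond the threshold the leading term may be negative, but `a²(σ-1)`, `a` and `1/σ` are at most
`τ²`, `τ` and `1` times `σ^(-1/3)`. All of them together are at most `Z σ^(-1/3)`. The bound on `ε`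
forces `σ^(1/3) ≥ 2Z/k²`, so half of `k²` compensates for the loss. -/
theorem weight_far {τ ε k K N : ℝ} (hτ : 0 < τ) (hK : 0 ≤ K) (hk : 0 < k) (hN : 0 ≤ N)
    (hε : 0 ≤ ε) {x : Space d} (hcase : 1 / 31 < ε * sig x)
    (hεb : ε ≤ (k ^ 2 / (2 * (5 * τ ^ 2 + N * τ + K))) ^ 3 / 31) :
    K / sig x + N * wtGrad τ ε x - k ^ 2 / 2
      ≤ wtGrad τ ε x ^ 2 * (sig x - 1) * (16 / 3 * (1 + ε * sig x)⁻¹ - 5) := by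
  set Z := 5 * τ ^ 2 + N * τ + K with hZ
  have hZ0 : 0 < Z := by positivity
  set b := k ^ 2 / (2 * Z) with hb
  have hb0 : 0 < b := by positivity
  have h1 := inv_pos.2 (one_add_mul_sig_pos hε x)
  have hσ := sig_pos x
  have hσ1 := one_le_sig x
  have hA0 := wtGrad_nonneg hτ.le hε x
  have hAm := wtGrad_mul_rpow_le hτ.le hε x
  have hm3 : (sig x ^ (1 / 3 : ℝ)) ^ 3 = sig x := by
    rw [← Real.rpow_natCast, ← Real.rpow_mul hσ.le]
    norm_num
  have hm1 : 1 ≤ sig x ^ (1 / 3 : ℝ) := Real.one_le_rpow hσ1 (by norm_num)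
  generalize wtGrad τ ε x = A at *
  generalize sig x ^ (1 / 3 : ℝ) = m at *
  generalize sig x = σ at *
  generalize (1 + ε * σ)⁻¹ = ι at *
  have hm0 : 0 < m := by linarith
  have hbm : 1 ≤ b * m := by
    have : 1 ≤ (b * m) ^ 3 := by
      rw [mul_pow, hm3]
      have := mul_le_mul_of_nonneg_right hεb hσ.le
      linarith
    by_contra hcon
    exact absurd this (not_le.2 (pow_lt_one₀ (by positivity) (not_le.1 hcon) (by norm_num)))
  have hZm : Z / m ≤ k ^ 2 / 2 := by
    rw [div_le_iff₀ hm0]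
    have e1 : b * (2 * Z) = k ^ 2 := by
      rw [hb]
      field_simp
    have e2 := mul_le_mul_of_nonneg_left hbm hZ0.le
    have e3 : Z * (b * m) = k ^ 2 / 2 * m := by
      rw [← e1]
      ring
    linarith
  have t1 : A ^ 2 * (σ - 1) ≤ τ ^ 2 / m := by
    rw [le_div_iff₀ hm0]
    have e1 : (A * m ^ 2) ^ 2 ≤ τ ^ 2 := pow_le_pow_left₀ (by positivity) hAm 2
    have e2 : (A * m ^ 2) ^ 2 = A ^ 2 * σ * m := by
      rw [← hm3]
      ring
    linarith [mul_nonneg (sq_nonneg A) hm0.le]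
  have t2 : A ≤ τ / m := by
    rw [le_div_iff₀ hm0]
    exact (mul_le_mul_of_nonneg_left (by nlinarith) hA0).trans hAm
  have t3 : K / σ ≤ K / m := by
    refine div_le_div_of_nonneg_left hK hm0 ?_
    rw [← hm3]
    exact le_self_pow₀ hm1 (by norm_num)
  have e : Z / m = 5 * (τ ^ 2 / m) + N * (τ / m) + K / m := by
    rw [hZ]
    ring
  have hB : 0 ≤ A ^ 2 * (σ - 1) := mul_nonneg (sq_nonneg _) (by linarith)
  have hinv : 0 ≤ A ^ 2 * (σ - 1) * (16 / 3 * ι) := mul_nonneg hB (by linarith)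
  have t4 := mul_le_mul_of_nonneg_left t2 hN
  linarith

/-- For large `τ` and then small `ε`, the weight makes the Carleman inequality coercive. -/
theorem exists_weight (d : ℕ) {K k r : ℝ} (hK : 0 ≤ K) (hk : 0 < k) (hr : 0 < r) :
    ∃ τ₀ : ℝ, 0 < τ₀ ∧ ∀ τ : ℝ, τ₀ ≤ τ → ∃ ε : ℝ, 0 < ε ∧ ε ≤ 1 ∧ ∀ x : Space d, r ≤ ‖x‖ →
      K / sig x + k ^ 2 / 2 ≤ carlemanPot (wtGrad τ ε) k x := by
  have hN : (0 : ℝ) < d ^ 2 + 16 := by positivity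
  have hτ₀ : 0 < 4 * (6 * ((d : ℝ) ^ 2 + 16 + K) / (r ^ 2 / (1 + r ^ 2)) + 1) := by positivity
  refine ⟨_, hτ₀, fun τ hτ ↦ ?_⟩
  have hτ0 : 0 < τ := hτ₀.trans_le hτ
  refine ⟨min 1 ((k ^ 2 / (2 * (5 * τ ^ 2 + (d ^ 2 + 16) * τ + K))) ^ 3 / 31), by positivity,
    min_le_left _ _, fun x hx ↦ ?_⟩
  have hεb := min_le_right 1 ((k ^ 2 / (2 * (5 * τ ^ 2 + (d ^ 2 + 16) * τ + K))) ^ 3 / 31)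
  have hε0 : 0 ≤ min 1 ((k ^ 2 / (2 * (5 * τ ^ 2 + (d ^ 2 + 16) * τ + K))) ^ 3 / 31) := by
    positivity
  generalize min 1 ((k ^ 2 / (2 * (5 * τ ^ 2 + (d ^ 2 + 16) * τ + K))) ^ 3 / 31) = ε at *
  refine le_trans ?_ (le_carlemanPot hτ0.le hε0 k x)
  rcases le_or_gt (ε * sig x) (1 / 31) with hcase | hcase
  · linarith [weight_near hr hK hN.le hε0 hτ hx hcase, sq_nonneg k]
  · linarith [weight_far hτ0 hK hk hN.le hε0 hcase hεb]

theorem wtProfile_mono {τ ε s t : ℝ} (hτ : 0 ≤ τ) (hε : 0 ≤ ε) (hs : 0 < s) (hst : s ≤ t) :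
    wtProfile τ ε s ≤ wtProfile τ ε t := by
  have h1 : 0 < 1 + ε * s := by positivity
  have h2 : 0 < 1 + ε * t := by
    have := hs.trans_le hst
    positivity
  refine mul_le_mul_of_nonneg_left (Real.rpow_le_rpow (div_pos hs h1).le ?_ (by norm_num)) hτ
  rw [div_le_div_iff₀ h1 h2]
  nlinarith

theorem wtProfile_le {τ ε s : ℝ} (hτ : 0 ≤ τ) (hε : 0 < ε) (hs : 0 < s) :
    wtProfile τ ε s ≤ τ * (1 / ε) ^ (1 / 3 : ℝ) := by
  have h1 : 0 < 1 + ε * s := by positivity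
  refine mul_le_mul_of_nonneg_left (Real.rpow_le_rpow (div_pos hs h1).le ?_ (by norm_num)) hτ
  rw [div_le_div_iff₀ h1 hε]
  linarith

/-- The gap `c` does not depend on `ε`, so it survives choosing `ε` after `τ`. The cubes of the two
profiles differ by `(t-s)/((1+εs)(1+εt))`, and dividing by `B² + AB + A² ≤ 3t²` gives the gap. -/
theorem exists_wtProfile_gap {s t : ℝ} (hs : 1 ≤ s) (hst : s < t) :
    ∃ c : ℝ, 0 < c ∧ ∀ τ ε : ℝ, 0 ≤ τ → 0 ≤ ε → ε ≤ 1 →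
      wtProfile τ ε s + c * τ ≤ wtProfile τ ε t := by
  have hs0 : 0 < s := by linarith
  have ht0 : 0 < t := by linarith
  have hts : 0 < t - s := sub_pos.2 hst
  refine ⟨(t - s) / ((1 + s) * (1 + t)) / (3 * t ^ 2), by positivity, fun τ ε hτ hε hε1 ↦ ?_⟩
  have h1 : 0 < 1 + ε * s := by positivity
  have h2 : 0 < 1 + ε * t := by positivity
  set A := (s / (1 + ε * s)) ^ (1 / 3 : ℝ) with hA
  set B := (t / (1 + ε * t)) ^ (1 / 3 : ℝ) with hB
  have hA3 : A ^ 3 = s / (1 + ε * s) := by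
    rw [hA, ← Real.rpow_natCast, ← Real.rpow_mul (by positivity)]
    norm_num
  have hB3 : B ^ 3 = t / (1 + ε * t) := by
    rw [hB, ← Real.rpow_natCast, ← Real.rpow_mul (by positivity)]
    norm_num
  have hA0 : 0 ≤ A := by positivity
  have hB0 : 0 ≤ B := by positivity
  have hAB : A ≤ B := by
    have := wtProfile_mono (zero_le_one (α := ℝ)) hε hs0 hst.le
    simpa only [wtProfile, one_mul] using this
  have hBt : B ≤ t := by
    by_contra hcon
    have h3 : t ^ 3 < B ^ 3 := pow_lt_pow_left₀ (not_le.1 hcon) ht0.le (by norm_num)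
    rw [hB3] at h3
    have h4 : t / (1 + ε * t) ≤ t := div_le_self ht0.le (by linarith [mul_nonneg hε ht0.le])
    have h5 : t ≤ t ^ 3 := le_self_pow₀ (by linarith) (by norm_num)
    linarith
  have hdiff : (t - s) / ((1 + s) * (1 + t)) ≤ B ^ 3 - A ^ 3 := by
    have e : B ^ 3 - A ^ 3 = (t - s) / ((1 + ε * s) * (1 + ε * t)) := by
      rw [hA3, hB3]
      field_simp
      ring
    rw [e]
    refine div_le_div_of_nonneg_left hts.le (by positivity) (mul_le_mul ?_ ?_ h2.le (by linarith))
    · nlinarith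
    · nlinarith
  have hle : B ^ 3 - A ^ 3 ≤ (B - A) * (3 * t ^ 2) := by
    have e : B ^ 3 - A ^ 3 = (B - A) * (B ^ 2 + A * B + A ^ 2) := by ring
    rw [e]
    refine mul_le_mul_of_nonneg_left ?_ (sub_nonneg.2 hAB)
    nlinarith
  have hc : (t - s) / ((1 + s) * (1 + t)) / (3 * t ^ 2) ≤ B - A := by
    rw [div_le_iff₀ (by positivity)]
    exact hdiff.trans hle
  have := mul_le_mul_of_nonneg_left hc hτ
  simp only [wtProfile]
  linarith

/-! ### Annular cutoffs and commutator terms -/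

/-- The cutoff to the annulus between the scales `a` and `b`. -/
def annCut (a b : ℝ) (x : Space d) : ℝ := cut b x + -1 * cut a x

@[fun_prop]
theorem contDiff_annCut (a b : ℝ) : ContDiff ℝ ∞ (annCut a b : Space d → ℝ) := by
  unfold annCut
  fun_prop

theorem hasCompactSupport_annCut {a b : ℝ} (ha : 0 < a) (hb : 0 < b) :
    HasCompactSupport (annCut a b : Space d → ℝ) :=
  (hasCompactSupport_cut hb).add (hasCompactSupport_cut ha).mul_left

theorem annCut_eq_zero {a b : ℝ} (ha : 0 < a) (hab : a ≤ b) {x : Space d} (hx : ‖x‖ ≤ a) :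
    annCut a b x = 0 := by
  rw [annCut, cut_eq_one ha hx, cut_eq_one (ha.trans_le hab) (hx.trans hab)]
  ring

theorem annCut_eq_one {a b : ℝ} (ha : 0 < a) (hb : 0 < b) {x : Space d} (h1 : 2 * a ≤ ‖x‖)
    (h2 : ‖x‖ ≤ b) : annCut a b x = 1 := by
  rw [annCut, cut_eq_zero ha h1, cut_eq_one hb h2]
  ring

theorem annCut_sq_le_one (a b : ℝ) (x : Space d) : annCut a b x ^ 2 ≤ 1 := by
  have h1 := cut_nonneg a x
  have h2 := cut_le_one a x
  have h3 := cut_nonneg b x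
  have h4 := cut_le_one b x
  rw [sq_le_one_iff_abs_le_one, abs_le]
  unfold annCut
  constructor <;> linarith

theorem pd_annCut (a b : ℝ) (i : Fin d) :
    pd i (annCut a b) = fun x ↦ pd i (cut b) x + -1 * pd i (cut a) x := by
  rw [show (annCut a b : Space d → ℝ) = fun x ↦ cut b x + -1 * cut a x from rfl,
    pd_add (contDiff_cut b) (by fun_prop), pd_const_mul _ (contDiff_cut a)]

theorem gradDot_annCut_le (a b : ℝ) (x : Space d) :
    gradDot (annCut a b) (annCut a b) x
      ≤ 2 * gradDot (cut b) (cut b) x + 2 * gradDot (cut a) (cut a) x := by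
  simp only [gradDot, pd_annCut, Finset.mul_sum, ← Finset.sum_add_distrib]
  refine Finset.sum_le_sum fun i _ ↦ ?_
  nlinarith [sq_nonneg (pd i (cut b) x + pd i (cut a) x)]

theorem lap_annCut_sq_le (a b : ℝ) (x : Space d) :
    lap (annCut a b) x ^ 2 ≤ 2 * lap (cut b) x ^ 2 + 2 * lap (cut a) x ^ 2 := by
  have h : lap (annCut a b) x = lap (cut b) x - lap (cut a) x := by
    simp only [lap, pd_annCut, ← Finset.sum_sub_distrib]
    refine Finset.sum_congr rfl fun i _ ↦ ?_
    rw [pd_add (contDiff_pd (contDiff_cut b) i)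
      (contDiff_const.mul (contDiff_pd (contDiff_cut a) i)),
      pd_const_mul _ (contDiff_pd (contDiff_cut a) i)]
    ring
  rw [h]
  nlinarith [sq_nonneg (lap (cut b) x + lap (cut a) x)]

/-- Two applications of `(a+b)² ≤ 2a² + 2b²` to `χ(Δv + k²v) + (2∇χ · ∇v + vΔχ)`. -/
theorem helmholtz_cutoff_sq_le {χ v : Space d → ℝ} (hχ : ContDiff ℝ ∞ χ) (hv : ContDiff ℝ ∞ v)
    (k : ℝ) (x : Space d) :
    (lap (fun x ↦ χ x * v x) x + k ^ 2 * (χ x * v x)) ^ 2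
      ≤ 2 * (χ x ^ 2 * (lap v x + k ^ 2 * v x) ^ 2)
        + (16 * gradDot χ χ x * gradDot v v x + 4 * lap χ x ^ 2 * v x ^ 2) := by
  rw [lap_mul hχ hv]
  have h := gradDot_sq_le χ v x
  have e1 := sq_nonneg (χ x * (lap v x + k ^ 2 * v x) - (2 * gradDot χ v x + lap χ x * v x))
  have e2 := sq_nonneg (2 * gradDot χ v x - lap χ x * v x)
  nlinarith

theorem gradDot_cut_eq_zero {R : ℝ} (hR : 0 < R) {x : Space d} (hx : ‖x‖ < R ∨ 2 * R < ‖x‖)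
    (g : Space d → ℝ) : gradDot (cut R) g x = 0 := by
  rcases hx with hx | hx
  · exact gradDot_eq_zero_of_eventually_const (cut_eventuallyEq_one hx) g
  · exact gradDot_eq_zero_of_eventually_const (cut_eventuallyEq_zero hR hx) g

theorem lap_cut_eq_zero {R : ℝ} (hR : 0 < R) {x : Space d} (hx : ‖x‖ < R ∨ 2 * R < ‖x‖) :
    lap (cut R) x = 0 := by
  rcases hx with hx | hx
  · exact lap_eq_zero_of_eventually_const (cut_eventuallyEq_one hx)
  · exact lap_eq_zero_of_eventually_const (cut_eventuallyEq_zero hR hx)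

/-- The size of the commutator terms at scale `R`. -/
def commConst (C K R : ℝ) : ℝ := (2 + 8 * R ^ 2 + C) * (32 * K * (1 / R ^ 2 + 1 / R ^ 4))

theorem commConst_nonneg {C K R : ℝ} (hC : 0 ≤ C) (hK : 0 ≤ K) : 0 ≤ commConst C K R := by
  unfold commConst
  positivity

/-- The derivatives of `cut R` live on `R ≤ |x| ≤ 2R`, where `annCut (R / 2) (2 * R)` equals `1`.
This wider cutoff is the one used later in the Caccioppoli inequality. -/
theorem comm_term_le {v ρ : Space d → ℝ} {C K R E : ℝ} (hC : 0 ≤ C) (hK0 : 0 ≤ K) (hR : 0 < R)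
    (hK : ∀ x : Space d, gradDot (cut R) (cut R) x ≤ K / R ^ 2 ∧ lap (cut R) x ^ 2 ≤ K / R ^ 4)
    (hE : ∀ x : Space d, ‖x‖ ≤ 2 * R → Real.exp (2 * ρ x) ≤ E) (x : Space d) :
    (2 * sig x + C) * Real.exp (2 * ρ x)
        * (32 * gradDot (cut R) (cut R) x * gradDot v v x + 8 * lap (cut R) x ^ 2 * v x ^ 2)
      ≤ commConst C K R * E
        * (annCut (R / 2) (2 * R) x ^ 2 * v x ^ 2
          + annCut (R / 2) (2 * R) x ^ 2 * gradDot v v x) := by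
  have hE0 : 0 ≤ E := (Real.exp_pos _).le.trans (hE 0 (by rw [norm_zero]; linarith))
  have hG := gradDot_self_nonneg v x
  have hcc := commConst_nonneg (R := R) hC hK0
  by_cases hx : ‖x‖ < R ∨ 2 * R < ‖x‖
  · rw [gradDot_cut_eq_zero hR hx, lap_cut_eq_zero hR hx]
    simp only [mul_zero, zero_mul, add_zero, ne_eq, OfNat.ofNat_ne_zero, not_false_eq_true,
      zero_pow]
    positivity
  · push Not at hx
    rw [annCut_eq_one (by linarith) (by linarith) (by linarith) hx.2, one_pow, one_mul, one_mul]
    have h1 : 2 * sig x + C ≤ 2 + 8 * R ^ 2 + C := by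
      unfold sig
      nlinarith [norm_nonneg x]
    have h2 : 32 * gradDot (cut R) (cut R) x * gradDot v v x + 8 * lap (cut R) x ^ 2 * v x ^ 2
        ≤ 32 * K * (1 / R ^ 2 + 1 / R ^ 4) * (v x ^ 2 + gradDot v v x) := by
      have a1 := mul_le_mul_of_nonneg_right (hK x).1 hG
      have a2 := mul_le_mul_of_nonneg_right (hK x).2 (sq_nonneg (v x))
      have a3 : 0 ≤ K / R ^ 2 * v x ^ 2 := by positivity
      have a4 : 0 ≤ K / R ^ 4 * gradDot v v x := by positivity
      have a5 : 0 ≤ K / R ^ 4 * v x ^ 2 := by positivity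
      have e : 32 * K * (1 / R ^ 2 + 1 / R ^ 4) * (v x ^ 2 + gradDot v v x)
          = 32 * (K / R ^ 2 * v x ^ 2 + K / R ^ 2 * gradDot v v x + K / R ^ 4 * v x ^ 2
            + K / R ^ 4 * gradDot v v x) := by ring
      rw [e]
      linarith
    have h3 : 0 ≤ 32 * gradDot (cut R) (cut R) x * gradDot v v x
        + 8 * lap (cut R) x ^ 2 * v x ^ 2 := by
      have := gradDot_self_nonneg (cut R) x
      positivity
    have h4 : 0 ≤ 2 * sig x + C := by linarith [sig_pos x]
    have h5 := mul_le_mul h1 (hE x hx.2) (Real.exp_pos _).le (h4.trans h1)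
    have h6 := mul_le_mul h5 h2 h3 (mul_nonneg (h4.trans h1) hE0)
    refine h6.trans (le_of_eq ?_)
    unfold commConst
    ring

/-- The quadratic form that bounds the commutator terms at scale `R`. -/
def commForm (R : ℝ) (u g : Space d → ℝ) : ℝ :=
  2 * (∫ x, annCut (R / 2) (2 * R) x ^ 2 * u x ^ 2)
    + (∫ x, annCut (R / 2) (2 * R) x ^ 2 * g x ^ 2)
    + 4 * ∫ x, gradDot (annCut (R / 2) (2 * R)) (annCut (R / 2) (2 * R)) x * u x ^ 2

/-- The Carleman inequality for `annCut r N * v`. The commutators sit near `|x| ~ r` and `|x| ~ N`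
and are bounded there by the supremum of the weight times a form without gradients. -/
theorem carleman_cutoff_smooth {ρ a v : Space d → ℝ} (hρ : ContDiff ℝ ∞ ρ)
    (ha : ContDiff ℝ ∞ a) (hv : ContDiff ℝ ∞ v) (hρa : ∀ i, pd i ρ = fun x ↦ a x * x i)
    (ha0 : ∀ x, 0 ≤ a x) (k : ℝ) {κ C K r N Er En : ℝ} (hκ : 0 < κ)
    (hC : C = (d - 1) ^ 2 / (4 * κ)) (hK0 : 0 ≤ K) (hr : 0 < r) (hN : 0 < N)
    (hK : ∀ R : ℝ, 0 < R → ∀ x : Space d,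
      gradDot (cut R) (cut R) x ≤ K / R ^ 2 ∧ lap (cut R) x ^ 2 ≤ K / R ^ 4)
    (hEr : ∀ x : Space d, ‖x‖ ≤ 2 * r → Real.exp (2 * ρ x) ≤ Er)
    (hEn : ∀ x : Space d, ‖x‖ ≤ 2 * N → Real.exp (2 * ρ x) ≤ En) :
    ∫ x, (carlemanPot a k x - κ) * Real.exp (2 * ρ x) * annCut r N x ^ 2 * v x ^ 2
      ≤ (∫ x, 2 * (2 * sig x + C) * Real.exp (2 * ρ x) * annCut r N x ^ 2
          * (lap v x + k ^ 2 * v x) ^ 2)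
        + (commConst C K r * Er * commForm r v (lap v)
          + commConst C K N * En * commForm N v (lap v)) := by
  have hC0 : 0 ≤ C := by
    rw [hC]
    positivity
  have hexp : ContDiff ℝ ∞ fun x ↦ Real.exp (2 * ρ x) := (contDiff_const.mul hρ).exp
  have hχ := contDiff_annCut (d := d) r N
  have hχc := hasCompactSupport_annCut (d := d) hr hN
  have hG := contDiff_gradDot hv hv
  have main := carleman_inequality hρ ha (hχ.mul hv) hχc.mul_right hρa ha0 k hκ
  rw [← hC] at main
  have iη : ∀ R : ℝ, 0 < R → ∀ f : Space d → ℝ, ContDiff ℝ ∞ f →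
      Integrable fun x ↦ annCut (R / 2) (2 * R) x ^ 2 * f x := by
    intro R hR f hf
    refine integrable_of_eq_zero_of_notMem
      (hasCompactSupport_annCut (d := d) (half_pos hR) (show 0 < 2 * R by linarith))
      (ContDiff.continuous (𝕜 := ℝ) (n := ∞) (by fun_prop)) fun x hx ↦ ?_
    simp [image_eq_zero_of_notMem_tsupport hx]
  have iS : ∀ R : ℝ, 0 < R → Integrable fun x ↦ annCut (R / 2) (2 * R) x ^ 2 * v x ^ 2
      + annCut (R / 2) (2 * R) x ^ 2 * gradDot v v x := fun R hR ↦
    (iη R hR _ (hv.pow 2)).fun_add (iη R hR _ hG)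
  have hform : ∀ R : ℝ, 0 < R → ∫ x, (annCut (R / 2) (2 * R) x ^ 2 * v x ^ 2
      + annCut (R / 2) (2 * R) x ^ 2 * gradDot v v x) ≤ commForm R v (lap v) := by
    intro R hR
    -- Caccioppoli removes the gradient from the commutators; the coefficients `2, 1, 4` of
    -- `commForm` arise here.
    have hc := integral_sq_mul_gradDot_le (contDiff_annCut (R / 2) (2 * R))
      (hasCompactSupport_annCut (half_pos hR) (show 0 < 2 * R by linarith)) hv
    rw [integral_add (iη R hR _ (hv.pow 2)) (iη R hR _ hG)]
    unfold commForm
    linarith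
  have i1 : Integrable fun x ↦ 2 * (2 * sig x + C) * Real.exp (2 * ρ x) * annCut r N x ^ 2
      * (lap v x + k ^ 2 * v x) ^ 2 := by
    refine integrable_of_eq_zero_of_notMem hχc
      (ContDiff.continuous (𝕜 := ℝ) (n := ∞) (by fun_prop)) fun x hx ↦ ?_
    simp [image_eq_zero_of_notMem_tsupport hx]
  have i0 : Integrable fun x ↦ (2 * sig x + C) * Real.exp (2 * ρ x)
      * (lap (fun x ↦ annCut r N x * v x) x + k ^ 2 * (annCut r N x * v x)) ^ 2 := by
    have hw := hχ.mul hv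
    have hl := contDiff_lap hw
    refine integrable_of_smooth (by fun_prop) (HasCompactSupport.mul_left ?_)
    exact hasCompactSupport_sq ((hasCompactSupport_lap hχc.mul_right).add
      hχc.mul_right.mul_left)
  have i2 := (iS r hr).const_mul (commConst C K r * Er)
  have i3 := (iS N hN).const_mul (commConst C K N * En)
  have step : ∫ x, (2 * sig x + C) * Real.exp (2 * ρ x)
      * (lap (fun x ↦ annCut r N x * v x) x + k ^ 2 * (annCut r N x * v x)) ^ 2
      ≤ (∫ x, 2 * (2 * sig x + C) * Real.exp (2 * ρ x) * annCut r N x ^ 2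
          * (lap v x + k ^ 2 * v x) ^ 2)
        + (commConst C K r * Er * (∫ x, (annCut (r / 2) (2 * r) x ^ 2 * v x ^ 2
            + annCut (r / 2) (2 * r) x ^ 2 * gradDot v v x))
          + commConst C K N * En * ∫ x, (annCut (N / 2) (2 * N) x ^ 2 * v x ^ 2
            + annCut (N / 2) (2 * N) x ^ 2 * gradDot v v x)) := by
    rw [← integral_const_mul, ← integral_const_mul, ← integral_add i2 i3,
      ← integral_add i1 (i2.fun_add i3)]
    refine integral_mono i0 (i1.fun_add (i2.fun_add i3)) fun x ↦ ?_
    simp only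
    have p0 : 0 ≤ (2 * sig x + C) * Real.exp (2 * ρ x) :=
      mul_nonneg (by linarith [sig_pos x]) (Real.exp_pos _).le
    have p1 := mul_le_mul_of_nonneg_left (helmholtz_cutoff_sq_le hχ hv k x) p0
    have p2 := comm_term_le (v := v) hC0 hK0 hr (hK r hr) hEr x
    have p3 := comm_term_le (v := v) hC0 hK0 hN (hK N hN) hEn x
    have p4 := mul_le_mul_of_nonneg_right (gradDot_annCut_le r N x) (gradDot_self_nonneg v x)
    have p5 := mul_le_mul_of_nonneg_right (lap_annCut_sq_le r N x) (sq_nonneg (v x))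
    have p6 : (2 * sig x + C) * Real.exp (2 * ρ x)
        * (16 * gradDot (annCut r N) (annCut r N) x * gradDot v v x
          + 4 * lap (annCut r N) x ^ 2 * v x ^ 2)
        ≤ (2 * sig x + C) * Real.exp (2 * ρ x)
          * ((32 * gradDot (cut r) (cut r) x * gradDot v v x + 8 * lap (cut r) x ^ 2 * v x ^ 2)
            + (32 * gradDot (cut N) (cut N) x * gradDot v v x
              + 8 * lap (cut N) x ^ 2 * v x ^ 2)) :=
      mul_le_mul_of_nonneg_left (by linarith) p0
    rw [mul_add] at p6 p1
    linarith
  have c1 : 0 ≤ commConst C K r * Er := mul_nonneg (commConst_nonneg hC0 hK0)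
    ((Real.exp_pos _).le.trans (hEr 0 (by rw [norm_zero]; linarith)))
  have c2 : 0 ≤ commConst C K N * En := mul_nonneg (commConst_nonneg hC0 hK0)
    ((Real.exp_pos _).le.trans (hEn 0 (by rw [norm_zero]; linarith)))
  have e : ∫ x, (carlemanPot a k x - κ) * Real.exp (2 * ρ x) * annCut r N x ^ 2 * v x ^ 2
      = ∫ x, (carlemanPot a k x - κ) * Real.exp (2 * ρ x) * (annCut r N x * v x) ^ 2 := by
    congr 1
    ext x
    ring
  rw [e]
  linarith [mul_le_mul_of_nonneg_left (hform r hr) c1, mul_le_mul_of_nonneg_left (hform N hN) c2]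

theorem tendsto_commForm {u g : Space d → ℝ} {v w : ℕ → Space d → ℝ} (hvu : LocTendsto v u)
    (hwg : LocTendsto w g) {R : ℝ} (hR : 0 < R) :
    Tendsto (fun n ↦ commForm R (v n) (w n)) atTop (𝓝 (commForm R u g)) := by
  have hη := contDiff_annCut (d := d) (R / 2) (2 * R)
  have hηc := hasCompactSupport_annCut (d := d) (half_pos hR) (show 0 < 2 * R by linarith)
  have c2 : Continuous fun x : Space d ↦ annCut (R / 2) (2 * R) x ^ 2 := hη.continuous.pow 2
  exact (((hvu.integral_mul_sq c2 (hasCompactSupport_sq hηc)).const_mul 2).add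
    (hwg.integral_mul_sq c2 (hasCompactSupport_sq hηc))).add
    ((hvu.integral_mul_sq (contDiff_gradDot hη hη).continuous
      (hasCompactSupport_gradDot hηc)).const_mul 4)

theorem carleman_cutoff_weak {ρ a u g : Space d → ℝ} (hρ : ContDiff ℝ ∞ ρ)
    (ha : ContDiff ℝ ∞ a) (h : IsWeakLap u g) (hu : LocL2 u) (hg : LocL2 g)
    (hρa : ∀ i, pd i ρ = fun x ↦ a x * x i)
    (ha0 : ∀ x, 0 ≤ a x) (k : ℝ) {κ C K r N Er En : ℝ} (hκ : 0 < κ)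
    (hC : C = (d - 1) ^ 2 / (4 * κ)) (hK0 : 0 ≤ K) (hr : 0 < r) (hN : 0 < N)
    (hK : ∀ R : ℝ, 0 < R → ∀ x : Space d,
      gradDot (cut R) (cut R) x ≤ K / R ^ 2 ∧ lap (cut R) x ^ 2 ≤ K / R ^ 4)
    (hEr : ∀ x : Space d, ‖x‖ ≤ 2 * r → Real.exp (2 * ρ x) ≤ Er)
    (hEn : ∀ x : Space d, ‖x‖ ≤ 2 * N → Real.exp (2 * ρ x) ≤ En) :
    ∫ x, (carlemanPot a k x - κ) * Real.exp (2 * ρ x) * annCut r N x ^ 2 * u x ^ 2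
      ≤ (∫ x, 2 * (2 * sig x + C) * Real.exp (2 * ρ x) * annCut r N x ^ 2
          * (g x + k ^ 2 * u x) ^ 2)
        + (commConst C K r * Er * commForm r u g + commConst C K N * En * commForm N u g) := by
  obtain ⟨v, hv, hvu, hvg⟩ := h.exists_approx hu hg
  have hexp : ContDiff ℝ ∞ fun x ↦ Real.exp (2 * ρ x) := (contDiff_const.mul hρ).exp
  have hχ := contDiff_annCut (d := d) r N
  have hχc := hasCompactSupport_sq (hasCompactSupport_annCut (d := d) hr hN)
  have hB := contDiff_carlemanPot ha k
  have c1 : Continuous fun x ↦ (carlemanPot a k x - κ) * Real.exp (2 * ρ x) * annCut r N x ^ 2 :=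
    ContDiff.continuous (𝕜 := ℝ) (n := ∞) (by fun_prop)
  have c2 : Continuous fun x ↦ 2 * (2 * sig x + C) * Real.exp (2 * ρ x) * annCut r N x ^ 2 :=
    ContDiff.continuous (𝕜 := ℝ) (n := ∞) (by fun_prop)
  exact le_of_tendsto_of_tendsto' (hvu.integral_mul_sq c1 hχc.mul_left)
    (((hvg.add (hvu.const_mul (k ^ 2))).integral_mul_sq c2 hχc.mul_left).add
      (((tendsto_commForm hvu hvg hr).const_mul _).add
        ((tendsto_commForm hvu hvg hN).const_mul _)))
    fun n ↦ carleman_cutoff_smooth hρ ha (hv n) hρa ha0 k hκ hC hK0 hr hN hK hEr hEn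

theorem gradDot_annCut_bound {K R : ℝ} (hR : 0 < R)
    (hK : ∀ R : ℝ, 0 < R → ∀ x : Space d,
      gradDot (cut R) (cut R) x ≤ K / R ^ 2 ∧ lap (cut R) x ^ 2 ≤ K / R ^ 4) (x : Space d) :
    gradDot (annCut (R / 2) (2 * R)) (annCut (R / 2) (2 * R)) x ≤ 9 * K / R ^ 2 := by
  have hK0 : 0 ≤ K := by
    have := (gradDot_self_nonneg (cut 1) x).trans (hK 1 one_pos x).1
    simpa using this
  have h := gradDot_annCut_le (R / 2) (2 * R) x
  have h1 := (hK (2 * R) (by linarith) x).1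
  have h2 := (hK (R / 2) (half_pos hR) x).1
  have e1 : K / (2 * R) ^ 2 = K / R ^ 2 / 4 := by
    field_simp
    ring
  have e2 : K / (R / 2) ^ 2 = 4 * (K / R ^ 2) := by
    field_simp
    ring
  have e3 : 9 * K / R ^ 2 = 9 * (K / R ^ 2) := by ring
  have : 0 ≤ K / R ^ 2 := by positivity
  rw [e1] at h1
  rw [e2] at h2
  rw [e3]
  linarith

theorem commForm_le {u g : Space d → ℝ} {K M R : ℝ} (hR : 0 < R) (hu : LocL2 u) (hg : LocL2 g)
    (iu : Integrable fun x ↦ u x ^ 2) (hgu : ∀ᵐ x, g x ^ 2 ≤ M * u x ^ 2)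
    (hK : ∀ R : ℝ, 0 < R → ∀ x : Space d,
      gradDot (cut R) (cut R) x ≤ K / R ^ 2 ∧ lap (cut R) x ^ 2 ≤ K / R ^ 4) :
    commForm R u g
      ≤ (2 + M + 36 * K / R ^ 2) * ∫ x in (Metric.ball 0 (R / 2))ᶜ, u x ^ 2 := by
  have hη := contDiff_annCut (d := d) (R / 2) (2 * R)
  have hηc := hasCompactSupport_annCut (d := d) (half_pos hR) (show 0 < 2 * R by linarith)
  have c2 : Continuous fun x : Space d ↦ annCut (R / 2) (2 * R) x ^ 2 := hη.continuous.pow 2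
  have i1 := integrable_mul_sq_of_locL2 c2 (hasCompactSupport_sq hηc) hu
  have i2 := integrable_mul_sq_of_locL2 c2 (hasCompactSupport_sq hηc) hg
  have i3 := integrable_mul_sq_of_locL2 (contDiff_gradDot hη hη).continuous
    (hasCompactSupport_gradDot hηc) hu
  have hS : MeasurableSet (Metric.ball (0 : Space d) (R / 2))ᶜ := measurableSet_ball.compl
  rw [← integral_indicator hS, ← integral_const_mul, commForm, ← integral_const_mul,
    ← integral_const_mul, ← integral_add (i1.const_mul 2) i2,
    ← integral_add ((i1.const_mul 2).fun_add i2) (i3.const_mul 4)]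
  refine integral_mono_ae (((i1.const_mul 2).fun_add i2).fun_add (i3.const_mul 4))
    ((iu.indicator hS).const_mul _) ?_
  filter_upwards [hgu] with x hx
  by_cases hxb : x ∈ (Metric.ball (0 : Space d) (R / 2))ᶜ
  · rw [Set.indicator_of_mem hxb]
    have h1 := mul_le_mul_of_nonneg_right (annCut_sq_le_one (R / 2) (2 * R) x) (sq_nonneg (u x))
    have h2 := mul_le_mul_of_nonneg_right (annCut_sq_le_one (R / 2) (2 * R) x) (sq_nonneg (g x))
    have h3 := mul_le_mul_of_nonneg_right (gradDot_annCut_bound hR hK x) (sq_nonneg (u x))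
    have e : 36 * K / R ^ 2 = 4 * (9 * K / R ^ 2) := by ring
    rw [e]
    linarith
  · rw [Set.indicator_of_notMem hxb, mul_zero]
    have hxb' : ‖x‖ < R / 2 := by simpa using hxb
    have h0 : gradDot (annCut (R / 2) (2 * R)) (annCut (R / 2) (2 * R)) x = 0 := by
      refine gradDot_eq_zero_of_eventually_const (c := 0) ?_ _
      filter_upwards [continuous_norm.continuousAt.eventually_lt continuousAt_const hxb'] with y hy
      exact annCut_eq_zero (half_pos hR) (by linarith) hy.le
    rw [h0, annCut_eq_zero (half_pos hR) (by linarith) hxb'.le]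
    simp

/-- The weight `σ ~ N²` of the Carleman inequality is compensated by `|∇χ|² ~ N⁻²`. Since the bound
is uniform in `N`, the tail of `∫u²` alone makes the outer commutator vanish. -/
theorem commConst_le {C K N : ℝ} (hC : 0 ≤ C) (hK : 0 ≤ K) (hN : 1 ≤ N) :
    commConst C K N ≤ (10 + C) * (64 * K) := by
  have hN0 : 0 < N := by linarith
  have h2 : 1 ≤ N ^ 2 := one_le_pow₀ hN
  have h1 : 1 / N ^ 2 + 1 / N ^ 4 ≤ 2 / N ^ 2 := by
    have : 1 / N ^ 4 ≤ 1 / N ^ 2 :=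
      one_div_le_one_div_of_le (by positivity) (pow_le_pow_right₀ hN (by norm_num))
    have e : 2 / N ^ 2 = 1 / N ^ 2 + 1 / N ^ 2 := by ring
    linarith
  have h3 : 2 + 8 * N ^ 2 + C ≤ (10 + C) * N ^ 2 := by nlinarith
  unfold commConst
  calc (2 + 8 * N ^ 2 + C) * (32 * K * (1 / N ^ 2 + 1 / N ^ 4))
      ≤ ((10 + C) * N ^ 2) * (32 * K * (2 / N ^ 2)) :=
        mul_le_mul h3 (mul_le_mul_of_nonneg_left h1 (by positivity)) (by positivity)
          (by positivity)
    _ = (10 + C) * (64 * K) := by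
        field_simp
        ring

/-! ### Positive energies -/

theorem tendsto_setIntegral_compl_ball {f : Space d → ℝ} (hf : Integrable f) :
    Tendsto (fun n : ℕ ↦ ∫ x in (Metric.ball 0 ((n : ℝ) / 2))ᶜ, f x) atTop (𝓝 0) := by
  have h := tendsto_setIntegral_of_antitone (μ := (volume : Measure (Space d))) (f := f)
    (s := fun n : ℕ ↦ (Metric.ball 0 ((n : ℝ) / 2))ᶜ) (fun n ↦ measurableSet_ball.compl)
    (fun m n hmn ↦ Set.compl_subset_compl.2 (Metric.ball_subset_ball (by
      have : (m : ℝ) ≤ n := by exact_mod_cast hmn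
      linarith))) ⟨0, hf.integrableOn⟩
  have he : ⋂ n : ℕ, (Metric.ball (0 : Space d) ((n : ℝ) / 2))ᶜ = ∅ := by
    refine Set.eq_empty_of_forall_notMem fun x hx ↦ ?_
    obtain ⟨n, hn⟩ := exists_nat_gt (2 * ‖x‖)
    have := Set.mem_iInter.1 hx n
    simp only [Set.mem_compl_iff, mem_ball_zero_iff, not_lt] at this
    linarith
  rwa [he, setIntegral_empty] at h

/-- The Carleman inequality for solutions, with fixed weight and outer cutoff. -/
theorem helmholtz_carleman {u g : Space d → ℝ} (h : IsWeakLap u g) (hu : LocL2 u)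
    (hg : LocL2 g) {k M K C r N τ ε S : ℝ} (hk : 0 < k)
    (hb : ∀ᵐ x, |g x + k ^ 2 * u x| ≤ M / sig x * |u x|)
    (hK0 : 0 ≤ K) (hr : 0 < r) (hrN : 2 * r ≤ N) (hSN : S ≤ N)
    (hK : ∀ R : ℝ, 0 < R → ∀ x : Space d,
      gradDot (cut R) (cut R) x ≤ K / R ^ 2 ∧ lap (cut R) x ^ 2 ≤ K / R ^ 4)
    (hC : C = (d - 1) ^ 2 / (4 * (k ^ 2 / 8))) (hτ : 0 ≤ τ) (hε : 0 < ε)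
    (hw : ∀ x : Space d, r ≤ ‖x‖ →
      2 * (2 + C) * M ^ 2 / sig x + k ^ 2 / 2 ≤ carlemanPot (wtGrad τ ε) k x) :
    k ^ 2 / 4 * Real.exp (2 * wtProfile τ ε (1 + (3 * r) ^ 2))
        * ∫ x in Metric.ball 0 S \ Metric.ball 0 (3 * r), u x ^ 2
      ≤ commConst C K r * Real.exp (2 * wtProfile τ ε (1 + (2 * r) ^ 2)) * commForm r u g
        + commConst C K N * Real.exp (2 * (τ * (1 / ε) ^ (1 / 3 : ℝ))) * commForm N u g := by
  have hκ : 0 < k ^ 2 / 8 := by positivity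
  have hC0 : 0 ≤ C := by
    rw [hC]
    positivity
  have hN : 0 < N := by linarith
  have hρ := contDiff_wt (d := d) τ hε.le
  have ha := contDiff_wtGrad (d := d) τ hε.le
  have hB := contDiff_carlemanPot ha k
  have hexp : ContDiff ℝ ∞ fun x : Space d ↦ Real.exp (2 * wt τ ε x) :=
    (contDiff_const.mul hρ).exp
  have hχ := contDiff_annCut (d := d) r N
  have hχc := hasCompactSupport_sq (hasCompactSupport_annCut (d := d) hr hN)
  have main := carleman_cutoff_weak hρ ha h hu hg (pd_wt τ hε.le) (wtGrad_nonneg hτ hε.le) k hκ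
    hC hK0 hr hN hK (Er := Real.exp (2 * wtProfile τ ε (1 + (2 * r) ^ 2)))
    (En := Real.exp (2 * (τ * (1 / ε) ^ (1 / 3 : ℝ))))
    (fun x hx ↦ Real.exp_le_exp.2 (by
      have : wt τ ε x ≤ wtProfile τ ε (1 + (2 * r) ^ 2) :=
        wtProfile_mono hτ hε.le (sig_pos x) (by
          unfold sig
          nlinarith [norm_nonneg x])
      linarith))
    (fun x _ ↦ Real.exp_le_exp.2 (by
      have : wt τ ε x ≤ τ * (1 / ε) ^ (1 / 3 : ℝ) := wtProfile_le hτ hε (sig_pos x)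
      linarith))
  have c1 : Continuous fun x ↦ (carlemanPot (wtGrad τ ε) k x - k ^ 2 / 8)
      * Real.exp (2 * wt τ ε x) * annCut r N x ^ 2 :=
    ContDiff.continuous (𝕜 := ℝ) (n := ∞) (by fun_prop)
  have c2 : Continuous fun x : Space d ↦ 2 * (2 * sig x + C) * Real.exp (2 * wt τ ε x)
      * annCut r N x ^ 2 :=
    ContDiff.continuous (𝕜 := ℝ) (n := ∞) (by fun_prop)
  have c3 : Continuous fun x : Space d ↦ k ^ 2 / 4 * Real.exp (2 * wt τ ε x)
      * annCut r N x ^ 2 :=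
    ContDiff.continuous (𝕜 := ℝ) (n := ∞) (by fun_prop)
  have i1 := integrable_mul_sq_of_locL2 c1 hχc.mul_left hu
  have i2 := integrable_mul_sq_of_locL2 c2 hχc.mul_left (hg.add (hu.const_mul (k ^ 2)))
  have i3 := integrable_mul_sq_of_locL2 c3 hχc.mul_left hu
  have s1 : ∫ x, k ^ 2 / 4 * Real.exp (2 * wt τ ε x) * annCut r N x ^ 2 * u x ^ 2
      ≤ (∫ x, (carlemanPot (wtGrad τ ε) k x - k ^ 2 / 8) * Real.exp (2 * wt τ ε x)
          * annCut r N x ^ 2 * u x ^ 2)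
        - ∫ x, 2 * (2 * sig x + C) * Real.exp (2 * wt τ ε x) * annCut r N x ^ 2
          * (g x + k ^ 2 * u x) ^ 2 := by
    rw [← integral_sub i1 i2]
    refine integral_mono_ae i3 (i1.sub i2) ?_
    filter_upwards [hb] with x hx
    rcases le_or_gt ‖x‖ r with hxr | hxr
    · rw [annCut_eq_zero hr (by linarith) hxr]
      simp
    · have hσ := sig_pos x
      have hx2 : (g x + k ^ 2 * u x) ^ 2 ≤ (M / sig x) ^ 2 * u x ^ 2 := by
        rw [← sq_abs, ← sq_abs (u x), ← mul_pow]
        exact pow_le_pow_left₀ (abs_nonneg _) hx 2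
      have p1 : 2 * (2 * sig x + C) * (g x + k ^ 2 * u x) ^ 2
          -- The weight `σ` costs one of the two powers of `1/σ` in the squared potential term,
          -- leaving the `1/σ` that the Carleman weight was built to dominate.
          ≤ 2 * (2 + C) * M ^ 2 / sig x * u x ^ 2 := by
        have q1 : 2 * (2 * sig x + C) ≤ 2 * (2 + C) * sig x := by
          nlinarith [one_le_sig x]
        have q2 := mul_le_mul q1 hx2 (sq_nonneg _) (by positivity)
        refine q2.trans (le_of_eq ?_)
        field_simp
      have p2 := mul_le_mul_of_nonneg_right (hw x hxr.le) (sq_nonneg (u x))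
      -- Of the lower bound `k²/2`, the loss `κ = k²/8` is subtracted; `3k²/8` remains, and `k²/4`
      -- is kept.
      have p3 : k ^ 2 / 4 * u x ^ 2 ≤ (carlemanPot (wtGrad τ ε) k x - k ^ 2 / 8) * u x ^ 2
          - 2 * (2 * sig x + C) * (g x + k ^ 2 * u x) ^ 2 := by
        nlinarith [mul_nonneg (sq_nonneg k) (sq_nonneg (u x))]
      have p4 := mul_le_mul_of_nonneg_left p3
        (mul_nonneg (Real.exp_pos (2 * wt τ ε x)).le (sq_nonneg (annCut r N x)))
      linarith
  have s2 : k ^ 2 / 4 * Real.exp (2 * wtProfile τ ε (1 + (3 * r) ^ 2))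
        * ∫ x in Metric.ball 0 S \ Metric.ball 0 (3 * r), u x ^ 2
      ≤ ∫ x, k ^ 2 / 4 * Real.exp (2 * wt τ ε x) * annCut r N x ^ 2 * u x ^ 2 := by
    have hS : MeasurableSet (Metric.ball (0 : Space d) S \ Metric.ball 0 (3 * r)) :=
      measurableSet_ball.diff measurableSet_ball
    rw [← integral_const_mul]
    refine le_trans ?_ (setIntegral_le_integral (s := Metric.ball 0 S \ Metric.ball 0 (3 * r)) i3
      (Eventually.of_forall fun x ↦ by positivity))
    refine setIntegral_mono_on (((hu.integrableOn_sq S).mono_set Set.sdiff_subset).const_mul _)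
      i3.integrableOn hS fun x hx ↦ ?_
    have hx1 : ‖x‖ < S := by simpa using hx.1
    have hx2 : 3 * r ≤ ‖x‖ := by simpa using hx.2
    rw [annCut_eq_one hr hN (by linarith) (by linarith), one_pow, mul_one]
    refine mul_le_mul_of_nonneg_right ?_ (sq_nonneg _)
    refine mul_le_mul_of_nonneg_left (Real.exp_le_exp.2 ?_) (by positivity)
    have : wtProfile τ ε (1 + (3 * r) ^ 2) ≤ wt τ ε x :=
      wtProfile_mono hτ hε.le (by positivity) (by
        unfold sig
        nlinarith [norm_nonneg x])
    linarith
  linarith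

/-- For each large `τ` a suitable `ε` is chosen and the outer cutoff radius goes to infinity. The
mass in `3r ≤ |x| < S`, with weight at least that of `3r`, is then bounded by the inner commutator,
with weight at most that of `2r`. The gap between the two weights yields a factor `exp(-2cτ)`, and
`τ → ∞`. -/
theorem helmholtz_annulus_eq_zero {u g : Space d → ℝ} (h : IsWeakLap u g) (hu : LocL2 u)
    (hg : LocL2 g) (iu : Integrable fun x ↦ u x ^ 2) {k M : ℝ} (hk : 0 < k) (hM : 0 ≤ M)
    (hb : ∀ᵐ x, |g x + k ^ 2 * u x| ≤ M / sig x * |u x|) {r S : ℝ} (hr : 0 < r) :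
    ∫ x in Metric.ball 0 S \ Metric.ball 0 (3 * r), u x ^ 2 ≤ 0 := by
  obtain ⟨K, hK0, hK⟩ := exists_cut_bound d
  obtain ⟨C, hC⟩ : ∃ C : ℝ, C = ((d : ℝ) - 1) ^ 2 / (4 * (k ^ 2 / 8)) := ⟨_, rfl⟩
  have hC0 : 0 ≤ C := by
    rw [hC]
    positivity
  have hgu : ∀ᵐ x, g x ^ 2 ≤ (M + k ^ 2) ^ 2 * u x ^ 2 := by
    filter_upwards [hb] with x hx
    have h1 : M / sig x ≤ M := div_le_self hM (one_le_sig x)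
    have h2 : |g x| ≤ (M + k ^ 2) * |u x| := by
      have e : g x = (g x + k ^ 2 * u x) - k ^ 2 * u x := by ring
      have h3 := abs_sub (g x + k ^ 2 * u x) (k ^ 2 * u x)
      rw [← e, abs_mul, abs_of_nonneg (sq_nonneg k)] at h3
      linarith [mul_le_mul_of_nonneg_right h1 (abs_nonneg (u x))]
    rw [← sq_abs, ← sq_abs (u x), ← mul_pow]
    exact pow_le_pow_left₀ (abs_nonneg _) h2 2
  set I := ∫ x in Metric.ball 0 S \ Metric.ball 0 (3 * r), u x ^ 2 with hI
  set F := commConst C K r * commForm r u g with hF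
  obtain ⟨c, hc0, hc⟩ := exists_wtProfile_gap (s := 1 + (2 * r) ^ 2) (t := 1 + (3 * r) ^ 2)
    (by nlinarith) (by nlinarith)
  obtain ⟨τ₀, hτ₀, hτ⟩ := exists_weight d (K := 2 * (2 + C) * M ^ 2) (by positivity) hk hr
  have key : ∀ τ : ℝ, τ₀ ≤ τ → k ^ 2 / 4 * I ≤ |F| * Real.exp (-(2 * c * τ)) := by
    intro τ hττ
    have hτ0 : 0 < τ := hτ₀.trans_le hττ
    obtain ⟨ε, hε, hε1, hw⟩ := hτ τ hττ
    set E := Real.exp (2 * (τ * (1 / ε) ^ (1 / 3 : ℝ))) with hE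
    -- With `τ` and `ε` fixed the weight is bounded by `E`, so the outer commutator is a constant
    -- times a tail of `∫u²`.
    have hlim := ((tendsto_setIntegral_compl_ball iu).const_mul
      ((10 + C) * (64 * K) * E * (2 + (M + k ^ 2) ^ 2 + 36 * K))).const_add
      (commConst C K r * Real.exp (2 * wtProfile τ ε (1 + (2 * r) ^ 2)) * commForm r u g)
    rw [mul_zero, add_zero] at hlim
    have hle : k ^ 2 / 4 * Real.exp (2 * wtProfile τ ε (1 + (3 * r) ^ 2)) * I
        ≤ commConst C K r * Real.exp (2 * wtProfile τ ε (1 + (2 * r) ^ 2)) * commForm r u g := by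
      refine ge_of_tendsto hlim ?_
      filter_upwards [eventually_ge_atTop (⌈max 1 (max (2 * r) S)⌉₊)] with n hn
      have hn' : max 1 (max (2 * r) S) ≤ (n : ℝ) := Nat.ceil_le.1 hn
      have hn1 : (1 : ℝ) ≤ n := (le_max_left _ _).trans hn'
      have hn2 : 2 * r ≤ n := (le_max_left _ _).trans ((le_max_right _ _).trans hn')
      have hn3 : S ≤ n := (le_max_right _ _).trans ((le_max_right _ _).trans hn')
      have hn0 : (0 : ℝ) < n := by linarith
      have h1 := helmholtz_carleman h hu hg hk hb hK0.le hr hn2 hn3 hK hC hτ0.le hε hw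
      refine h1.trans (add_le_add_right ?_ _)
      have h2 := commForm_le hn0 hu hg iu hgu hK
      have hT : 0 ≤ ∫ x in (Metric.ball 0 ((n : ℝ) / 2))ᶜ, u x ^ 2 :=
        integral_nonneg fun x ↦ sq_nonneg _
      have h3 : 36 * K / (n : ℝ) ^ 2 ≤ 36 * K :=
        div_le_self (by positivity) (one_le_pow₀ hn1)
      have h4 : commForm n u g ≤ (2 + (M + k ^ 2) ^ 2 + 36 * K)
          * ∫ x in (Metric.ball 0 ((n : ℝ) / 2))ᶜ, u x ^ 2 :=
        h2.trans (mul_le_mul_of_nonneg_right (by linarith) hT)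
      have h5 := commConst_le hC0 hK0.le hn1
      have hE0 : 0 ≤ E := (Real.exp_pos _).le
      have h6 := commConst_nonneg (R := n) hC0 hK0.le
      calc commConst C K n * E * commForm n u g
          ≤ commConst C K n * E * ((2 + (M + k ^ 2) ^ 2 + 36 * K)
            * ∫ x in (Metric.ball 0 ((n : ℝ) / 2))ᶜ, u x ^ 2) :=
            mul_le_mul_of_nonneg_left h4 (mul_nonneg h6 hE0)
        _ ≤ (10 + C) * (64 * K) * E * ((2 + (M + k ^ 2) ^ 2 + 36 * K)
            * ∫ x in (Metric.ball 0 ((n : ℝ) / 2))ᶜ, u x ^ 2) :=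
            mul_le_mul_of_nonneg_right (mul_le_mul_of_nonneg_right h5 hE0)
              (mul_nonneg (by positivity) hT)
        _ = _ := by ring
    have hgap := hc τ ε hτ0.le hε.le hε1
    have hexp : Real.exp (2 * wtProfile τ ε (1 + (2 * r) ^ 2))
        ≤ Real.exp (2 * wtProfile τ ε (1 + (3 * r) ^ 2)) * Real.exp (-(2 * c * τ)) := by
      rw [← Real.exp_add]
      exact Real.exp_le_exp.2 (by linarith)
    have hp := Real.exp_pos (2 * wtProfile τ ε (1 + (3 * r) ^ 2))
    have h7 : Real.exp (2 * wtProfile τ ε (1 + (3 * r) ^ 2)) * (k ^ 2 / 4 * I)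
        ≤ Real.exp (2 * wtProfile τ ε (1 + (3 * r) ^ 2)) * (|F| * Real.exp (-(2 * c * τ))) := by
      have h8 : commConst C K r * Real.exp (2 * wtProfile τ ε (1 + (2 * r) ^ 2))
          * commForm r u g ≤ |F| * Real.exp (2 * wtProfile τ ε (1 + (2 * r) ^ 2)) := by
        have := mul_le_mul_of_nonneg_right (le_abs_self F)
          (Real.exp_pos (2 * wtProfile τ ε (1 + (2 * r) ^ 2))).le
        rw [hF] at this ⊢
        linarith
      have h9 := mul_le_mul_of_nonneg_left hexp (abs_nonneg F)
      linarith
    exact le_of_mul_le_mul_left h7 hp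
  have hlim : Tendsto (fun τ : ℝ ↦ |F| * Real.exp (-(2 * c * τ))) atTop (𝓝 0) := by
    have h1 : Tendsto (fun τ : ℝ ↦ 2 * c * τ) atTop atTop :=
      tendsto_id.const_mul_atTop (by positivity)
    simpa using (Real.tendsto_exp_neg_atTop_nhds_zero.comp h1).const_mul |F|
  have hfin : k ^ 2 / 4 * I ≤ 0 :=
    ge_of_tendsto hlim ((eventually_ge_atTop τ₀).mono key)
  have hk4 : 0 < k ^ 2 / 4 := by positivity
  by_contra hcon
  exact absurd hfin (not_le.2 (mul_pos hk4 (not_le.1 hcon)))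

/-- Absence of positive eigenvalues: a square integrable solution of `Δu + k²u = f` with
`|f| ≤ M ⟨x⟩⁻² |u|` vanishes. -/
theorem eq_zero_of_helmholtz (hd : 1 ≤ d) {u g : Space d → ℝ} (h : IsWeakLap u g) (hu : LocL2 u)
    (hg : LocL2 g) (iu : Integrable fun x ↦ u x ^ 2) {k M : ℝ} (hk : 0 < k) (hM : 0 ≤ M)
    (hb : ∀ᵐ x, |g x + k ^ 2 * u x| ≤ M / sig x * |u x|) : u =ᵐ[volume] 0 := by
  have h1 : ∀ n : ℕ, ∀ᵐ x ∂volume.restrict (Metric.ball (0 : Space d) (n + 1) \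
      Metric.ball 0 (3 * (1 / (n + 1)))), u x = 0 := by
    intro n
    have h0 := helmholtz_annulus_eq_zero h hu hg iu hk hM hb (r := 1 / ((n : ℝ) + 1))
      (S := n + 1) (by positivity)
    have h2 : ∀ x, 0 ≤ u x ^ 2 := fun x ↦ sq_nonneg _
    have := (setIntegral_eq_zero_iff_of_nonneg_ae (Eventually.of_forall h2) iu.integrableOn).1
      (le_antisymm h0 (integral_nonneg h2))
    filter_upwards [this] with x hx
    simpa using hx
  have h2 := (ae_restrict_iUnion_iff _ (fun x ↦ u x = 0) (μ := volume)).2 h1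
  -- The inner radius `r` is arbitrary, so the annuli exhaust everything but the origin, a null set.
  have hU : (⋃ n : ℕ, Metric.ball (0 : Space d) (n + 1) \ Metric.ball 0 (3 * (1 / (n + 1))))
      ⊇ {0}ᶜ := by
    intro x hx
    have hx0 : 0 < ‖x‖ := norm_pos_iff.2 hx
    obtain ⟨n, hn⟩ := exists_nat_gt (max ‖x‖ (3 / ‖x‖))
    have hn1 := (le_max_left _ _).trans_lt hn
    have hn2 := (le_max_right _ _).trans_lt hn
    rw [div_lt_iff₀ hx0] at hn2
    refine Set.mem_iUnion.2 ⟨n, ?_, ?_⟩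
    · rw [mem_ball_zero_iff]
      linarith
    · rw [mem_ball_zero_iff, not_lt, mul_one_div, div_le_iff₀ (by positivity)]
      nlinarith
  have h3 := ae_restrict_of_ae_restrict_of_subset hU h2
  have : Nonempty (Fin d) := ⟨⟨0, hd⟩⟩
  have hnull : (volume : Measure (Space d)) {0} = 0 := measure_singleton 0
  rw [ae_restrict_iff' (measurableSet_singleton 0).compl] at h3
  filter_upwards [h3, compl_mem_ae_iff.2 hnull] with x hx hx0
  exact hx hx0

/-! ### From the complex `L²` setting to real weak equations -/

theorem isWeakLap_re_im {u g : Space d → ℂ} (hu : LocallyIntegrable u) (hg : LocallyIntegrable g)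
    (h : ∀ η : Space d → ℝ, ContDiff ℝ ∞ η → HasCompactSupport η →
      ∫ x, u x * (lap η x : ℂ) = ∫ x, g x * (η x : ℂ)) :
    IsWeakLap (fun x ↦ (u x).re) (fun x ↦ (g x).re) ∧
      IsWeakLap (fun x ↦ (u x).im) (fun x ↦ (g x).im) := by
  have key : ∀ {f : Space d → ℂ}, LocallyIntegrable f → ∀ {η : Space d → ℝ}, Continuous η →
      HasCompactSupport η → Integrable fun x ↦ f x * (η x : ℂ) := by
    intro f hf η hη hc
    refine (hf.integrable_smul_left_of_hasCompactSupport hη hc).congr (.of_forall fun x ↦ ?_)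
    simp [Complex.real_smul, mul_comm]
  have hre : ∀ {f : Space d → ℂ}, LocallyIntegrable f → LocallyIntegrable fun x ↦ (f x).re :=
    fun hf x ↦ let ⟨s, hs, hi⟩ := hf x; ⟨s, hs, Integrable.re hi⟩
  have him : ∀ {f : Space d → ℂ}, LocallyIntegrable f → LocallyIntegrable fun x ↦ (f x).im :=
    fun hf x ↦ let ⟨s, hs, hi⟩ := hf x; ⟨s, hs, Integrable.im hi⟩
  refine ⟨⟨hre hu, hre hg, fun η hη hc ↦ ?_⟩, ⟨him hu, him hg, fun η hη hc ↦ ?_⟩⟩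
  · have i1 := key hu (contDiff_lap hη).continuous (hasCompactSupport_lap hc)
    have i2 := key hg hη.continuous hc
    have e1 := integral_re i1
    have e2 := integral_re i2
    rw [h η hη hc, ← e2] at e1
    simpa using e1
  · have i1 := key hu (contDiff_lap hη).continuous (hasCompactSupport_lap hc)
    have i2 := key hg hη.continuous hc
    have e1 := integral_im i1
    have e2 := integral_im i2
    rw [h η hη hc, ← e2] at e1
    simpa using e1

/-- A compactly supported smooth function is a Schwartz function, so the tempered identity defining
`laplacianFun` can be tested with it. -/
theorem integral_laplacianFun_mul (φ : sobolevTwo d) {η : Space d → ℝ} (hη : ContDiff ℝ ∞ η)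
    (hc : HasCompactSupport η) :
    ∫ x, (φ : L2 d) x * (lap η x : ℂ) = ∫ x, laplacianFun φ x * (η x : ℂ) := by
  have hη' : ContDiff ℝ ∞ fun x ↦ (η x : ℂ) := Complex.ofRealCLM.contDiff.comp hη
  have hc' : HasCompactSupport fun x ↦ (η x : ℂ) := hc.comp_left Complex.ofReal_zero
  have h := congrArg (fun T : TemperedDistribution (Space d) ℂ ↦ T (hc'.toSchwartzMap hη'))
    (toDistr_laplacianFun φ)
  simp only [TemperedDistribution.laplacian_apply_apply, Lp.toTemperedDistribution_apply,
    SchwartzMap.laplacian_apply, smul_eq_mul] at h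
  rw [show ((hc'.toSchwartzMap hη' : SchwartzMap (Space d) ℂ) : Space d → ℂ) =
    fun x ↦ (η x : ℂ) from rfl] at h
  simp only [laplacian_ofReal hη] at h
  simpa only [mul_comm] using h.symm

theorem bracket_eq_sqrt (x : Space d) : bracket x = √(sig x) := rfl

theorem one_le_bracket (x : Space d) : 1 ≤ bracket x := Real.one_le_sqrt.2 (one_le_sig x)

/-- The decay exponent enters only through this comparison with `⟨x⟩⁻²`, so the smallness constant
does not depend on `α`. -/
theorem bracket_rpow_neg_le {α : ℝ} (hα : 2 < α) (x : Space d) :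
    bracket x ^ (-α) ≤ (sig x)⁻¹ := by
  calc bracket x ^ (-α) ≤ bracket x ^ (-2 : ℝ) :=
        Real.rpow_le_rpow_of_exponent_le (one_le_bracket x) (by linarith)
    _ = (sig x)⁻¹ := by
        rw [Real.rpow_neg (zero_le_one.trans (one_le_bracket x)), Real.rpow_two, bracket_eq_sqrt,
          Real.sq_sqrt (sig_pos x).le]

theorem bracket_rpow_neg_sq (x : Space d) :
    (bracket x ^ (-(3 / 4) : ℝ)) ^ 2 = sig x ^ (-(3 / 4) : ℝ) := by
  rw [bracket_eq_sqrt, Real.sqrt_eq_rpow, ← Real.rpow_natCast, ← Real.rpow_mul (sig_pos x).le,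
    ← Real.rpow_mul (sig_pos x).le]
  norm_num

theorem sig_rpow_le_one (x : Space d) : sig x ^ (-(3 / 4) : ℝ) ≤ 1 :=
  Real.rpow_le_one_of_one_le_of_nonpos (one_le_sig x) (by norm_num)

theorem continuous_sig_rpow (s : ℝ) : Continuous fun x : Space d ↦ sig x ^ s :=
  contDiff_sig.continuous.rpow_const fun x ↦ Or.inl (sig_pos x).ne'

theorem continuous_bracket_rpow (s : ℝ) : Continuous fun x : Space d ↦ bracket x ^ s :=
  (contDiff_sig.continuous.sqrt).rpow_const
    fun x ↦ Or.inl (zero_lt_one.trans_le (one_le_bracket x)).ne'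

theorem integrable_sig_rpow_mul_sq {u : Space d → ℝ} (hu : MemLp u 2 volume) :
    Integrable fun x ↦ sig x ^ (-(3 / 4) : ℝ) * u x ^ 2 := by
  refine hu.integrable_sq.mono' ((continuous_sig_rpow _).aestronglyMeasurable.mul
    hu.integrable_sq.aestronglyMeasurable) (.of_forall fun x ↦ ?_)
  have h := Real.rpow_nonneg (sig_pos x).le (-(3 / 4))
  rw [Real.norm_of_nonneg (by positivity)]
  exact mul_le_of_le_one_left (sq_nonneg _) (sig_rpow_le_one x)

theorem locL2_of_memLp {u : Space d → ℝ} (hu : MemLp u 2 volume) : LocL2 u :=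
  fun _ ↦ hu.restrict _

/-- Multiplication by `⟨x⟩^(3/4)`, bounded on balls, undoes the weight. -/
theorem locL2_of_weighted {u : Space d → ℝ}
    (hu : MemLp (fun x ↦ bracket x ^ (-(3 / 4) : ℝ) * u x) 2 volume) : LocL2 u := by
  intro R
  have e : ∀ x : Space d, u x = bracket x ^ (3 / 4 : ℝ) * (bracket x ^ (-(3 / 4) : ℝ) * u x) := by
    intro x
    have h0 := zero_lt_one.trans_le (one_le_bracket x)
    rw [← mul_assoc, ← Real.rpow_add h0]
    norm_num
  obtain ⟨K, hK⟩ := (isCompact_closedBall (0 : Space d) R).exists_bound_of_continuousOn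
    (continuous_bracket_rpow (d := d) (3 / 4)).continuousOn
  have hm : AEStronglyMeasurable u volume :=
    ((continuous_bracket_rpow (3 / 4)).aestronglyMeasurable.mul hu.aestronglyMeasurable).congr
      (.of_forall fun x ↦ (e x).symm)
  refine (hu.restrict (Metric.ball 0 R)).of_le_mul (c := K) hm.restrict ?_
  filter_upwards [ae_restrict_mem measurableSet_ball] with x hx
  conv_lhs => rw [e x, norm_mul]
  exact mul_le_mul_of_nonneg_right (hK x (Metric.ball_subset_closedBall hx)) (norm_nonneg _)

/-! ### Eigenvalues and resonances of the Schrödinger operator -/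

/-- The two-sided bound on the potential that the decay hypotheses provide. -/
structure IsSmallNegative (V : Space d → ℝ) (C δ : ℝ) : Prop where
  le : ∀ᵐ x, V x ≤ C * (sig x)⁻¹
  ge : ∀ᵐ x, -(δ * (sig x)⁻¹) ≤ V x

/-- Since `-E ≥ 0`, the product `u g = 2(V-E)u²` is at least `-2δu²/σ`, and `2δ ≤ 1/8` is what the
Hardy argument requires. -/
theorem eq_zero_of_nonpos_energy (hd : 3 ≤ d) {V u g : Space d → ℝ} {C δ E : ℝ}
    (hV : IsSmallNegative V C δ) (hδ : δ ≤ 1 / 16) (hE : E ≤ 0) (h : IsWeakLap u g)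
    (hu : LocL2 u) (hg : LocL2 g) (hgu : ∀ᵐ x, g x = 2 * (V x - E) * u x)
    (hw : Integrable fun x ↦ sig x ^ (-(3 / 4) : ℝ) * u x ^ 2) : u =ᵐ[volume] 0 := by
  refine eq_zero_of_form_nonneg hd h hu hg ?_ hw
  filter_upwards [hV.ge, hgu] with x h1 h2
  have hs := inv_pos.2 (sig_pos x)
  have h3 : δ * (sig x)⁻¹ ≤ 1 / 16 * (sig x)⁻¹ := mul_le_mul_of_nonneg_right hδ hs.le
  rw [h2]
  nlinarith [sq_nonneg (u x)]

/-- With `k² = 2E` the equation reads `Δu + k²u = 2Vu`, and `|2V| ≤ 2(C+δ)/σ`. -/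
theorem eq_zero_of_pos_energy (hd : 1 ≤ d) {V u g : Space d → ℝ} {C δ E : ℝ} (hC : 0 ≤ C)
    (hδ : 0 ≤ δ) (hV : IsSmallNegative V C δ) (hE : 0 < E) (h : IsWeakLap u g) (hu : MemLp u 2 volume)
    (hg : LocL2 g) (hgu : ∀ᵐ x, g x = 2 * (V x - E) * u x) : u =ᵐ[volume] 0 := by
  refine eq_zero_of_helmholtz hd h (locL2_of_memLp hu) hg hu.integrable_sq (k := √(2 * E))
    (M := 2 * (C + δ)) (by positivity) (by positivity) ?_
  filter_upwards [hV.le, hV.ge, hgu] with x h1 h2 h3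
  have hs := inv_pos.2 (sig_pos x)
  rw [h3, Real.sq_sqrt (by positivity), show 2 * (V x - E) * u x + 2 * E * u x = 2 * V x * u x by
    ring, abs_mul, div_eq_mul_inv]
  refine mul_le_mul_of_nonneg_right (abs_le.2 ⟨?_, ?_⟩) (abs_nonneg _)
  · nlinarith [mul_nonneg hC hs.le]
  · nlinarith [mul_nonneg hδ hs.le]

theorem not_isEigenvalue (hd : 3 ≤ d) {V : Space d → ℝ} {C δ : ℝ} (hC : 0 ≤ C) (hδ : 0 ≤ δ)
    (hδ' : δ ≤ 1 / 16) (hV : IsSmallNegative V C δ) (z : ℂ) :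
    ¬ IsEigenvalue (hamiltonian V) z := by
  rintro ⟨⟨φ, hφ⟩, hne, heq⟩
  obtain ⟨h1, h2⟩ := mem_hamiltonian_domain.1 hφ
  rw [hamiltonian_apply φ hφ h1 h2] at heq
  set ψ : L2 d := laplacianFun ⟨φ, h1⟩ with hψ
  have hψφ : ∀ᵐ x, ψ x = 2 * ((V x : ℂ) - z) * φ x := by
    have hae : ((-(1 / 2 : ℂ)) • ψ + potentialFun V ⟨φ, h2⟩ : L2 d) =ᵐ[volume] (z • φ : L2 d) := by
      rw [heq]
    filter_upwards [hae, Lp.coeFn_add ((-(1 / 2 : ℂ)) • ψ) (potentialFun V ⟨φ, h2⟩),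
      Lp.coeFn_smul (-(1 / 2 : ℂ)) ψ, Lp.coeFn_smul z φ, coeFn_potentialFun V ⟨φ, h2⟩]
      with x e1 e2 e3 e4 e5
    rw [e2, Pi.add_apply, e3, e4, e5, Pi.smul_apply, Pi.smul_apply, smul_eq_mul, smul_eq_mul] at e1
    linear_combination (-2) * e1
  have mφ := Lp.memLp φ
  have mψ := Lp.memLp ψ
  obtain ⟨hre, him⟩ := isWeakLap_re_im (mφ.locallyIntegrable (by norm_num))
    (mψ.locallyIntegrable (by norm_num)) fun η hη hc ↦ integral_laplacianFun_mul ⟨φ, h1⟩ hη hc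
  have ma : MemLp (fun x ↦ (φ x).re) 2 volume := mφ.re
  have mb : MemLp (fun x ↦ (φ x).im) 2 volume := mφ.im
  have ma' : MemLp (fun x ↦ (ψ x).re) 2 volume := mψ.re
  have mb' : MemLp (fun x ↦ (ψ x).im) 2 volume := mψ.im
  have ea : ∀ᵐ x, (ψ x).re = 2 * (V x - z.re) * (φ x).re + 2 * z.im * (φ x).im := by
    filter_upwards [hψφ] with x hx
    rw [hx]
    simp
  have eb : ∀ᵐ x, (ψ x).im = 2 * (V x - z.re) * (φ x).im - 2 * z.im * (φ x).re := by
    filter_upwards [hψφ] with x hx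
    rw [hx]
    simp
    ring
  suffices H : (fun x ↦ (φ x).re) =ᵐ[volume] 0 ∧ (fun x ↦ (φ x).im) =ᵐ[volume] 0 by
    refine hne ((Lp.eq_zero_iff_ae_eq_zero).2 ?_)
    filter_upwards [H.1, H.2] with x h1 h2
    exact Complex.ext h1 h2
  -- With `a`, `b` the parts of `φ`, the Wronskian `aΔb - bΔa` equals `-2 Im z (a² + b²)`. For `Im z
  -- > 0` the roles of `a` and `b` are exchanged to make the constant positive.
  rcases lt_trichotomy z.im 0 with hz | hz | hz
  · refine eq_zero_of_wronskian hre him (locL2_of_memLp ma) (locL2_of_memLp mb)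
      (locL2_of_memLp ma') (locL2_of_memLp mb') ma.integrable_sq mb.integrable_sq
      ma'.integrable_sq mb'.integrable_sq (c := -2 * z.im) (by linarith) ?_
    filter_upwards [ea, eb] with x h1 h2
    rw [h1, h2]
    ring
  · simp only [hz, mul_zero, zero_mul, add_zero, sub_zero] at ea eb
    rcases le_or_gt z.re 0 with hE | hE
    · exact ⟨eq_zero_of_nonpos_energy hd hV hδ' hE hre (locL2_of_memLp ma) (locL2_of_memLp ma') ea
          (integrable_sig_rpow_mul_sq ma),
        eq_zero_of_nonpos_energy hd hV hδ' hE him (locL2_of_memLp mb) (locL2_of_memLp mb') eb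
          (integrable_sig_rpow_mul_sq mb)⟩
    · exact ⟨eq_zero_of_pos_energy (by omega) hC hδ hV hE hre ma (locL2_of_memLp ma') ea,
        eq_zero_of_pos_energy (by omega) hC hδ hV hE him mb (locL2_of_memLp mb') eb⟩
  · refine And.symm (eq_zero_of_wronskian him hre (locL2_of_memLp mb) (locL2_of_memLp ma)
      (locL2_of_memLp mb') (locL2_of_memLp ma') mb.integrable_sq ma.integrable_sq
      mb'.integrable_sq ma'.integrable_sq (c := 2 * z.im) (by linarith) ?_)
    filter_upwards [ea, eb] with x h1 h2
    rw [h1, h2]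
    ring

/-- This is the case `E = 0`; boundedness of `V` gives the local square integrability of `g`, and
the square of `⟨x⟩^(-3/4)` is the weight `σ^(-3/4)`. -/
theorem eq_zero_of_weighted_of_isWeakLap (hd : 3 ≤ d) {V u g : Space d → ℝ} {C δ : ℝ} (hC : 0 ≤ C)
    (hδ : 0 ≤ δ) (hδ' : δ ≤ 1 / 16) (hV : IsSmallNegative V C δ)
    (hu : MemLp (fun x ↦ bracket x ^ (-(3 / 4) : ℝ) * u x) 2 volume)
    (hgu : ∀ x, g x = 2 * V x * u x) (h : IsWeakLap u g) : u =ᵐ[volume] 0 := by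
  have hloc := locL2_of_weighted hu
  refine eq_zero_of_nonpos_energy hd hV hδ' le_rfl h hloc
    (hloc.of_le (M := 2 * (C + δ)) h.right.aestronglyMeasurable ?_)
    (.of_forall fun x ↦ by rw [hgu, sub_zero]) ?_
  · filter_upwards [hV.le, hV.ge] with x h1 h2
    have hs := inv_pos.2 (sig_pos x)
    have hs1 := inv_le_one_of_one_le₀ (one_le_sig x)
    have hCs : C * (sig x)⁻¹ ≤ C := mul_le_of_le_one_right hC hs1
    have hds : δ * (sig x)⁻¹ ≤ δ := mul_le_of_le_one_right hδ hs1
    rw [hgu, abs_mul]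
    exact mul_le_mul_of_nonneg_right (abs_le.2 ⟨by linarith, by linarith⟩) (abs_nonneg _)
  · refine hu.integrable_sq.congr (.of_forall fun x ↦ ?_)
    simp only [mul_pow, bracket_rpow_neg_sq]

theorem not_hasZeroResonance (hd : 3 ≤ d) {V : Space d → ℝ} {C δ : ℝ} (hC : 0 ≤ C) (hδ : 0 ≤ δ)
    (hδ' : δ ≤ 1 / 16) (hV : IsSmallNegative V C δ) : ¬ HasZeroResonance V := by
  rintro ⟨u, hne, hw, hu, hVu, hsol⟩
  -- One exponent above `1/2` and below `1` is enough for the cutoff error to vanish.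
  have hw := hw (3 / 4) (by norm_num)
  have hg : LocallyIntegrable fun x ↦ 2 * ((V x : ℂ) * u x) := hVu.smul (2 : ℂ)
  obtain ⟨hre, him⟩ := isWeakLap_re_im hu hg fun η hη hc ↦ by
    have h := hsol (fun x ↦ (η x : ℂ)) (Complex.ofRealCLM.contDiff.comp hη)
      (hc.comp_left Complex.ofReal_zero)
    have i1 : Integrable fun x ↦ u x * (lap η x : ℂ) := by
      refine (hu.integrable_smul_left_of_hasCompactSupport (contDiff_lap hη).continuous
        (hasCompactSupport_lap hc)).congr (.of_forall fun x ↦ ?_)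
      simp [Complex.real_smul, mul_comm]
    have i2 : Integrable fun x ↦ (V x : ℂ) * u x * (η x : ℂ) := by
      refine (hVu.integrable_smul_left_of_hasCompactSupport hη.continuous hc).congr
        (.of_forall fun x ↦ ?_)
      simp [Complex.real_smul, mul_comm, mul_left_comm]
    have e : ∀ x, u x * (-(1 / 2 : ℂ) * Δ (fun x ↦ (η x : ℂ)) x) + (V x : ℂ) * u x * (η x : ℂ) =
        (-(1 / 2 : ℂ)) * (u x * (lap η x : ℂ)) + (V x : ℂ) * u x * (η x : ℂ) := by
      intro x
      rw [laplacian_ofReal hη]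
      ring
    simp only [e] at h
    rw [integral_add (i1.const_mul _) i2, integral_const_mul] at h
    have e2 : ∀ x, 2 * ((V x : ℂ) * u x) * (η x : ℂ) = 2 * ((V x : ℂ) * u x * (η x : ℂ)) :=
      fun x ↦ by ring
    simp only [e2]
    rw [integral_const_mul]
    linear_combination (-2) * h
  have ha : (fun x ↦ (u x).re) =ᵐ[volume] 0 := by
    refine eq_zero_of_weighted_of_isWeakLap hd hC hδ hδ' hV ?_ (fun x ↦ ?_) hre
    · exact (MemLp.re hw).ae_eq (.of_forall fun x ↦ by simp)
    · simp
      ring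
  have hb : (fun x ↦ (u x).im) =ᵐ[volume] 0 := by
    refine eq_zero_of_weighted_of_isWeakLap hd hC hδ hδ' hV ?_ (fun x ↦ ?_) him
    · exact (MemLp.im hw).ae_eq (.of_forall fun x ↦ by simp)
    · simp
      ring
  refine hne ?_
  filter_upwards [ha, hb] with x h1 h2
  exact Complex.ext h1 h2

end Schrodinger

end

theorem proposition1p8 (d : ℕ) (hd : 3 ≤ d) (α : ℝ) (hα : 2 < α) :
    ∃ δ₀ : ℝ, 0 < δ₀ ∧
      ∀ (V : EuclideanSpace ℝ (Fin d) → ℝ), AEMeasurable V MeasureTheory.volume →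
      ∀ C δ : ℝ, 0 < C → 0 < δ → δ ≤ δ₀ →
      (∀ᵐ x ∂MeasureTheory.volume, max (V x) 0 ≤ C * Schrodinger.bracket x ^ (-α)) →
      (∀ᵐ x ∂MeasureTheory.volume, max (-(V x)) 0 ≤ δ * Schrodinger.bracket x ^ (-α)) →
      (∀ z : ℂ, ¬ Schrodinger.IsEigenvalue (Schrodinger.hamiltonian V) z) ∧
        ¬ Schrodinger.HasZeroResonance V := by
  -- Hardy's constant `4` and the factor `2` from `-½Δ` give the relative bound `4 · 2 · (1/16) =
  -- 1/2 < 1`.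
  refine ⟨1 / 16, by norm_num, fun V _ C δ hC hδ hδ' hp hn ↦ ?_⟩
  have hV : Schrodinger.IsSmallNegative V C δ := by
    refine ⟨?_, ?_⟩
    · filter_upwards [hp] with x hx
      exact (le_max_left _ _).trans (hx.trans
        (mul_le_mul_of_nonneg_left (Schrodinger.bracket_rpow_neg_le hα x) hC.le))
    · filter_upwards [hn] with x hx
      have := (le_max_left _ _).trans (hx.trans
        (mul_le_mul_of_nonneg_left (Schrodinger.bracket_rpow_neg_le hα x) hδ.le))
      linarith
  exact ⟨Schrodinger.not_isEigenvalue hd hC.le hδ.le hδ' hV,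
    Schrodinger.not_hasZeroResonance hd hC.le hδ.le hδ' hV⟩
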